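/- Let $M$ be a smooth manifold and $(A,\rho,[\cdot,\cdot])$ a regular Lie algebroid over $M$: $A\to M$ is a smooth vector bundle, $\rho\colon A\to T_M$ is a bundle map of constant rank, and $[\cdot,\cdot]$ is a real Lie bracket on $\Gamma(A)$ with $\rho[a,b]=[\rho a,\rho b]$ and $[a,fb]=f[a,b]+(\rho(a)f)\,b$. Put $K=\ker\rho\subseteq A$, $F=\operatorname{Im}\rho\subseteq T_M$, $B=T_M/F$, with projection $\mathrm{pr}_B\colon T_M\to B$. Let $(\tau,j,\nabla^K,\nabla^F)$ be a quadruple such that * $\tau\colon F\to A$ and $j\colon B\to T_M$ are bundle maps with $\rho\circ\tau=\mathrm{id}_F$ and $\mathrm{pr}_B\circ j=\mathrm{id}_B$; write $\mathrm{pr}_F=\mathrm{id}-j\,\mathrm{pr}_B\colon T_M\to F$, $\mathrm{pr}_K=\mathrm{id}-\tau\rho\colon A\to K$, $u_F=\mathrm{pr}_F(u)$, $a_K=\mathrm{pr}_K(a)$, $a_F=\rho(a)$; * $\nabla^K$ is a linear connection on $K$ with $\nabla^K_u k=[\tau(u),k]$ for $u\in\Gamma(F)$, $k\in\Gamma(K)$;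 * $\nabla^F$ is a linear connection on $F$ with $\nabla^F_uv-\nabla^F_vu=[u,v]$ for $u,v\in\Gamma(F)$ and $\nabla^F_{j(b)}u=\mathrm{pr}_F[j(b),u]$ for $b\in\Gamma(B)$, $u\in\Gamma(F)$. Let $\nabla^A$ be the linear connection on $A$ given by $$\nabla^A_ua=\nabla^K_ua_K+\tau(\nabla^F_ua_F)+R^\tau(u_F,a_F),\qquad R^\tau(u,v)=[\tau(u),\tau(v)]-\tau([u,v])\quad(u,v\in\Gamma(F)),$$ and let, for $a,b\in\Gamma(A)$, $u\in\Gamma(T_M)$, $$\nabla^{\mathrm{bas}}_au=\rho(\nabla^A_ua)+[\rho(a),u],\qquad \nabla^{\mathrm{bas}}_ab=\nabla^A_{\rho(b)}a+[a,b],$$ $$R^{\mathrm{bas}}(u)(a,b)=\nabla^A_u[a,b]-[\nabla^A_ua,b]-[a,\nabla^A_ub]-\nabla^A_{\nabla^{\mathrm{bas}}_bu}a+\nabla^A_{\nabla^{\mathrm{bas}}_au}b .$$ For a graded vector bundle $E$ over $M$ let $\Omega_A(E)=\Gamma(\wedge A^*\otimes E)$, a left module over $\Omega_A=\Gamma(\wedge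 A^*)$, graded by total degree; $A[1]$ and $K[1]$ sit in degree $-1$, $T_M$ and $B$ in degree $0$. An $\Omega_A$-linear map $g$ of degree $r$ is one with $g(\alpha x)=(-1)^{r|\alpha|}\alpha\,g(x)$. On $\Omega_A(A[1]\oplus T_M)$ let $$D_{\nabla^A}=\begin{pmatrix} d_{\nabla^{\mathrm{bas}}} & R^{\mathrm{bas}}\\ \rho & d_{\nabla^{\mathrm{bas}}}\end{pmatrix},$$ where $d_{\nabla^{\mathrm{bas}}}$ is the covariant derivative of $\nabla^{\mathrm{bas}}$, and $\rho$, $R^{\mathrm{bas}}$ denote the $\Omega_A$-linear maps of degree $1$ extending $\rho\colon A[1]\to T_M$ and $u\mapsto R^{\mathrm{bas}}(u)\in\Omega^2_A(A[1])$. On $\Omega_A(K[1]\oplus B)$ let $d_{\mathrm{CE}}$ be the Chevalley–Eilenberg differential of the $A$-module with $\nabla_ak=[a,k]$ on $K$ and $\nabla_a(\mathrm{pr}_Bu)=\mathrm{pr}_B[\rho(a),u]$ on $B$, and let $\Omega\colon\Omega_A^\bullet(B)\to\Omega_A^{\bullet+2}(K[1])$ be the $\Omega_A$-linear map of degree $1$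 with $\Omega(b)(a,a')=-R^{\mathrm{bas}}(j(b))(a,a')$, which indeed takes values in $K$. Let $\phi,\psi,h$ be the $\Omega_A$-linear maps of degrees $0,0,-1$ that extend $$\phi(a+u)=\mathrm{pr}_K(a)+\mathrm{pr}_B(u),\qquad \psi(k+b)=k+j(b),\qquad h(a+u)=-\tau(\mathrm{pr}_F(u)).$$ Then $D=D_{\nabla^A}$ and $D'=d_{\mathrm{CE}}-\Omega$ are representations up to homotopy of $A$ on $A[1]\oplus T_M$ and $K[1]\oplus B$: they have degree $1$, square to zero, and satisfy $D(\alpha x)=(d_A\alpha)x+(-1)^{|\alpha|}\alpha\,Dx$ (likewise $D'$) for homogeneous $\alpha\in\Omega_A$. Moreover $(\phi,\psi,h)$ is a contraction of $(\Omega_A(A[1]\oplus T_M),D_{\nabla^A})$ onto $(\Omega_A(K[1]\oplus B),d_{\mathrm{CE}}-\Omega)$, i.e. $$\phi D=D'\phi,\quad D\psi=\psi D',\quad \phi\psi=\mathrm{id},\quad \psi\phi=\mathrm{id}+Dh+hD,\quad h^2=0,\quad \phi h=0,\quad h\psi=0 .$$ -/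

import Mathlib

open scoped Manifold ContDiff Bundle TensorProduct DirectSum

set_option linter.unusedSectionVars false

noncomputable section

/-! Part one is the exterior calculus of a Lie algebroid `A` over `M`, written for the
Lie-Rinehart pair formed by `R = C^∞(M)` and `L = Γ(A)`.  Vector bundles enter through their
`R`-modules of smooth sections, and bundle maps through the `R`-linear maps between these; the
bundle-valued forms `Γ(Λⁿ A* ⊗ E)` are the `R`-multilinear alternating maps `L × ... × L → Γ(E)`.
Part two defines Lie algebroids over a smooth manifold, and their sections as such a pair. -/

namespace LRForms

section Wedge

variable {R L : Type*} [CommRing R] [AddCommGroup L] [Module R L]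

/-- `Ω_A^n(E) = Γ(Λⁿ A* ⊗ E)`: the alternating `R`-multilinear maps from `n` copies of
`L = Γ(A)` to the module `E` of sections. -/
abbrev Forms (R L E : Type*) [CommRing R] [AddCommGroup L] [Module R L] [AddCommGroup E]
    [Module R E] (n : ℕ) := L [⋀^Fin n]→ₗ[R] E

/-- `Ω_A(E)`, the direct sum of the `Ω_A^n(E)` over all form degrees `n`. -/
abbrev TotalForms (R L E : Type*) [CommRing R] [AddCommGroup L] [Module R L] [AddCommGroup E]
    [Module R E] := ⨁ n : ℕ, Forms R L E n

instance {E : Type*} [AddCommGroup E] [Module R E] [Algebra ℝ R] [Module ℝ E]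
    [IsScalarTower ℝ R E] (n : ℕ) : IsScalarTower ℝ R (Forms R L E n) where
  smul_assoc c f η := by ext v; simp

/-- The wedge product of a `P`-valued `k`-form and a `Q`-valued `n`-form along a pairing
`p : P × Q → E`, i.e. the signed sum over `(k, n)`-shuffles of
`p (α (first k arguments)) (η (last n arguments))`. -/
def wedge {P Q E : Type*} [AddCommGroup P] [Module R P] [AddCommGroup Q] [Module R Q]
    [AddCommGroup E] [Module R E]
    (p : P →ₗ[R] Q →ₗ[R] E) {k n : ℕ} (α : Forms R L P k) (η : Forms R L Q n) :
    Forms R L E (k + n) :=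
  ((TensorProduct.lift p).compAlternatingMap (α.domCoprod η)).domDomCongr finSumFinEquiv

variable {E : Type*} [AddCommGroup E] [Module R E]
  {P : Type*} [AddCommGroup P] [Module R P]
  {Q : Type*} [AddCommGroup Q] [Module R Q]
  [Algebra ℝ R] [Module ℝ P] [IsScalarTower ℝ R P] [Module ℝ Q] [IsScalarTower ℝ R Q]
  [Module ℝ E] [IsScalarTower ℝ R E]

/-- The map `η ↦ α ∧ η`, as a real-linear map. -/
def wedgeLeft (p : P →ₗ[R] Q →ₗ[R] E) {k : ℕ} (α : Forms R L P k) (n : ℕ) :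
    Forms R L Q n →ₗ[ℝ] Forms R L E (k + n) where
  toFun := wedge p α
  map_add' η θ := by
    simp only [wedge, ← AlternatingMap.domCoprod'_apply, TensorProduct.tmul_add, map_add]
    ext v
    simp
  map_smul' c η := by
    simp only [wedge, ← AlternatingMap.domCoprod'_apply, RingHom.id_apply]
    rw [← algebraMap_smul R c η, TensorProduct.tmul_smul, map_smul]
    ext v
    simp

/-- The `Ω_A`-linear extension of a bundle map `g : P → E` of degree `0` (or of the degree `0` part
of a shifted one): on forms of every degree it is composition with `g`. -/
def extendEven (g : P →ₗ[R] E) : TotalForms R L P →ₗ[ℝ] TotalForms R L E :=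
  DirectSum.toModule ℝ ℕ _ fun n =>
    DirectSum.lof ℝ ℕ (Forms R L E) n ∘ₗ LinearMap.compAlternatingMapₗ ℝ g

/-- The graded `Ω_A`-linear extension of a bundle map `g` of odd degree: it maps `α ⊗ e` to
`(-1)^n α ⊗ g e` for a scalar `n`-form `α`. -/
def extendOdd (g : P →ₗ[R] E) : TotalForms R L P →ₗ[ℝ] TotalForms R L E :=
  DirectSum.toModule ℝ ℕ _ fun n =>
    (-1 : ℝ) ^ n • DirectSum.lof ℝ ℕ (Forms R L E) n ∘ₗ LinearMap.compAlternatingMapₗ ℝ g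

/-- The graded `Ω_A`-linear extension, of total degree one, of a two-form `Φ` with values in bundle
maps `P → E` that have degree `-1`: it maps `η` of form degree `n` to `(-1)^n Φ ∧ η`, and thus
`α ⊗ e` to `(-1)^n α ∧ Φ(e)`. -/
def extendTwoForm (Φ : Forms R L (P →ₗ[R] E) 2) :
    TotalForms R L P →ₗ[ℝ] TotalForms R L E :=
  DirectSum.toModule ℝ ℕ _ fun n =>
    (-1 : ℝ) ^ n • DirectSum.lof ℝ ℕ (Forms R L E) (2 + n) ∘ₗ wedgeLeft LinearMap.id Φ n

/-- Multiplication from the left by a scalar `k`-form `α`; this is the `Ω_A`-module structure of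
`Ω_A(E)`. -/
def mulForm {k : ℕ} (α : Forms R L R k) : TotalForms R L E →ₗ[ℝ] TotalForms R L E :=
  DirectSum.toModule ℝ ℕ _ fun n =>
    DirectSum.lof ℝ ℕ (Forms R L E) (k + n) ∘ₗ wedgeLeft (LinearMap.lsmul R E) α n

/-- The two-form of an alternating `R`-bilinear map. -/
def twoForm (β : L →ₗ[R] L →ₗ[R] E) (h : ∀ a, β a a = 0) : Forms R L E 2 where
  toFun v := β (v 0) (v 1)
  map_update_add' v i x y := by
    fin_cases i <;> simp
  map_update_smul' v i c x := by
    fin_cases i <;> simp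
  map_eq_zero_of_eq' v i j hv hij := by
    fin_cases i <;> fin_cases j <;> simp_all

end Wedge

variable {R L : Type*} [CommRing R] [Algebra ℝ R] [LieRing L] [LieAlgebra ℝ L] [Module R L]
  [LieRingModule L R] [LieRinehartRing R L] [LieRinehartAlgebra ℝ R L]

/-- An `L`-connection on `E` (a linear connection for `L = Γ(TM)`, an `A`-connection for `L = Γ(A)`):
`R`-linear in the direction, real-linear in the section, and
`∇_a (f e) = f ∇_a e + a(f) e`. -/
structure Connection (R L E : Type*) [CommRing R] [Algebra ℝ R] [LieRing L] [LieAlgebra ℝ L]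
    [Module R L] [LieRingModule L R] [AddCommGroup E] [Module R E] [Module ℝ E]
    [IsScalarTower ℝ R E] where
  toFun : L →ₗ[R] E →ₗ[ℝ] E
  leibniz : ∀ (a : L) (f : R) (e : E), toFun a (f • e) = f • toFun a e + ⁅a, f⁆ • e

variable {E : Type*} [AddCommGroup E] [Module R E] [Module ℝ E] [IsScalarTower ℝ R E]
  {P : Type*} [AddCommGroup P] [Module R P] [Module ℝ P] [IsScalarTower ℝ R P]
  {Q : Type*} [AddCommGroup Q] [Module R Q] [Module ℝ Q] [IsScalarTower ℝ R Q]

instance : CoeFun (Connection R L E) (fun _ => L → E →ₗ[ℝ] E) := ⟨fun c => ⇑c.toFun⟩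

/-- The canonical connection `∇_a f = a(f)` on functions; its covariant derivative is `d_A`. -/
def Connection.trivial (R L : Type*) [CommRing R] [Algebra ℝ R] [LieRing L] [LieAlgebra ℝ L]
    [Module R L] [LieRingModule L R] [LieRinehartRing R L] [LieRinehartAlgebra ℝ R L] :
    Connection R L R where
  toFun :=
    { toFun := fun a =>
        { toFun := fun f => ⁅a, f⁆
          map_add' := fun f g => lie_add a f g
          map_smul' := fun c f => by simp }
      map_add' := fun a b => by ext f; simp
      map_smul' := fun c a => by ext f; simp }
  leibniz a f e := by
    simp [LieRinehartRing.leibniz_mul_right]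

/-- The covariant derivative by the Koszul formula, where a hat marks an omitted argument,
`(d_∇ η)(v₀, …, vₙ) = ∑ᵢ (-1)^i ∇_{vᵢ} η(…, v̂ᵢ, …)
  + ∑_{p < q} (-1)^(p+q) η([v_p, v_q], …, v̂_p, …, v̂_q, …)`.
The pairs `p < q` are written `p = i`, `q = j + 1` with `i ≤ j`. -/
def Connection.koszulFun (D : Connection R L E) :
    {n : ℕ} → Forms R L E n → (Fin (n + 1) → L) → E
  | 0, η, v => D (v 0) (η (Fin.removeNth 0 v))
  | n + 1, η, v =>
      ∑ i : Fin (n + 2), (-1 : ℤ) ^ (i : ℕ) • D (v i) (η (i.removeNth v)) +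
      ∑ i : Fin (n + 1), ∑ j ≥ i, (-1 : ℤ) ^ (i + (j + 1) : ℕ) •
        η (Matrix.vecCons ⁅v i.castSucc, v j.succ⁆ (j.removeNth (i.castSucc.removeNth v)))

/-- A form, regarded as a real multilinear map. -/
def Forms.real {n : ℕ} (η : Forms R L E n) : L [⋀^Fin n]→ₗ[ℝ] E :=
  { η.toMultilinearMap.restrictScalars ℝ with
    map_eq_zero_of_eq' := η.map_eq_zero_of_eq' }

@[simp] lemma Forms.real_apply {n : ℕ} (η : Forms R L E n) (v : Fin n → L) : η.real v = η v := rfl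

/-- The first sum of the Koszul formula, as a real multilinear map. -/
def Connection.aux₁ (D : Connection R L E) {n : ℕ} (η : Forms R L E n) :
    L [⋀^Fin (n+1)]→ₗ[ℝ] E :=
  AlternatingMap.alternatizeUncurryFin
    { toFun := fun a => (D.toFun a).compAlternatingMap η.real
      map_add' := fun a b => by ext v; simp
      map_smul' := fun c a => by
        ext v
        have : D.toFun (c • a) = c • D.toFun a := by
          rw [← algebraMap_smul R c a, map_smul, algebraMap_smul]
        simp [this] }

/-- Minus twice the second sum of the Koszul formula, as a real multilinear map. -/
def aux₂ {n : ℕ} (η : Forms R L E (n + 1)) : L [⋀^Fin (n + 2)]→ₗ[ℝ] E :=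
  AlternatingMap.alternatizeUncurryFin (AlternatingMap.alternatizeUncurryFinLM ∘ₗ
    (LinearMap.mk₂ ℝ (fun a b : L => η.real.curryLeft ⁅a, b⁆)
      (by intros; simp) (by intros; simp) (by intros; simp) (by intros; simp)))

lemma aux₂_apply {n : ℕ} (η : Forms R L E (n + 1)) (v : Fin (n + 2) → L) :
    aux₂ η v = (2 : ℝ) • ∑ i : Fin (n + 1), ∑ j ≥ i, (-1 : ℤ) ^ (i + j : ℕ) •
        η (Matrix.vecCons ⁅v i.castSucc, v j.succ⁆ (j.removeNth (i.castSucc.removeNth v))) := by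
  rw [aux₂, AlternatingMap.alternatizeUncurryFin_alternatizeUncurryFinLM_comp_apply,
    Finset.smul_sum]
  refine Finset.sum_congr rfl fun i _ => ?_
  rw [Finset.smul_sum]
  refine Finset.sum_congr rfl fun j _ => ?_
  simp only [LinearMap.mk₂_apply]
  rw [← lie_skew (v j.succ) (v i.castSucc), map_neg, AlternatingMap.neg_apply, sub_neg_eq_add,
    ← two_smul ℝ, smul_comm]
  rfl

lemma Connection.koszulFun_succ (D : Connection R L E) {n : ℕ} (η : Forms R L E (n + 1)) :
    D.koszulFun η = ⇑(D.aux₁ η - (2⁻¹ : ℝ) • aux₂ η) := by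
  funext v
  rw [AlternatingMap.sub_apply, AlternatingMap.smul_apply, aux₂_apply, inv_smul_smul₀ two_ne_zero,
    sub_eq_add_neg, Connection.aux₁, AlternatingMap.alternatizeUncurryFin_apply]
  simp only [koszulFun]
  congr 1
  rw [← Finset.sum_neg_distrib]
  refine Finset.sum_congr rfl fun i _ => ?_
  rw [← Finset.sum_neg_distrib]
  refine Finset.sum_congr rfl fun j _ => ?_
  rw [← add_assoc, pow_succ, mul_neg_one, neg_smul]

lemma Connection.koszulFun_zero (D : Connection R L E) (η : Forms R L E 0) :
    D.koszulFun η = ⇑(D.aux₁ η) := by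
  funext v
  simp [Connection.aux₁, koszulFun, AlternatingMap.alternatizeUncurryFin_apply]

lemma Connection.exists_real (D : Connection R L E) {n : ℕ} (η : Forms R L E n) :
    ∃ θ : L [⋀^Fin (n+1)]→ₗ[ℝ] E, D.koszulFun η = ⇑θ := by
  cases n with
  | zero => exact ⟨_, D.koszulFun_zero η⟩
  | succ n => exact ⟨_, D.koszulFun_succ η⟩

lemma removeNth_succ_vecCons {α : Type*} {n : ℕ} (i : Fin (n + 1)) (y : α) (w : Fin (n + 1) → α) :
    i.succ.removeNth (Matrix.vecCons y w : Fin (n + 2) → α) = Matrix.vecCons y (i.removeNth w) := by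
  funext k
  refine Fin.cases ?_ (fun k => ?_) k
  · simp [Fin.removeNth]
  · simp [Fin.removeNth]

lemma map_smul_slot_one {n : ℕ} (η : L [⋀^Fin (n + 2)]→ₗ[R] E) (f : R) (b y : L)
    (z : Fin n → L) :
    η (Matrix.vecCons b (Matrix.vecCons (f • y) z)) =
      f • η (Matrix.vecCons b (Matrix.vecCons y z)) := by
  have key : ∀ u : L, Matrix.vecCons b (Matrix.vecCons u z) =
      Function.update (Matrix.vecCons b (Matrix.vecCons y z)) 1 u := by
    intro u
    funext k
    refine Fin.cases ?_ (fun k => ?_) k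
    · simp
    · refine Fin.cases ?_ (fun k => ?_) k
      · simp
      · rw [Function.update_of_ne]
        · simp
        · rw [← Fin.succ_zero_eq_one]
          simp [Fin.ext_iff]
  rw [key, AlternatingMap.map_update_smul, ← key]

lemma Connection.koszulFun_vecCons (D : Connection R L E) {n : ℕ} (η : Forms R L E (n + 1))
    (x : L) (w : Fin (n + 1) → L) :
    D.koszulFun η (Matrix.vecCons x w) = D x (η w) +
      ∑ j : Fin (n + 1), (-1 : ℤ) ^ (j + 1 : ℕ) • D (w j) (η (Matrix.vecCons x (j.removeNth w))) +
      (∑ j : Fin (n + 1), (-1 : ℤ) ^ (j + 1 : ℕ) • η (Matrix.vecCons ⁅x, w j⁆ (j.removeNth w)) +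
      ∑ i : Fin n, ∑ j ≥ i.succ, (-1 : ℤ) ^ (i + 1 + (j + 1) : ℕ) •
        η (Matrix.vecCons ⁅w i.castSucc, w j⁆
          (j.removeNth (i.castSucc.succ.removeNth (Matrix.vecCons x w))))) := by
  have h0 : (Finset.Ici (0 : Fin (n + 1))) = Finset.univ := by ext; simp
  simp only [koszulFun]
  rw [Fin.sum_univ_succ]
  congr 1
  · simp [removeNth_succ_vecCons]
  · rw [Fin.sum_univ_succ, h0]
    simp

/-- The Koszul formula is `R`-homogeneous in the first argument. -/
lemma Connection.koszulFun_smul_zero (D : Connection R L E) {n : ℕ} (η : Forms R L E n)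
    (f : R) (x : L) (w : Fin n → L) :
    D.koszulFun η (Matrix.vecCons (f • x) w) = f • D.koszulFun η (Matrix.vecCons x w) := by
  cases n with
  | zero => simp [koszulFun]
  | succ n =>
    have last : ∀ i : Fin n, ∀ j ∈ Finset.Ici i.succ, ∀ b : L,
        η (Matrix.vecCons b (j.removeNth (i.castSucc.succ.removeNth
            (Matrix.vecCons (f • x) w)))) =
        f • η (Matrix.vecCons b (j.removeNth (i.castSucc.succ.removeNth
            (Matrix.vecCons x w)))) := by
      intro i j hj b
      obtain ⟨m, rfl⟩ : ∃ m, n = m + 1 := ⟨n - 1, by have := i.pos; omega⟩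
      obtain ⟨j, rfl⟩ : ∃ k : Fin (m + 1), k.succ = j := by
        refine Fin.exists_succ_eq.2 ?_
        rintro rfl
        exact (Fin.succ_pos i).not_ge (Finset.mem_Ici.1 hj)
      rw [removeNth_succ_vecCons, removeNth_succ_vecCons,
        removeNth_succ_vecCons, removeNth_succ_vecCons, map_smul_slot_one]
    have l2 : ∀ j : Fin (n + 1), η (Matrix.vecCons ⁅f • x, w j⁆ (j.removeNth w)) =
        f • η (Matrix.vecCons ⁅x, w j⁆ (j.removeNth w)) -
          ⁅w j, f⁆ • η (Matrix.vecCons x (j.removeNth w)) := by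
      intro j
      have : ⁅f • x, w j⁆ = f • ⁅x, w j⁆ - ⁅w j, f⁆ • x := by
        rw [← lie_skew, LieRinehartRing.leibniz_smul_right, ← lie_skew x (w j)]
        module
      rw [this, sub_eq_add_neg, AlternatingMap.map_vecCons_add, ← neg_smul,
        AlternatingMap.map_vecCons_smul, AlternatingMap.map_vecCons_smul, neg_smul,
        ← sub_eq_add_neg]
    have l3 : ∀ j : Fin (n + 1), D (w j) (η (Matrix.vecCons (f • x) (j.removeNth w))) =
        f • D (w j) (η (Matrix.vecCons x (j.removeNth w))) +
          ⁅w j, f⁆ • η (Matrix.vecCons x (j.removeNth w)) := by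
      intro j
      rw [AlternatingMap.map_vecCons_smul, D.leibniz]
    rw [koszulFun_vecCons, koszulFun_vecCons,
      Finset.sum_congr rfl fun i _ => Finset.sum_congr rfl fun j hj => by rw [last i j hj]]
    simp only [l2, l3, smul_add, smul_sub, Finset.smul_sum, Finset.sum_add_distrib,
      Finset.sum_sub_distrib, smul_comm f, map_smul, LinearMap.smul_apply]
    abel

/-- The covariant derivative of a form is a form: the Koszul formula is `R`-multilinear and
alternating. -/
def Connection.koszulForm (D : Connection R L E) {n : ℕ} (η : Forms R L E n) :
    Forms R L E (n + 1) where
  toFun := D.koszulFun η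
  map_update_add' := by
    intro inst v i x y
    obtain ⟨θ, hθ⟩ := D.exists_real η
    rw [hθ, Subsingleton.elim inst (instDecidableEqFin _), AlternatingMap.map_update_add]
  map_update_smul' := by
    intro inst v i f x
    obtain ⟨θ, hθ⟩ := D.exists_real η
    have key : ∀ u : L, D.koszulFun η (Function.update v i u) =
        (Equiv.Perm.sign (Equiv.swap 0 i)) • D.koszulFun η
          (Matrix.vecCons u (Fin.tail (v ∘ Equiv.swap 0 i))) := by
      intro u
      have h : Function.update v i u =
          (Matrix.vecCons u (Fin.tail (v ∘ Equiv.swap 0 i))) ∘ Equiv.swap 0 i := by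
        rw [← Equiv.comp_symm_eq, Equiv.symm_swap]
        funext k
        refine Fin.cases ?_ (fun k => ?_) k
        · simp
        · simp only [Function.comp_apply, Matrix.cons_val_succ, Fin.tail]
          rw [Function.update_of_ne]
          intro h
          rw [Equiv.swap_apply_eq_iff, Equiv.swap_apply_right] at h
          exact Fin.succ_ne_zero _ h
      rw [h, hθ, AlternatingMap.map_perm]
    rw [key, key, D.koszulFun_smul_zero, smul_comm]
  map_eq_zero_of_eq' := by
    intro v i j hv hij
    obtain ⟨θ, hθ⟩ := D.exists_real η
    rw [hθ, θ.map_eq_zero_of_eq v hv hij]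

/-- The covariant derivative `d_∇ : Ω_A^n(E) → Ω_A^{n+1}(E)`. -/
def Connection.koszul (D : Connection R L E) (n : ℕ) :
    Forms R L E n →ₗ[ℝ] Forms R L E (n + 1) where
  toFun := D.koszulForm
  map_add' := by
    intro η θ
    ext v
    change D.koszulFun (η + θ) v = D.koszulFun η v + D.koszulFun θ v
    cases n <;>
    simp [koszulFun, Finset.sum_add_distrib]
    abel
  map_smul' := by
    intro c η
    ext v
    change D.koszulFun (c • η) v = c • D.koszulFun η v
    cases n <;>
    simp [koszulFun, Finset.smul_sum, smul_comm c]

/-- The covariant derivative `d_∇` on `Ω_A(E)`. -/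
def Connection.d (D : Connection R L E) : TotalForms R L E →ₗ[ℝ] TotalForms R L E :=
  DirectSum.toModule ℝ ℕ _ fun n => DirectSum.lof ℝ ℕ (Forms R L E) (n + 1) ∘ₗ D.koszul n



variable {T : Type*} [LieRing T] [LieAlgebra ℝ T] [Module R T]
  [LieRingModule T R] [LieRinehartRing R T] [LieRinehartAlgebra ℝ R T]

/-- The anchor `ρ : Γ(A) → Γ(TM)` of a Lie algebroid on sections, with the space `Γ(F)` of vector
fields which are tangent to the characteristic distribution `F = Im ρ`. -/
structure AnchorData (R L T : Type*) [CommRing R]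
    [LieRing L] [Module R L] [LieRingModule L R] [LieRing T] [Module R T] [LieRingModule T R] where
  anchor : L →ₗ[R] T
  anchor_lie : ∀ a b : L, anchor ⁅a, b⁆ = ⁅anchor a, anchor b⁆
  lie_fun : ∀ (a : L) (f : R), ⁅a, f⁆ = ⁅anchor a, f⁆
  image : Submodule R T
  anchor_mem : ∀ a, anchor a ∈ image

lemma smul_lie' {X : Type*} [LieRing X] [Module R X] [LieRingModule X R] [LieRinehartRing R X]
    (f : R) (a b : X) : ⁅f • a, b⁆ = f • ⁅a, b⁆ - ⁅b, f⁆ • a := by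
  rw [← lie_skew, LieRinehartRing.leibniz_smul_right, ← lie_skew a b]
  module

lemma Connection.smul_left (D : Connection R L E) (f : R) (a : L) (e : E) :
    D (f • a) e = f • D a e := by
  simp

namespace AnchorData

variable (𝔞 : AnchorData R L T)

/-- The basic connection `∇^bas_a u = ρ(∇_u a) + [ρ a, u]` on `TM`. -/
def basicT (D : Connection R T L) : Connection R L T where
  toFun :=
    { toFun := fun a =>
        { toFun := fun u => 𝔞.anchor (D u a) + ⁅𝔞.anchor a, u⁆
          map_add' := fun u v => by simp; abel
          map_smul' := fun c u => by
            have h' : 𝔞.anchor (c • D u a) = c • 𝔞.anchor (D u a) := by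
              rw [← algebraMap_smul R c (D u a), map_smul, algebraMap_smul]
            simp [h'] }
      map_add' := fun a b => by ext u; simp; abel
      map_smul' := fun f a => by
        ext u
        simp [D.leibniz, smul_lie'] }
  leibniz a f u := by
    simp [LieRinehartRing.leibniz_smul_right, 𝔞.lie_fun]
    module

/-- The basic connection `∇^bas_a b = ∇_{ρ b} a + [a, b]` on `A`. -/
def basicL (D : Connection R T L) : Connection R L L where
  toFun :=
    { toFun := fun a =>
        { toFun := fun b => D (𝔞.anchor b) a + ⁅a, b⁆
          map_add' := fun u v => by simp; abel
          map_smul' := fun c b => by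
            simp }
      map_add' := fun a b => by ext u; simp; abel
      map_smul' := fun f a => by
        ext b
        simp [D.leibniz, smul_lie', 𝔞.lie_fun] }
  leibniz a f u := by
    simp [LieRinehartRing.leibniz_smul_right]
    module

/-- The basic curvature `R^bas(u)(a, b) = ∇_u [a, b] - [∇_u a, b] - [a, ∇_u b]
- ∇_{∇^bas_b u} a + ∇_{∇^bas_a u} b`. -/
def basicCurvFun (D : Connection R T L) (u : T) (a b : L) : L :=
  D u ⁅a, b⁆ - ⁅D u a, b⁆ - ⁅a, D u b⁆ - D (𝔞.basicT D b u) a + D (𝔞.basicT D a u) b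

lemma basicT_apply (D : Connection R T L) (a : L) (u : T) :
    𝔞.basicT D a u = 𝔞.anchor (D u a) + ⁅𝔞.anchor a, u⁆ := rfl

lemma basicT_lie (D : Connection R T L) (a : L) (u : T) (f : R) :
    ⁅𝔞.basicT D a u, f⁆ =
      ⁅𝔞.anchor (D u a), f⁆ + ⁅𝔞.anchor a, ⁅u, f⁆⁆ - ⁅u, ⁅𝔞.anchor a, f⁆⁆ := by
  rw [basicT_apply, add_lie, lie_lie]
  abel

lemma basicCurvFun_self (D : Connection R T L) (u : T) (a : L) : 𝔞.basicCurvFun D u a a = 0 := by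
  simp [basicCurvFun]

/-- The basic curvature as a two-form with values in `Hom(TM, A)`. -/
def basicCurvature (D : Connection R T L) : Forms R L (T →ₗ[R] L) 2 :=
  twoForm
    (LinearMap.mk₂ R
      (fun a b =>
        { toFun := fun u => 𝔞.basicCurvFun D u a b
          map_add' := fun u v => by simp [basicCurvFun]; abel
          map_smul' := fun f u => by
            simp [basicCurvFun, Connection.leibniz, smul_lie', LieRinehartRing.leibniz_smul_right,
              𝔞.lie_fun]
            module })
      (by intro a a' b; ext u; simp [basicCurvFun]; abel)
      (by
        intro f a b
        ext u
        simp [basicCurvFun, Connection.leibniz, smul_lie', 𝔞.lie_fun, 𝔞.basicT_lie]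
        module)
      (by intro a a' b; ext u; simp [basicCurvFun]; abel)
      (by
        intro f a b
        ext u
        simp [basicCurvFun, Connection.leibniz, LieRinehartRing.leibniz_smul_right, 𝔞.lie_fun,
          𝔞.basicT_lie]
        module))
    (fun a => LinearMap.ext fun u => 𝔞.basicCurvFun_self D u a)

@[simp] lemma basicCurvature_apply (D : Connection R T L) (v : Fin 2 → L) (u : T) :
    𝔞.basicCurvature D v u = 𝔞.basicCurvFun D u (v 0) (v 1) := rfl

/-- The operator `D_∇` of the adjoint representation on `Ω_A(A[1] ⊕ TM)`. The first component holds
the forms with values in `A[1]`, the second one those with values in `TM`; in matrix form `D_∇` is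
`(d_{∇^bas}, R^bas; ρ, d_{∇^bas})`. -/
def adjointD (D : Connection R T L) :
    TotalForms R L L × TotalForms R L T →ₗ[ℝ] TotalForms R L L × TotalForms R L T :=
  LinearMap.prod
    ((𝔞.basicL D).d.coprod (extendTwoForm (𝔞.basicCurvature D)))
    ((extendOdd 𝔞.anchor).coprod (𝔞.basicT D).d)

/-- `Γ(K)`, where `K = ker ρ`. -/
abbrev kernel : Submodule R L := LinearMap.ker 𝔞.anchor

/-- `Γ(B) = Γ(TM) / Γ(F)`, where `B = TM / F`. -/
abbrev Normal : Type _ := T ⧸ 𝔞.image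

/-- The projection `TM → B`. -/
abbrev prB : T →ₗ[R] 𝔞.Normal := 𝔞.image.mkQ

lemma prB_eq_zero {u : T} (hu : u ∈ 𝔞.image) : 𝔞.prB u = 0 :=
  (Submodule.Quotient.mk_eq_zero 𝔞.image).2 hu

lemma mem_of_prB_eq_zero {u : T} (hu : 𝔞.prB u = 0) : u ∈ 𝔞.image :=
  (Submodule.Quotient.mk_eq_zero 𝔞.image).1 hu

/-- The anchor as a map `A → F`. -/
def toImage : L →ₗ[R] 𝔞.image := 𝔞.anchor.codRestrict 𝔞.image 𝔞.anchor_mem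

lemma toImage_coe (a : L) : (𝔞.toImage a : T) = 𝔞.anchor a := rfl

/-- The projection `TM → F` along `j(B)`, for a splitting `j` of `TM → B`. -/
def projF (j : 𝔞.Normal →ₗ[R] T) (hj : ∀ b, 𝔞.prB (j b) = b) : T →ₗ[R] 𝔞.image :=
  LinearMap.codRestrict 𝔞.image (LinearMap.id - j ∘ₗ 𝔞.prB) fun u => 𝔞.mem_of_prB_eq_zero <| by
    rw [LinearMap.sub_apply, LinearMap.id_apply, LinearMap.comp_apply, map_sub, hj, sub_self]

lemma projF_coe (j : 𝔞.Normal →ₗ[R] T) (hj : ∀ b, 𝔞.prB (j b) = b) (u : T) :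
    (𝔞.projF j hj u : T) = u - j (𝔞.prB u) := rfl

/-- A quadruple `(τ, j, ∇^K, ∇^F)`: splittings `τ : F → A` of `ρ : A → F` and `j : B → TM` of
`TM → B`; a linear connection `∇^K` on `K` with `∇^K_u k = [τ u, k]` for `u ∈ Γ(F)`; a linear
connection `∇^F` on `F`, torsion-free along `F`, with `∇^F_{j b} u = pr_F [j b, u]`. -/
structure Quadruple where
  τ : 𝔞.image →ₗ[R] L
  anchor_τ : ∀ u : 𝔞.image, 𝔞.anchor (τ u) = u
  j : 𝔞.Normal →ₗ[R] T
  prB_j : ∀ b : 𝔞.Normal, 𝔞.prB (j b) = b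
  nablaK : Connection R T 𝔞.kernel
  nablaK_image : ∀ (u : 𝔞.image) (k : 𝔞.kernel), (nablaK (u : T) k : L) = ⁅τ u, (k : L)⁆
  nablaF : Connection R T 𝔞.image
  nablaF_torsion : ∀ u v : 𝔞.image, (nablaF (u : T) v : T) - nablaF (v : T) u = ⁅(u : T), (v : T)⁆
  nablaF_normal : ∀ (b : 𝔞.Normal) (u : 𝔞.image),
    nablaF (j b) u = 𝔞.projF j prB_j ⁅j b, (u : T)⁆

namespace Quadruple

variable {𝔞} (q : 𝔞.Quadruple)

/-- The projection `TM → F` along `j(B)`. -/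
def prF : T →ₗ[R] 𝔞.image := 𝔞.projF q.j q.prB_j

lemma prF_coe (u : T) : (q.prF u : T) = u - q.j (𝔞.prB u) := rfl

lemma prF_j (b : 𝔞.Normal) : q.prF (q.j b) = 0 := by
  ext
  rw [prF_coe, q.prB_j, sub_self]
  rfl

lemma prF_image (u : 𝔞.image) : q.prF u = u := by
  ext
  rw [prF_coe, 𝔞.prB_eq_zero u.2, map_zero, sub_zero]

/-- The projection `A → K` along `τ(F)`, `a ↦ a - τ(ρ a)`. -/
def prK : L →ₗ[R] 𝔞.kernel :=
  LinearMap.codRestrict 𝔞.kernel (LinearMap.id - q.τ ∘ₗ 𝔞.toImage) fun a =>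
    LinearMap.mem_ker.2 <| show 𝔞.anchor (a - q.τ (𝔞.toImage a)) = 0 by
      rw [map_sub, q.anchor_τ, toImage_coe, sub_self]

lemma prK_coe (a : L) : (q.prK a : L) = a - q.τ (𝔞.toImage a) := rfl

lemma lie_mem (q : 𝔞.Quadruple) (u v : 𝔞.image) : ⁅(u : T), (v : T)⁆ ∈ 𝔞.image := by
  rw [← q.anchor_τ u, ← q.anchor_τ v, ← 𝔞.anchor_lie]
  exact 𝔞.anchor_mem _

/-- The Lie bracket of two vector fields tangent to `F`. -/
def lieF (u v : 𝔞.image) : 𝔞.image := ⟨⁅(u : T), (v : T)⁆, q.lie_mem u v⟩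

lemma lieF_add_left (u v w : 𝔞.image) : q.lieF (u + v) w = q.lieF u w + q.lieF v w :=
  Subtype.ext (add_lie _ _ _)
lemma lieF_add_right (u v w : 𝔞.image) : q.lieF u (v + w) = q.lieF u v + q.lieF u w :=
  Subtype.ext (lie_add _ _ _)
lemma lieF_smul_left (f : R) (u v : 𝔞.image) :
    q.lieF (f • u) v = f • q.lieF u v - ⁅(v : T), f⁆ • u :=
  Subtype.ext (smul_lie' _ _ _)
lemma lieF_smul_right (f : R) (u v : 𝔞.image) :
    q.lieF u (f • v) = f • q.lieF u v + ⁅(u : T), f⁆ • v :=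
  Subtype.ext (LieRinehartRing.leibniz_smul_right _ _ _)

/-- The curvature `R^τ(u, v) = [τ u, τ v] - τ [u, v]` of the splitting `τ`. -/
def curvτ : 𝔞.image →ₗ[R] 𝔞.image →ₗ[R] L :=
  LinearMap.mk₂ R (fun u v => ⁅q.τ u, q.τ v⁆ - q.τ (q.lieF u v))
    (by intro u v w; simp only [lieF_add_left, map_add, add_lie]; abel)
    (by
      intro f u v
      simp only [lieF_smul_left, map_sub, map_smul, smul_lie', 𝔞.lie_fun, q.anchor_τ]
      module)
    (by intro u v w; simp only [lieF_add_right, map_add, lie_add]; abel)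
    (by
      intro f u v
      simp only [lieF_smul_right, map_add, map_smul, LieRinehartRing.leibniz_smul_right,
        𝔞.lie_fun, q.anchor_τ]
      module)

/-- The formula `∇^A_u a = ∇^K_u a_K + τ(∇^F_u a_F) + R^τ(u_F, a_F)`. -/
def nablaAFun (u : T) (a : L) : L :=
  (q.nablaK u (q.prK a) : L) + q.τ (q.nablaF u (𝔞.toImage a)) + q.curvτ (q.prF u) (𝔞.toImage a)

lemma coe_real_smul (p : Submodule R L) (c : ℝ) (k : p) : ((c • k : p) : L) = c • (k : L) := rfl

/-- The linear connection `∇^A` on `A` of a quadruple. -/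
def nablaA : Connection R T L where
  toFun := LinearMap.mk₂' R ℝ q.nablaAFun
    (by
      intro u v a
      simp only [nablaAFun, map_add, LinearMap.add_apply, Submodule.coe_add]
      abel)
    (by
      intro f u a
      simp only [nablaAFun, map_smul, LinearMap.smul_apply, Submodule.coe_smul, smul_add])
    (by
      intro u a b
      simp only [nablaAFun, map_add, Submodule.coe_add]
      abel)
    (by
      intro c u a
      simp only [nablaAFun, LinearMap.map_smul_of_tower, map_smul, coe_real_smul, smul_add])
  leibniz u f a := by
    have h : f • a = f • (q.prK a : L) + f • q.τ (𝔞.toImage a) := by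
      rw [← smul_add, prK_coe, sub_add_cancel]
    have h' : ⁅u, f⁆ • a = ⁅u, f⁆ • (q.prK a : L) + ⁅u, f⁆ • q.τ (𝔞.toImage a) := by
      rw [← smul_add, prK_coe, sub_add_cancel]
    simp only [LinearMap.mk₂'_apply, nablaAFun, map_smul, Connection.leibniz, map_add,
      Submodule.coe_add, Submodule.coe_smul]
    rw [h']
    module

lemma nablaA_apply (u : T) (a : L) : q.nablaA u a =
  (q.nablaK u (q.prK a) : L) + q.τ (q.nablaF u (𝔞.toImage a)) +
    q.curvτ (q.prF u) (𝔞.toImage a) := rfl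

lemma lie_anchor_mem (q : 𝔞.Quadruple) (a : L) {u : T} (hu : u ∈ 𝔞.image) :
    ⁅𝔞.anchor a, u⁆ ∈ 𝔞.image :=
  q.lie_mem (𝔞.toImage a) ⟨u, hu⟩

end Quadruple

/-- The `A`-module structure on `K`, `∇_a k = [a, k]`. -/
def moduleK : Connection R L 𝔞.kernel where
  toFun := LinearMap.mk₂' R ℝ
    (fun a k => ⟨⁅a, (k : L)⁆, by
      rw [LinearMap.mem_ker, 𝔞.anchor_lie, LinearMap.mem_ker.1 k.2, lie_zero]⟩)
    (fun a b k => Subtype.ext (add_lie a b (k : L)))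
    (fun f a k => Subtype.ext <| by
      have hk : 𝔞.anchor (k : L) = 0 := k.2
      simp [smul_lie', 𝔞.lie_fun, hk])
    (fun a k l => Subtype.ext (lie_add a (k : L) (l : L)))
    (fun c a k => Subtype.ext (lie_smul c a (k : L)))
  leibniz a f k := Subtype.ext (LieRinehartRing.leibniz_smul_right a (k : L) f)

namespace Quadruple
variable {𝔞} (q : 𝔞.Quadruple)

/-- The `A`-module structure on `B` (the Bott connection), `∇_a b = pr_B [ρ a, j b]`. It does not
depend on `j`, as `moduleB_prB` shows. -/
def moduleB : Connection R L 𝔞.Normal where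
  toFun := LinearMap.mk₂' R ℝ (fun a b => 𝔞.prB ⁅𝔞.anchor a, q.j b⁆)
    (by intro a a' b; simp only [map_add, add_lie])
    (by
      intro f a b
      simp only [map_smul, smul_lie', map_sub, 𝔞.prB_eq_zero (𝔞.anchor_mem a), smul_zero,
        sub_zero])
    (by intro a b b'; simp only [map_add, lie_add])
    (by intro c a b; simp only [LinearMap.map_smul_of_tower, lie_smul])
  leibniz a f b := by
    simp only [LinearMap.mk₂'_apply, map_smul, LieRinehartRing.leibniz_smul_right, map_add,
      q.prB_j, 𝔞.lie_fun]

lemma moduleB_prB (a : L) (u : T) :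
    q.moduleB a (𝔞.prB u) = 𝔞.prB ⁅𝔞.anchor a, u⁆ := by
  have h : ⁅𝔞.anchor a, u⁆ = ⁅𝔞.anchor a, (q.prF u : T)⁆ + ⁅𝔞.anchor a, q.j (𝔞.prB u)⁆ := by
    rw [← lie_add, prF_coe, sub_add_cancel]
  rw [h, map_add, 𝔞.prB_eq_zero (q.lie_anchor_mem a (q.prF u).2), zero_add]
  rfl

lemma anchor_kernel (k : 𝔞.kernel) : 𝔞.anchor (k : L) = 0 := k.2

lemma anchor_nablaA (u : T) (a : L) :
    𝔞.anchor (q.nablaA u a) = q.nablaF u (𝔞.toImage a) := by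
  have h : 𝔞.anchor (q.curvτ (q.prF u) (𝔞.toImage a)) = 0 := by
    simp only [curvτ, LinearMap.mk₂_apply, map_sub, 𝔞.anchor_lie, q.anchor_τ]
    exact sub_self _
  rw [nablaA_apply, map_add, map_add, h, anchor_kernel, q.anchor_τ, zero_add, add_zero]

/-- The basic connection preserves the complement `j(B)`. -/
lemma basicT_j (a : L) (b : 𝔞.Normal) :
    𝔞.basicT q.nablaA a (q.j b) = q.j (q.moduleB a b) := by
  rw [basicT_apply, anchor_nablaA, q.nablaF_normal, projF_coe, ← lie_skew, toImage_coe, map_neg,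
    map_neg]
  change _ = q.j (𝔞.prB ⁅𝔞.anchor a, q.j b⁆)
  abel

/-- The basic curvature maps `j(B)` to `K`. -/
lemma anchor_basicCurvature_j (b : 𝔞.Normal) (v : Fin 2 → L) :
    𝔞.anchor (𝔞.basicCurvature q.nablaA v (q.j b)) = 0 := by
  obtain ⟨x, hx⟩ : ∃ x, x = v 0 := ⟨_, rfl⟩
  obtain ⟨y, hy⟩ : ∃ y, y = v 1 := ⟨_, rfl⟩
  have key : ∀ (c : 𝔞.Normal) (z : L), 𝔞.anchor (q.nablaA (q.j c) z) =
      ⁅q.j c, 𝔞.anchor z⁆ - q.j (𝔞.prB ⁅q.j c, 𝔞.anchor z⁆) := by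
    intro c z
    rw [anchor_nablaA, q.nablaF_normal, projF_coe, toImage_coe]
  have hm : ∀ (z : L) (c : 𝔞.Normal), 𝔞.prB ⁅q.j c, 𝔞.anchor z⁆ = -q.moduleB z c := by
    intro z c
    rw [← lie_skew, map_neg]
    rfl
  have hflat : 𝔞.prB ⁅q.j b, ⁅𝔞.anchor x, 𝔞.anchor y⁆⁆ =
      q.moduleB y (q.moduleB x b) - q.moduleB x (q.moduleB y b) := by
    have e : ∀ z : L, q.moduleB z b = 𝔞.prB ⁅𝔞.anchor z, q.j b⁆ := fun z => rfl
    rw [← lie_skew, lie_lie, e x, e y, moduleB_prB, moduleB_prB, map_neg, map_sub, neg_sub]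
  rw [basicCurvature_apply, ← hx, ← hy, basicCurvFun, basicT_j, basicT_j]
  simp only [map_add, map_sub, 𝔞.anchor_lie, key, sub_lie, lie_sub]
  simp only [hflat, hm, map_neg, map_sub, lie_neg, neg_lie]
  rw [leibniz_lie (q.j b) (𝔞.anchor x) (𝔞.anchor y), ← lie_skew (𝔞.anchor x) (q.j _)]
  abel

/-- The two-form `Ω` with values in `Hom(B, K)`, `Ω(a, a')(b) = -R^bas(a, a')(j b)`. -/
def Ω : Forms R L (𝔞.Normal →ₗ[R] 𝔞.kernel) 2 where
  toFun v := -LinearMap.codRestrict 𝔞.kernel (𝔞.basicCurvature q.nablaA v ∘ₗ q.j)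
    fun b => LinearMap.mem_ker.2 (q.anchor_basicCurvature_j b v)
  map_update_add' v i x y := by
    ext b
    simp [-basicCurvature_apply, LinearMap.codRestrict]
    abel
  map_update_smul' v i c x := by
    ext b
    simp [-basicCurvature_apply, LinearMap.codRestrict]
  map_eq_zero_of_eq' v i j hv hij := by
    ext b
    simp [-basicCurvature_apply, LinearMap.codRestrict, AlternatingMap.map_eq_zero_of_eq _ _ hv hij]

/-- The operator `d_CE - Ω` on `Ω_A(K[1] ⊕ B)`, where `d_CE` is the Chevalley-Eilenberg differential
of the `A`-module `K[1] ⊕ B`. -/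
def targetD : TotalForms R L 𝔞.kernel × TotalForms R L 𝔞.Normal →ₗ[ℝ]
    TotalForms R L 𝔞.kernel × TotalForms R L 𝔞.Normal :=
  LinearMap.prodMap 𝔞.moduleK.d q.moduleB.d -
    LinearMap.prod (extendTwoForm q.Ω ∘ₗ LinearMap.snd ℝ _ _) 0

/-- The projection `φ(a + u) = pr_K a + pr_B u`, extended `Ω_A`-linearly. -/
def φ : TotalForms R L L × TotalForms R L T →ₗ[ℝ]
    TotalForms R L 𝔞.kernel × TotalForms R L 𝔞.Normal :=
  LinearMap.prodMap (extendEven q.prK) (extendEven 𝔞.prB)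

/-- The inclusion `ψ(k + b) = k + j b`, extended `Ω_A`-linearly. -/
def ψ : TotalForms R L 𝔞.kernel × TotalForms R L 𝔞.Normal →ₗ[ℝ]
    TotalForms R L L × TotalForms R L T :=
  LinearMap.prodMap (extendEven 𝔞.kernel.subtype) (extendEven q.j)

/-- The homotopy `h(a + u) = -τ(pr_F u)`, of degree `-1`, extended `Ω_A`-linearly. -/
def h : TotalForms R L L × TotalForms R L T →ₗ[ℝ] TotalForms R L L × TotalForms R L T :=
  LinearMap.prod (-(extendOdd (q.τ ∘ₗ q.prF) ∘ₗ LinearMap.snd ℝ _ _)) 0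

end Quadruple

end AnchorData

section TwoTerm

variable {P' : Type*} [AddCommGroup P'] [Module R P'] [Module ℝ P'] [IsScalarTower ℝ R P']
  {Q' : Type*} [AddCommGroup Q'] [Module R Q'] [Module ℝ Q'] [IsScalarTower ℝ R Q']

/-- An element `(x, y)` of `Ω_A(P[1] ⊕ Q)` is homogeneous of total degree `n`: `x` has form degree
`n + 1` and `y` has form degree `n`. -/
def HasDegree (n : ℤ) (x : TotalForms R L P × TotalForms R L Q) : Prop :=
  (∀ k : ℕ, (k : ℤ) ≠ n + 1 → x.1 k = 0) ∧ (∀ k : ℕ, (k : ℤ) ≠ n → x.2 k = 0)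

/-- A real-linear map is homogeneous of degree `r`. -/
def MapHasDegree (r : ℤ) (g : TotalForms R L P × TotalForms R L Q →ₗ[ℝ]
    TotalForms R L P' × TotalForms R L Q') : Prop :=
  ∀ (n : ℤ) (x : TotalForms R L P × TotalForms R L Q), HasDegree n x → HasDegree (n + r) (g x)

/-- Left multiplication by a scalar form on `Ω_A(P[1] ⊕ Q)`. -/
def mulPair {k : ℕ} (α : Forms R L R k) : TotalForms R L P × TotalForms R L Q →ₗ[ℝ]
    TotalForms R L P × TotalForms R L Q :=
  LinearMap.prodMap (mulForm α) (mulForm α)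

/-- A map of degree `r` is graded `Ω_A`-linear: `g (α ∧ x) = (-1)^(r k) α ∧ g x` for scalar
`k`-forms `α`. -/
def IsFormLinear (r : ℕ) (g : TotalForms R L P × TotalForms R L Q →ₗ[ℝ]
    TotalForms R L P' × TotalForms R L Q') : Prop :=
  ∀ (k : ℕ) (α : Forms R L R k) (x : TotalForms R L P × TotalForms R L Q),
    g (mulPair α x) = (-1 : ℝ) ^ (r * k) • mulPair α (g x)

/-- A representation up to homotopy on `P[1] ⊕ Q`: an operator `D` on `Ω_A(P[1] ⊕ Q)` of degree one
with `D ∘ D = 0` and `D (α ∧ x) = d_A α ∧ x + (-1)^k α ∧ D x` for scalar `k`-forms `α`. -/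
structure IsRepUpToHomotopy (D : TotalForms R L P × TotalForms R L Q →ₗ[ℝ]
    TotalForms R L P × TotalForms R L Q) : Prop where
  degree : MapHasDegree 1 D
  square_zero : D ∘ₗ D = 0
  leibniz : ∀ (k : ℕ) (α : Forms R L R k) (x : TotalForms R L P × TotalForms R L Q),
    D (mulPair α x) =
      mulPair ((Connection.trivial R L).koszul k α) x + (-1 : ℝ) ^ k • mulPair α (D x)

/-- `(φ, ψ, h)` is a contraction of `(Ω_A(P[1] ⊕ Q), D)` onto `(Ω_A(P'[1] ⊕ Q'), D')`: `φ` and `ψ`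
are `Ω_A`-linear cochain maps of degree zero, `h` is `Ω_A`-linear of degree `-1`, and the homotopy
identities and the side conditions hold. -/
structure IsContraction
    (D : TotalForms R L P × TotalForms R L Q →ₗ[ℝ] TotalForms R L P × TotalForms R L Q)
    (D' : TotalForms R L P' × TotalForms R L Q' →ₗ[ℝ] TotalForms R L P' × TotalForms R L Q')
    (φ : TotalForms R L P × TotalForms R L Q →ₗ[ℝ] TotalForms R L P' × TotalForms R L Q')
    (ψ : TotalForms R L P' × TotalForms R L Q' →ₗ[ℝ] TotalForms R L P × TotalForms R L Q)
    (h : TotalForms R L P × TotalForms R L Q →ₗ[ℝ] TotalForms R L P × TotalForms R L Q) :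
    Prop where
  φ_degree : MapHasDegree 0 φ
  ψ_degree : MapHasDegree 0 ψ
  h_degree : MapHasDegree (-1) h
  φ_linear : IsFormLinear 0 φ
  ψ_linear : IsFormLinear 0 ψ
  h_linear : IsFormLinear 1 h
  φ_comm : φ ∘ₗ D = D' ∘ₗ φ
  ψ_comm : D ∘ₗ ψ = ψ ∘ₗ D'
  φ_ψ : φ ∘ₗ ψ = LinearMap.id
  ψ_φ : ψ ∘ₗ φ = LinearMap.id + (D ∘ₗ h + h ∘ₗ D)
  h_h : h ∘ₗ h = 0
  φ_h : φ ∘ₗ h = 0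
  h_ψ : h ∘ₗ ψ = 0

end TwoTerm

end LRForms

namespace SmoothSections

open Bundle

section
variable {m : ℕ} {M : Type*} [TopologicalSpace M] [ChartedSpace (EuclideanSpace ℝ (Fin m)) M]

section
variable {V : Type*} [NormedAddCommGroup V] [NormedSpace ℝ V]
  {A : M → Type*} [TopologicalSpace (TotalSpace V A)] [∀ x, TopologicalSpace (A x)]
  [∀ x, AddCommGroup (A x)] [∀ x, Module ℝ (A x)]
  [FiberBundle V A] [VectorBundle ℝ V A]

/-- The `C^∞(M)`-module structure on the smooth sections of a vector bundle. -/
instance sectionModule : Module C^∞⟮𝓡 m, M; ℝ⟯ Cₛ^∞⟮𝓡 m; V, A⟯ where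
  smul f s := ⟨fun x => f x • s x, f.contMDiff.smul_section s.contMDiff⟩
  one_smul s := by ext x; exact one_smul ℝ (s x)
  mul_smul f g s := by ext x; exact mul_smul (f x) (g x) (s x)
  smul_zero f := by ext x; exact smul_zero (f x)
  smul_add f s t := by ext x; exact smul_add (f x) (s x) (t x)
  add_smul f g s := by ext x; exact add_smul (f x) (g x) (s x)
  zero_smul s := by ext x; exact zero_smul ℝ (s x)

@[simp] lemma sectionSMul_apply (f : C^∞⟮𝓡 m, M; ℝ⟯) (s : Cₛ^∞⟮𝓡 m; V, A⟯) (x : M) :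
    (f • s) x = f x • s x := rfl

lemma sectionSMul_coe (f : C^∞⟮𝓡 m, M; ℝ⟯) (s : Cₛ^∞⟮𝓡 m; V, A⟯) :
    ⇑(f • s) = ⇑f • ⇑s := rfl

instance sectionTower : IsScalarTower ℝ C^∞⟮𝓡 m, M; ℝ⟯ Cₛ^∞⟮𝓡 m; V, A⟯ where
  smul_assoc c f s := by ext x; exact smul_assoc c (f x) (s x)
end

variable [IsManifold (𝓡 m) ∞ M]

variable (m M) in
/-- `Γ(TM)`, the smooth vector fields on `M`. -/
abbrev SmoothVF := Cₛ^∞⟮𝓡 m; EuclideanSpace ℝ (Fin m), (TangentSpace (𝓡 m) : M → Type _)⟯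

namespace SmoothVF

/-- The derivative `X(f)` of a function along a vector field. -/
instance : Bracket (SmoothVF m M) C^∞⟮𝓡 m, M; ℝ⟯ where
  bracket X f := ⟨fun x => mvfderiv (𝓡 m) f x (X x),
    (contMDiff_snd_tangentBundle_modelSpace ℝ 𝓘(ℝ, ℝ)).comp
      ((f.contMDiff.contMDiff_tangentMap (m := ∞) (by simp)).comp X.contMDiff)⟩

lemma lie_apply (X : SmoothVF m M) (f : C^∞⟮𝓡 m, M; ℝ⟯) (x : M) :
    ⁅X, f⁆ x = mvfderiv (𝓡 m) f x (X x) := rfl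

lemma two_le_infty : (2 : ℕ∞ω) ≤ ∞ := WithTop.coe_le_coe.2 (le_top : (2 : ℕ∞) ≤ ⊤)

instance : IsManifold (𝓡 m) (∞ + 1) M := by simpa

instance : IsManifold (𝓡 m) (minSmoothness ℝ 3) M := by
  simp only [minSmoothness_of_isRCLikeNormedField]
  exact IsManifold.of_le (n := ∞) (WithTop.coe_le_coe.2 (le_top : (3 : ℕ∞) ≤ ⊤))

instance : IsManifold (𝓡 m) (minSmoothness ℝ 2) M := by
  simp only [minSmoothness_of_isRCLikeNormedField]
  exact IsManifold.of_le (n := ∞) two_le_infty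

/-- The Lie bracket of vector fields. -/
instance : Bracket (SmoothVF m M) (SmoothVF m M) where
  bracket X Y := ⟨VectorField.mlieBracket (𝓡 m) X Y,
    ContDiff.mlieBracket_vectorField (m := ⊤) (n := ⊤) X.contMDiff Y.contMDiff (by simp)⟩

lemma lie_coe (X Y : SmoothVF m M) : ⇑⁅X, Y⁆ = VectorField.mlieBracket (𝓡 m) X Y := rfl

instance : LieRing (SmoothVF m M) where
  add_lie X Y Z := by
    ext x
    exact VectorField.mlieBracket_add_left X.mdifferentiableAt Y.mdifferentiableAt
  lie_add X Y Z := by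
    ext x
    exact VectorField.mlieBracket_add_right Y.mdifferentiableAt Z.mdifferentiableAt
  lie_self X := by
    ext x
    rw [lie_coe, VectorField.mlieBracket_self]
    rfl
  leibniz_lie X Y Z := by
    ext x
    exact VectorField.leibniz_identity_mlieBracket_apply
      ((X.contMDiff x).of_le (by simpa using two_le_infty))
      ((Y.contMDiff x).of_le (by simpa using two_le_infty))
      ((Z.contMDiff x).of_le (by simpa using two_le_infty))

instance : LieAlgebra ℝ (SmoothVF m M) where
  lie_smul c X Y := by
    ext x
    exact VectorField.mlieBracket_const_smul_right Y.mdifferentiableAt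

lemma mdiffAt (f : C^∞⟮𝓡 m, M; ℝ⟯) (x : M) : MDifferentiableAt (𝓡 m) 𝓘(ℝ, ℝ) f x :=
  (f.contMDiff x).mdifferentiableAt (by simp)

/-- The vector field `[X, Y]` acts on functions as the commutator of `X` and `Y`. -/
lemma lie_lie_fun (X Y : SmoothVF m M) (f : C^∞⟮𝓡 m, M; ℝ⟯) :
    ⁅X, ⁅Y, f⁆⁆ = ⁅⁅X, Y⁆, f⁆ + ⁅Y, ⁅X, f⁆⁆ := by
  ext x
  change ⁅X, ⁅Y, f⁆⁆ x = ⁅⁅X, Y⁆, f⁆ x + ⁅Y, ⁅X, f⁆⁆ x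
  rcases subsingleton_or_nontrivial (EuclideanSpace ℝ (Fin m)) with hs | hs
  · have h0 : ∀ v : TangentSpace (𝓡 m) x, v = 0 := fun v =>
      Subsingleton.elim (α := EuclideanSpace ℝ (Fin m)) v 0
    simp only [lie_apply, h0, map_zero, add_zero]
  obtain ⟨v, hv⟩ : ∃ v : TangentSpace (𝓡 m) x, v ≠ 0 := exists_ne (0 : EuclideanSpace ℝ (Fin m))
  let Z : ∀ y : M, TangentSpace (𝓡 m) y := FiberBundle.extend (EuclideanSpace ℝ (Fin m)) v
  have hZx : Z x = v := FiberBundle.extend_apply_self _ v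
  obtain ⟨s, hs, hZs⟩ := FiberBundle.exists_contMDiffOn_extend (k := ∞) (𝓡 m)
    (EuclideanSpace ℝ (Fin m)) v
  obtain ⟨t, hts, ht, hxt⟩ := mem_nhds_iff.1 hs
  have hZ : ∀ y ∈ t, ContMDiffAt (𝓡 m) ((𝓡 m).prod 𝓘(ℝ, EuclideanSpace ℝ (Fin m))) ∞
      (fun y => (⟨y, Z y⟩ : TangentBundle (𝓡 m) M)) y := fun y hy =>
    hZs.contMDiffAt (mem_nhds_iff.2 ⟨t, hts, ht, hy⟩)
  have hZd : ∀ y ∈ t, MDifferentiableAt (𝓡 m) ((𝓡 m).prod 𝓘(ℝ, EuclideanSpace ℝ (Fin m)))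
      (fun y => (⟨y, Z y⟩ : TangentBundle (𝓡 m) M)) y := fun y hy =>
    (hZ y hy).mdifferentiableAt (by simp)
  have hbr : ∀ U : SmoothVF m M, MDifferentiableAt (𝓡 m)
      ((𝓡 m).prod 𝓘(ℝ, EuclideanSpace ℝ (Fin m)))
      (fun y => (⟨y, VectorField.mlieBracket (𝓡 m) U Z y⟩ : TangentBundle (𝓡 m) M)) x := fun U =>
    (ContMDiffAt.mlieBracket_vectorField (m := ⊤) (n := ⊤) (U.contMDiff x) (hZ x hxt)
      (by simp)).mdifferentiableAt (by simp)
  have hgZ : ∀ g : C^∞⟮𝓡 m, M; ℝ⟯, MDifferentiableAt (𝓡 m)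
      ((𝓡 m).prod 𝓘(ℝ, EuclideanSpace ℝ (Fin m)))
      (fun y => (⟨y, (⇑g • Z) y⟩ : TangentBundle (𝓡 m) M)) x := fun g =>
    ((g.contMDiff x).smul_section (hZ x hxt)).mdifferentiableAt (by simp)
  have hgbr : ∀ (g : C^∞⟮𝓡 m, M; ℝ⟯) (U : SmoothVF m M), MDifferentiableAt (𝓡 m)
      ((𝓡 m).prod 𝓘(ℝ, EuclideanSpace ℝ (Fin m)))
      (fun y => (⟨y, (⇑g • VectorField.mlieBracket (𝓡 m) U Z) y⟩ : TangentBundle (𝓡 m) M)) x := fun g U =>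
    MDifferentiableAt.smul_section (mdiffAt g x) (hbr U)
  have hloc : ∀ U : SmoothVF m M, VectorField.mlieBracket (𝓡 m) U (⇑f • Z) =ᶠ[nhds x]
      (⇑⁅U, f⁆ • Z + ⇑f • VectorField.mlieBracket (𝓡 m) U Z) := fun U => by
    filter_upwards [ht.mem_nhds hxt] with y hy
    rw [VectorField.mlieBracket_smul_right (mdiffAt f y) (hZd y hy)]
    rfl
  have h2 : ∀ U W : SmoothVF m M, VectorField.mlieBracket (𝓡 m) U (VectorField.mlieBracket (𝓡 m) W (⇑f • Z)) x =
      ⁅U, ⁅W, f⁆⁆ x • Z x + ⁅W, f⁆ x • VectorField.mlieBracket (𝓡 m) U Z x +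
        (⁅U, f⁆ x • VectorField.mlieBracket (𝓡 m) W Z x +
          f x • VectorField.mlieBracket (𝓡 m) U (VectorField.mlieBracket (𝓡 m) W Z) x) := by
    intro U W
    refine (Filter.EventuallyEq.mlieBracket_vectorField_eq
      (Filter.EventuallyEq.refl (nhds x) ⇑U) (hloc W)).trans ?_
    rw [VectorField.mlieBracket_add_right (hgZ _) (hgbr _ _), VectorField.mlieBracket_smul_right (mdiffAt _ x) (hZd x hxt),
      VectorField.mlieBracket_smul_right (mdiffAt _ x) (hbr W)]
    rfl
  have hX2 := (X.contMDiff x).of_le (m := minSmoothness ℝ 2) (by simpa using two_le_infty)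
  have hY2 := (Y.contMDiff x).of_le (m := minSmoothness ℝ 2) (by simpa using two_le_infty)
  have hJ := VectorField.leibniz_identity_mlieBracket_apply hX2 hY2
    ((hZ x hxt).of_le (m := minSmoothness ℝ 2) (by simpa using two_le_infty))
  have hJf := VectorField.leibniz_identity_mlieBracket_apply hX2 hY2
    (((f.contMDiff x).smul_section (hZ x hxt)).of_le (m := minSmoothness ℝ 2)
      (by simpa using two_le_infty))
  rw [h2, h2, ← lie_coe, VectorField.mlieBracket_smul_right (mdiffAt f x) (hZd x hxt), lie_coe, hJ] at hJf
  have hfin : (⁅X, ⁅Y, f⁆⁆ x - (⁅⁅X, Y⁆, f⁆ x + ⁅Y, ⁅X, f⁆⁆ x)) • v = 0 := by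
    have e : mvfderiv (𝓡 m) f x (VectorField.mlieBracket (𝓡 m) X Y x) = ⁅⁅X, Y⁆, f⁆ x := rfl
    rw [e, hZx] at hJf
    have := sub_eq_zero.2 hJf
    rw [← this]
    module
  rcases smul_eq_zero.1 hfin with h | h
  · exact sub_eq_zero.1 h
  · exact absurd h hv

instance : LieRingModule (SmoothVF m M) C^∞⟮𝓡 m, M; ℝ⟯ where
  add_lie X Y f := by
    ext x
    exact map_add (mvfderiv (𝓡 m) f x) (X x) (Y x)
  lie_add X f g := by
    ext x
    exact congrArg (fun φ => φ (X x)) (mvfderiv_add (mdiffAt f x) (mdiffAt g x))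
  leibniz_lie X Y f := lie_lie_fun X Y f

instance : LieRinehartRing C^∞⟮𝓡 m, M; ℝ⟯ (SmoothVF m M) where
  lie_smul_eq_mul' f g X := by
    ext x
    exact map_smul (mvfderiv (𝓡 m) g x) (f x) (X x)
  leibniz_mul_right' X f g := by
    ext x
    refine (congrArg (fun φ => φ (X x)) (mvfderiv_mul (mdiffAt f x) (mdiffAt g x))).trans ?_
    simp [lie_apply, mul_comm]
  leibniz_smul_right' X Y f := by
    ext x
    refine (VectorField.mlieBracket_smul_right (mdiffAt f x) Y.mdifferentiableAt).trans ?_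
    exact add_comm _ _

instance : LieRinehartAlgebra ℝ C^∞⟮𝓡 m, M; ℝ⟯ (SmoothVF m M) where
  smul_lie c X f := by
    ext x
    exact map_smul (mvfderiv (𝓡 m) f x) c (X x)
  lie_smul c X f := by
    ext x
    have h := mvfderiv_smul (a := fun _ : M => c) (mdifferentiableAt_const (x := x)) (mdiffAt f x)
    refine (congrArg (fun φ => φ (X x)) h).trans ?_
    simp [mvfderiv_const, lie_apply]

end SmoothVF

section
variable (V : Type*) [NormedAddCommGroup V] [NormedSpace ℝ V]
  (A : M → Type*) [TopologicalSpace (TotalSpace V A)] [∀ x, TopologicalSpace (A x)]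
  [∀ x, AddCommGroup (A x)] [∀ x, Module ℝ (A x)]
  [FiberBundle V A] [VectorBundle ℝ V A]

/-- A Lie algebroid structure on the smooth vector bundle `A` over `M`: a bundle map `ρ : A → TM`
and a Lie bracket on `Γ(A)` with `ρ [a, b] = [ρ a, ρ b]` and `[a, f b] = f [a, b] + (ρ a)(f) b`. -/
class LieAlgebroid where
  /-- The anchor, a smooth section of `Hom(A, TM)`. -/
  anchor : Cₛ^∞⟮𝓡 m; V →L[ℝ] EuclideanSpace ℝ (Fin m),
    fun x : M => A x →L[ℝ] TangentSpace (𝓡 m) x⟯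
  /-- The Lie bracket of sections. -/
  bracket : Cₛ^∞⟮𝓡 m; V, A⟯ →ₗ[ℝ] Cₛ^∞⟮𝓡 m; V, A⟯ →ₗ[ℝ] Cₛ^∞⟮𝓡 m; V, A⟯
  bracket_self : ∀ a, bracket a a = 0
  jacobi : ∀ a b c,
    bracket a (bracket b c) = bracket (bracket a b) c + bracket b (bracket a c)
  anchor_bracket : ∀ a b x, anchor x (bracket a b x) =
    VectorField.mlieBracket (𝓡 m) (fun y => anchor y (a y)) (fun y => anchor y (b y)) x
  leibniz : ∀ (a b : Cₛ^∞⟮𝓡 m; V, A⟯) (f : C^∞⟮𝓡 m, M; ℝ⟯) (x : M),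
    bracket a (f • b) x = f x • bracket a b x + mvfderiv (𝓡 m) f x (anchor x (a x)) • b x

namespace LieAlgebroid

variable {V A} [LieAlgebroid (m := m) V A]

/-- The anchor on sections, `Γ(A) → Γ(TM)`. -/
def anchorMap : Cₛ^∞⟮𝓡 m; V, A⟯ →ₗ[C^∞⟮𝓡 m, M; ℝ⟯] SmoothVF m M where
  toFun a := ⟨fun x => anchor (m := m) (V := V) (A := A) x (a x),
    ContMDiff.clm_bundle_apply (anchor (m := m) (V := V) (A := A)).contMDiff a.contMDiff⟩
  map_add' a b := by ext x; exact map_add (anchor (m := m) (V := V) (A := A) x) (a x) (b x)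
  map_smul' f a := by ext x; exact map_smul (anchor (m := m) (V := V) (A := A) x) (f x) (a x)

lemma anchorMap_apply (a : Cₛ^∞⟮𝓡 m; V, A⟯) (x : M) :
    anchorMap a x = anchor (m := m) (V := V) (A := A) x (a x) := rfl

instance : LieRing Cₛ^∞⟮𝓡 m; V, A⟯ where
  bracket a b := bracket a b
  add_lie a b c := LinearMap.map_add₂ bracket a b c
  lie_add a b c := map_add (bracket a) b c
  lie_self a := bracket_self a
  leibniz_lie a b c := jacobi a b c

lemma lie_def (a b : Cₛ^∞⟮𝓡 m; V, A⟯) : ⁅a, b⁆ = bracket a b := rfl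

instance : LieAlgebra ℝ Cₛ^∞⟮𝓡 m; V, A⟯ where
  lie_smul c a b := map_smul (bracket a) c b

lemma anchorMap_lie (a b : Cₛ^∞⟮𝓡 m; V, A⟯) : anchorMap ⁅a, b⁆ = ⁅anchorMap a, anchorMap b⁆ := by
  ext x
  exact anchor_bracket a b x

/-- A section `a` of `A` acts on functions through `ρ a`. -/
instance : LieRingModule Cₛ^∞⟮𝓡 m; V, A⟯ C^∞⟮𝓡 m, M; ℝ⟯ where
  bracket a f := ⁅anchorMap a, f⁆
  add_lie a b f := by
    change ⁅anchorMap (a + b), f⁆ = ⁅anchorMap a, f⁆ + ⁅anchorMap b, f⁆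
    rw [map_add, add_lie]
  lie_add a f g := lie_add (anchorMap a) f g
  leibniz_lie a b f := by
    change ⁅anchorMap a, ⁅anchorMap b, f⁆⁆ = ⁅anchorMap ⁅a, b⁆, f⁆ + ⁅anchorMap b, ⁅anchorMap a, f⁆⁆
    rw [anchorMap_lie, leibniz_lie]

lemma lie_fun (a : Cₛ^∞⟮𝓡 m; V, A⟯) (f : C^∞⟮𝓡 m, M; ℝ⟯) : ⁅a, f⁆ = ⁅anchorMap a, f⁆ := rfl

instance : LieRinehartRing C^∞⟮𝓡 m, M; ℝ⟯ Cₛ^∞⟮𝓡 m; V, A⟯ where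
  lie_smul_eq_mul' f g a := by
    rw [lie_fun, lie_fun, map_smul, LieRinehartRing.lie_smul_eq_mul]
  leibniz_mul_right' a f g := by
    simp only [lie_fun, LieRinehartRing.leibniz_mul_right]
  leibniz_smul_right' a b f := by
    ext x
    exact leibniz a b f x

instance : LieRinehartAlgebra ℝ C^∞⟮𝓡 m, M; ℝ⟯ Cₛ^∞⟮𝓡 m; V, A⟯ where
  smul_lie c a f := by
    have h : anchorMap (c • a) = c • anchorMap a := LinearMap.map_smul_of_tower _ c a
    rw [lie_fun, lie_fun, h, smul_lie]
  lie_smul c a f := by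
    rw [lie_fun, lie_fun, lie_smul]

variable (V A) in
/-- The Lie algebroid is regular: its anchor has constant rank. -/
def IsRegular : Prop :=
  ∃ r : ℕ, ∀ x : M, Module.finrank ℝ
    (LinearMap.range (anchor (m := m) (V := V) (A := A) x).toLinearMap) = r

variable (m V A) in
/-- `Γ(F)`, for the characteristic distribution `F = Im ρ`: the vector fields with values in the
image of the anchor at each point. -/
def imageSections : Submodule C^∞⟮𝓡 m, M; ℝ⟯ (SmoothVF m M) where
  carrier := {u | ∀ x : M, u x ∈ LinearMap.range (anchor (m := m) (V := V) (A := A) x).toLinearMap}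
  add_mem' hu hv x := Submodule.add_mem _ (hu x) (hv x)
  zero_mem' _ := Submodule.zero_mem _
  smul_mem' f _ hu x := Submodule.smul_mem _ (f x) (hu x)

variable (m V A) in
/-- The anchor of a Lie algebroid on sections, with `Γ(F)`. -/
def anchorData : LRForms.AnchorData C^∞⟮𝓡 m, M; ℝ⟯ Cₛ^∞⟮𝓡 m; V, A⟯ (SmoothVF m M) where
  anchor := anchorMap
  anchor_lie := anchorMap_lie
  lie_fun := lie_fun
  image := imageSections m V A
  anchor_mem a x := ⟨a x, rfl⟩

end LieAlgebroid
end
end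

end SmoothSections

end

/-!
Every operator in the statement is determined by two things: its commutation with the contractions
`ι_a`, `a ∈ Γ(A)`, and the component of form degree `0` of its values. Indeed, an operator which
commutes with all `ι_a` up to a factor, and whose values have no component of degree `0`, is zero by
induction on the degree (`op_eq_zero`, and `op₂_ext` for bilinear operations such as the wedge
product). With the derivation rule of `ι_a` for the wedge product (`contract_wedgeTotal`) and the
Cartan relation `[L_a, ι_b] = ι_[a, b]` for `L_a = ι_a d + d ι_a` (`Connection.contract_lieDeriv`),
this reduces the identities between operators on forms to identities between sections.

For the adjoint representation these are: the curvatures of the two basic connections are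
`-R^bas ∘ ρ` on `A` and `-ρ ∘ R^bas` on `TM` (`basicL_curv_add`, `basicT_curv_add`), the anchor is
parallel (`anchor_basicL`), and the covariant derivative of `R^bas` vanishes
(`basicCurvature_bianchi`). They hold for every linear connection on `A`, and give `D ∘ D = 0`.

For the special connection `∇^A`, the maps `pr_K`, `pr_B`, `j`, the inclusion of `K` and
`τ ∘ pr_F` are parallel for the basic connections and the flat connections on `K` and `B`
(`prK_basicL`, `prB_basicT`, `basicT_j`, `basicL_coe_kernel`, `basicL_τ_prF`). So their extensions
commute with the covariant derivatives. Since `K` is flat, `pr_K ∘ R^bas` vanishes on `F` and hence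
equals `-Ω ∘ pr_B` (`prK_basicCurvature`). This makes `φ` and `ψ` cochain maps and gives the
homotopy identity. As `φ ψ = id`, the operator `d_CE - Ω` squares to zero because `D` does.
-/

noncomputable section

namespace LRForms

/-! ### Sums over permutations -/

section Shuffle

variable {R L : Type*} [CommRing R] [AddCommGroup L] [Module R L]
  {P Q E : Type*} [AddCommGroup P] [Module R P] [AddCommGroup Q] [Module R Q]
  [AddCommGroup E] [Module R E]

open Equiv

/-- The antisymmetrization of `p (α (v ∘ l)) (η (v ∘ r))` over all permutations of the arguments,
for an arbitrary selection `l`, `r` of the slots of `α` and `η`. It is `k! n!` times the sum over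
shuffles when `l` and `r` are complementary. -/
def permSum (p : P →ₗ[R] Q →ₗ[R] E) {k n N : ℕ} (α : Forms R L P k) (η : Forms R L Q n)
    (l : Fin k → Fin N) (r : Fin n → Fin N) (v : Fin N → L) : E :=
  ∑ σ : Perm (Fin N), Perm.sign σ • p (α (v ∘ σ ∘ l)) (η (v ∘ σ ∘ r))

/-- The wedge product, which is defined by shuffles, in terms of sums over all permutations: each
shuffle stands for a coset of `k! n!` permutations. -/
lemma factorial_smul_wedge (p : P →ₗ[R] Q →ₗ[R] E) {k n : ℕ} (α : Forms R L P k)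
    (η : Forms R L Q n) (v : Fin (k + n) → L) :
    (k.factorial * n.factorial) • wedge p α η v =
      permSum p α η (Fin.castAdd n) (Fin.natAdd k) v := by
  have h := DFunLike.congr_fun (MultilinearMap.domCoprod_alternization_eq α η)
    (v ∘ finSumFinEquiv)
  rw [Fintype.card_fin, Fintype.card_fin, MultilinearMap.alternatization_apply] at h
  have h' := congrArg (TensorProduct.lift p) h
  rw [AlternatingMap.smul_apply, map_nsmul] at h'
  refine h'.symm.trans ?_
  rw [map_sum, permSum, ← (finSumFinEquiv (m := k) (n := n)).permCongr.sum_comp]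
  refine Finset.sum_congr rfl fun σ _ => ?_
  rw [Perm.sign_permCongr]
  rcases Int.units_eq_one_or (Perm.sign σ) with hσ | hσ <;> rw [hσ] <;>
  simp [MultilinearMap.domCoprod_apply, Function.comp_def]

lemma permSum_cast (p : P →ₗ[R] Q →ₗ[R] E) {k n N N' : ℕ} (h : N = N') (α : Forms R L P k)
    (η : Forms R L Q n) (l : Fin k → Fin N) (r : Fin n → Fin N) (v : Fin N' → L) :
    permSum p α η l r (v ∘ Fin.cast h) =
      permSum p α η (Fin.cast h ∘ l) (Fin.cast h ∘ r) v := by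
  subst h
  rfl

/-- A sum over the permutations of `0, …, N`, sorted by the slot `s` that is sent to `0`. -/
lemma sum_perm_eq_sum_swap {M : Type*} [AddCommMonoid M] {N : ℕ} (f : Perm (Fin (N + 1)) → M) :
    ∑ σ, f σ = ∑ s : Fin (N + 1), ∑ e : Perm (Fin N),
      f (Perm.decomposeFin.symm (0, e) * swap 0 s) := by
  -- `Perm.decomposeFin` sorts permutations by the image of `0`, hence the passage to inverses.
  have key : ∀ (s : Fin (N + 1)) (e : Perm (Fin N)),
      (Perm.decomposeFin.symm (s, e))⁻¹ = Perm.decomposeFin.symm (0, e⁻¹) * swap 0 s := by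
    intro s e
    rw [inv_eq_iff_mul_eq_one]
    ext i
    refine congrArg Fin.val (?_ : _ = i)
    rw [Perm.mul_apply, Perm.mul_apply]
    by_cases h0 : swap 0 s i = 0
    · rw [h0, Perm.decomposeFin_symm_apply_zero, Perm.decomposeFin_symm_apply_zero]
      rw [swap_apply_eq_iff, swap_apply_left] at h0
      exact h0.symm
    · obtain ⟨t, ht⟩ := Fin.exists_succ_eq.2 h0
      rw [← ht, Perm.decomposeFin_symm_apply_succ, swap_self, refl_apply,
        Perm.decomposeFin_symm_apply_succ, show e (e⁻¹ t) = t by simp, ht, swap_apply_self]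
  rw [← Equiv.sum_comp (Equiv.inv (Perm (Fin (N + 1)))), ← Perm.decomposeFin.symm.sum_comp,
    Fintype.sum_prod_type]
  refine Finset.sum_congr rfl fun s _ => ?_
  rw [← Equiv.sum_comp (Equiv.inv (Perm (Fin N)))]
  refine Finset.sum_congr rfl fun e _ => ?_
  rw [inv_apply, key, inv_apply, inv_inv]

/-- The summands of `permSum` do not change when two slots of `α` are exchanged. -/
lemma permSum_term_mul_swap (p : P →ₗ[R] Q →ₗ[R] E) {k n N : ℕ} (α : Forms R L P k)
    (η : Forms R L Q n) {l : Fin k → Fin N} {r : Fin n → Fin N} (hl : Function.Injective l)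
    (hlr : ∀ i j, l i ≠ r j) (v : Fin N → L) (σ : Perm (Fin N)) (i i' : Fin k) :
    Perm.sign (σ * swap (l i) (l i')) • p (α (v ∘ ⇑(σ * swap (l i) (l i')) ∘ l))
        (η (v ∘ ⇑(σ * swap (l i) (l i')) ∘ r)) =
      Perm.sign σ • p (α (v ∘ σ ∘ l)) (η (v ∘ σ ∘ r)) := by
  rcases eq_or_ne i i' with rfl | hi
  · simp
  have h1 : v ∘ ⇑(σ * swap (l i) (l i')) ∘ l = (v ∘ σ ∘ l) ∘ swap i i' := by
    funext t
    simp [Function.comp, hl.map_swap]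
  have h2 : v ∘ ⇑(σ * swap (l i) (l i')) ∘ r = v ∘ σ ∘ r := by
    funext t
    simp [Function.comp, swap_apply_of_ne_of_ne (hlr i t).symm (hlr i' t).symm]
  rw [h1, h2, AlternatingMap.map_swap _ _ hi, Perm.sign_mul, Perm.sign_swap (hl.ne hi)]
  simp [Units.smul_def]

lemma permSum_term_mul_swap_right (p : P →ₗ[R] Q →ₗ[R] E) {k n N : ℕ} (α : Forms R L P k)
    (η : Forms R L Q n) {l : Fin k → Fin N} {r : Fin n → Fin N} (hr : Function.Injective r)
    (hlr : ∀ i j, l i ≠ r j) (v : Fin N → L) (σ : Perm (Fin N)) (j j' : Fin n) :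
    Perm.sign (σ * swap (r j) (r j')) • p (α (v ∘ ⇑(σ * swap (r j) (r j')) ∘ l))
        (η (v ∘ ⇑(σ * swap (r j) (r j')) ∘ r)) =
      Perm.sign σ • p (α (v ∘ σ ∘ l)) (η (v ∘ σ ∘ r)) :=
  permSum_term_mul_swap p.flip η α hr (fun i j => (hlr j i).symm) v σ j j'

lemma cons_comp_decomposeFin {N : ℕ} (a : L) (w : Fin N → L) (e : Perm (Fin N)) :
    (Matrix.vecCons a w : Fin (N + 1) → L) ∘ ⇑(Perm.decomposeFin.symm (0, e)) =
      Matrix.vecCons a (w ∘ e) := by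
  funext t
  refine Fin.cases ?_ (fun t => ?_) t <;> simp

/-- Expansion of `permSum` along the first argument, which goes to one of the slots of `α` or to one
of the slots of `η`. By antisymmetry, all slots of `α` contribute the same amount. -/
lemma permSum_vecCons (p : P →ₗ[R] Q →ₗ[R] E) {k n N : ℕ} (α : Forms R L P (k + 1))
    (η : Forms R L Q n) {l : Fin (k + 1) → Fin (N + 1)} {r : Fin n → Fin (N + 1)}
    {l' : Fin k → Fin N} {r' : Fin n → Fin N}
    (hl : Function.Injective l) (hlr : ∀ i j, l i ≠ r j)
    (hl0 : l 0 = 0) (hl' : ∀ i, l i.succ = (l' i).succ) (hr' : ∀ j, r j = (r' j).succ)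
    (hsum : ∀ f : Fin (N + 1) → E, ∑ s, f s = ∑ i, f (l i) + ∑ j, f (r j))
    (a : L) (w : Fin N → L) :
    permSum p α η l r (Matrix.vecCons a w) =
      (k + 1) • permSum p (α.curryLeft a) η l' r' w +
      ∑ j, ∑ e : Perm (Fin N), Perm.sign (Perm.decomposeFin.symm (0, e) * swap 0 (r j)) •
        p (α (Matrix.vecCons a w ∘ ⇑(Perm.decomposeFin.symm (0, e) * swap 0 (r j)) ∘ l))
          (η (Matrix.vecCons a w ∘ ⇑(Perm.decomposeFin.symm (0, e) * swap 0 (r j)) ∘ r)) := by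
  have hL : ∀ (i : Fin (k + 1)) (e : Perm (Fin N)),
      Perm.sign (Perm.decomposeFin.symm (0, e) * swap 0 (l i)) •
        p (α (Matrix.vecCons a w ∘ ⇑(Perm.decomposeFin.symm (0, e) * swap 0 (l i)) ∘ l))
          (η (Matrix.vecCons a w ∘ ⇑(Perm.decomposeFin.symm (0, e) * swap 0 (l i)) ∘ r)) =
      Perm.sign e • p (α.curryLeft a (w ∘ e ∘ l')) (η (w ∘ e ∘ r')) := by
    intro i e
    have h1 : Matrix.vecCons a w ∘ ⇑(Perm.decomposeFin.symm (0, e)) ∘ l =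
        Matrix.vecCons a (w ∘ e ∘ l') := by
      rw [← Function.comp_assoc, cons_comp_decomposeFin]
      funext t
      refine Fin.cases ?_ (fun t => ?_) t <;> simp [hl0, hl']
    have h2 : Matrix.vecCons a w ∘ ⇑(Perm.decomposeFin.symm (0, e)) ∘ r = w ∘ e ∘ r' := by
      rw [← Function.comp_assoc, cons_comp_decomposeFin]
      funext t
      simp [hr']
    have := permSum_term_mul_swap p α η hl hlr (Matrix.vecCons a w)
      (Perm.decomposeFin.symm (0, e)) 0 i
    rw [hl0] at this
    rw [this, h1, h2, Perm.decomposeFin.symm_sign, if_pos rfl, one_mul]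
    rfl
  rw [permSum, sum_perm_eq_sum_swap, hsum]
  congr 1
  rw [Finset.sum_congr rfl fun i _ => Finset.sum_congr rfl fun e _ => hL i e, Finset.sum_const,
    Finset.card_univ, Fintype.card_fin]
  rfl

lemma map_vecCons_eq_snoc {k : ℕ} (α : Forms R L P (k + 1)) (x : L) (y : Fin k → L) :
    α (Matrix.vecCons x y) = (-1 : ℤ) ^ k • α (Fin.snoc y x) := by
  have h : Matrix.vecCons x y = (Fin.snoc y x : Fin (k + 1) → L) ∘ (finRotate (k + 1)).symm := by
    rw [eq_comp_symm]
    funext t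
    refine Fin.lastCases ?_ (fun t => ?_) t
    · simp
    · simp [Fin.snoc_castSucc]
  rw [h, AlternatingMap.map_perm]
  simp [Units.smul_def]

/-- The terms of `permSum` in which the first argument goes to a slot of `η`. To contract `η` with
it, the slot `0` of `α` is exchanged with the first slot of `η`, which costs a sign, and then
becomes the last slot of `α`, which costs `(-1)^k`. -/
lemma permSum_vecCons_right (p : P →ₗ[R] Q →ₗ[R] E) {k n N : ℕ} (α : Forms R L P (k + 1))
    (η : Forms R L Q (n + 1)) {l : Fin (k + 1) → Fin (N + 1)} {r : Fin (n + 1) → Fin (N + 1)}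
    {l' : Fin k → Fin N} {r' : Fin (n + 1) → Fin N}
    (hr : Function.Injective r) (hlr : ∀ i j, l i ≠ r j)
    (hl0 : l 0 = 0) (hl' : ∀ i, l i.succ = (l' i).succ) (hr' : ∀ j, r j = (r' j).succ)
    (a : L) (w : Fin N → L) :
    ∑ j, ∑ e : Perm (Fin N), Perm.sign (Perm.decomposeFin.symm (0, e) * swap 0 (r j)) •
        p (α (Matrix.vecCons a w ∘ ⇑(Perm.decomposeFin.symm (0, e) * swap 0 (r j)) ∘ l))
          (η (Matrix.vecCons a w ∘ ⇑(Perm.decomposeFin.symm (0, e) * swap 0 (r j)) ∘ r)) =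
      (-1 : ℤ) ^ (k + 1) • (n + 1) •
        permSum p α (η.curryLeft a) (Fin.snoc l' (r' 0)) (r' ∘ Fin.succ) w := by
  have hL : ∀ (j : Fin (n + 1)) (e : Perm (Fin N)),
      Perm.sign (Perm.decomposeFin.symm (0, e) * swap 0 (r j)) •
        p (α (Matrix.vecCons a w ∘ ⇑(Perm.decomposeFin.symm (0, e) * swap 0 (r j)) ∘ l))
          (η (Matrix.vecCons a w ∘ ⇑(Perm.decomposeFin.symm (0, e) * swap 0 (r j)) ∘ r)) =
      (-1 : ℤ) ^ (k + 1) • Perm.sign (e * swap (r' 0) (r' j)) •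
        p (α (w ∘ ⇑(e * swap (r' 0) (r' j)) ∘ (Fin.snoc l' (r' 0) : Fin (k + 1) → Fin N)))
        (η.curryLeft a (w ∘ ⇑(e * swap (r' 0) (r' j)) ∘ (r' ∘ Fin.succ))) := by
    intro j e
    have hdec : Perm.decomposeFin.symm (0, e) * swap (r 0) (r j) =
        Perm.decomposeFin.symm (0, e * swap (r' 0) (r' j)) := by
      ext i
      refine congrArg Fin.val (?_ : _ = _)
      rw [hr', hr', Perm.mul_apply]
      refine Fin.cases ?_ (fun i => ?_) i
      · rw [swap_apply_of_ne_of_ne (Fin.succ_ne_zero _).symm (Fin.succ_ne_zero _).symm,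
          Perm.decomposeFin_symm_apply_zero, Perm.decomposeFin_symm_apply_zero]
      · rw [← (Fin.succ_injective _).map_swap, Perm.decomposeFin_symm_apply_succ,
          Perm.decomposeFin_symm_apply_succ, Perm.mul_apply, swap_self, refl_apply]
    have hconj : swap 0 (r j) * swap (r 0) (r j) = swap (r 0) (r j) * swap 0 (r 0) := by
      rw [mul_swap_eq_swap_mul (swap (r 0) (r j)) 0 (r 0), swap_apply_left,
        swap_apply_of_ne_of_ne (by rw [hr']; exact (Fin.succ_ne_zero _).symm)
          (by rw [hr']; exact (Fin.succ_ne_zero _).symm)]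
    rw [← permSum_term_mul_swap_right p α η hr hlr _ _ 0 j, mul_assoc, hconj, ← mul_assoc, hdec]
    set e' := e * swap (r' 0) (r' j)
    have h1 : Matrix.vecCons a w ∘ ⇑(Perm.decomposeFin.symm (0, e') * swap 0 (r 0)) ∘ l =
        Matrix.vecCons (w (e' (r' 0))) (w ∘ e' ∘ l') := by
      rw [Perm.coe_mul, Function.comp_assoc, ← Function.comp_assoc, cons_comp_decomposeFin]
      funext t
      refine Fin.cases ?_ (fun t => ?_) t
      · simp [hl0, hr']
      · have : swap 0 (r 0) (l t.succ) = l t.succ := by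
          refine swap_apply_of_ne_of_ne ?_ (hlr _ _)
          rw [hl']; exact Fin.succ_ne_zero _
        simp only [Function.comp_apply, this]
        simp [hl']
    have h2 : Matrix.vecCons a w ∘ ⇑(Perm.decomposeFin.symm (0, e') * swap 0 (r 0)) ∘ r =
        Matrix.vecCons a (w ∘ e' ∘ (r' ∘ Fin.succ)) := by
      rw [Perm.coe_mul, Function.comp_assoc, ← Function.comp_assoc, cons_comp_decomposeFin]
      funext t
      refine Fin.cases ?_ (fun t => ?_) t
      · simp
      · have : swap 0 (r 0) (r t.succ) = r t.succ := by
          refine swap_apply_of_ne_of_ne ?_ (hr.ne (Fin.succ_ne_zero _))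
          rw [hr']; exact Fin.succ_ne_zero _
        simp only [Function.comp_apply, this]
        simp [hr']
    have h3 : (Fin.snoc (w ∘ e' ∘ l') (w (e' (r' 0))) : Fin (k + 1) → L) =
        w ∘ e' ∘ (Fin.snoc l' (r' 0) : Fin (k + 1) → Fin N) := by
      funext t
      refine Fin.lastCases ?_ (fun t => ?_) t <;> simp
    rw [h1, h2, map_vecCons_eq_snoc, h3, Perm.sign_mul, Perm.decomposeFin.symm_sign, if_pos rfl,
      one_mul, Perm.sign_swap (by rw [hr']; exact (Fin.succ_ne_zero _).symm)]
    simp only [map_zsmul, LinearMap.smul_apply, Units.smul_def,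
      AlternatingMap.curryLeft_apply_apply]
    simp only [smul_smul, Units.val_mul, Units.val_neg, Units.val_one]
    congr 1
    ring
  have hre : ∀ j, ∑ e : Perm (Fin N), (-1 : ℤ) ^ (k + 1) • Perm.sign (e * swap (r' 0) (r' j)) •
        p (α (w ∘ ⇑(e * swap (r' 0) (r' j)) ∘ (Fin.snoc l' (r' 0) : Fin (k + 1) → Fin N)))
        (η.curryLeft a (w ∘ ⇑(e * swap (r' 0) (r' j)) ∘ (r' ∘ Fin.succ))) =
      (-1 : ℤ) ^ (k + 1) •
        permSum p α (η.curryLeft a) (Fin.snoc l' (r' 0)) (r' ∘ Fin.succ) w := by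
    intro j
    rw [permSum, Finset.smul_sum]
    exact Equiv.sum_comp (Equiv.mulRight (swap (r' 0) (r' j))) fun e : Perm (Fin N) =>
      (-1 : ℤ) ^ (k + 1) • Perm.sign e •
        p (α (w ∘ e ∘ (Fin.snoc l' (r' 0) : Fin (k + 1) → Fin N)))
          (η.curryLeft a (w ∘ e ∘ (r' ∘ Fin.succ)))
  rw [Finset.sum_congr rfl fun j _ => Finset.sum_congr rfl fun e _ => hL j e,
    Finset.sum_congr rfl fun j _ => hre j, Finset.sum_const, Finset.card_univ, Fintype.card_fin,
    smul_comm]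

end Shuffle

/-! ### Contraction of the wedge product on vectors -/

section WedgeExpansion

variable {R L : Type*} [CommRing R] [AddCommGroup L] [Module R L]
  {P Q E : Type*} [AddCommGroup P] [Module R P] [AddCommGroup Q] [Module R Q]
  [AddCommGroup E] [Module R E] [Module ℝ E]

/-- The wedge product with a `0`-form is multiplication with its value. -/
lemma wedge_of_isEmpty (p : P →ₗ[R] Q →ₗ[R] E) {n : ℕ} (α : Forms R L P 0)
    (η : Forms R L Q n) (v : Fin (0 + n) → L) :
    wedge p α η v = p (α ![]) (η (v ∘ Fin.natAdd 0)) := by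
  -- The factorials can be cancelled, because `E` is a real vector space.
  have hn : ((Nat.factorial 0 * n.factorial : ℕ) : ℝ) ≠ 0 := by
    exact_mod_cast mul_ne_zero (Nat.factorial_ne_zero 0) n.factorial_ne_zero
  refine smul_right_injective E hn ?_
  simp only [Nat.cast_smul_eq_nsmul]
  rw [factorial_smul_wedge, permSum]
  have hterm : ∀ σ : Equiv.Perm (Fin n),
      Equiv.Perm.sign ((finCongr (zero_add n).symm).permCongr σ) •
        p (α (v ∘ ⇑((finCongr (zero_add n).symm).permCongr σ) ∘ Fin.castAdd n))
          (η (v ∘ ⇑((finCongr (zero_add n).symm).permCongr σ) ∘ Fin.natAdd 0)) =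
      p (α ![]) (η (v ∘ Fin.natAdd 0)) := by
    intro σ
    have h : v ∘ ⇑((finCongr (zero_add n).symm).permCongr σ) ∘ Fin.natAdd 0 =
        (v ∘ Fin.natAdd 0) ∘ σ := by
      funext t
      have e : ∀ t : Fin n, Fin.natAdd 0 t = Fin.cast (zero_add n).symm t := fun t =>
        Fin.ext (by simp)
      simp [Function.comp, e]
    rw [h, AlternatingMap.map_perm, Subsingleton.elim (v ∘ _ ∘ Fin.castAdd n) ![],
      Equiv.Perm.sign_permCongr]
    simp only [Units.smul_def, map_zsmul, smul_smul]
    rw [← Units.val_mul, Int.units_mul_self, Units.val_one, one_smul]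
  rw [← Equiv.sum_comp (finCongr (zero_add n).symm).permCongr,
    Finset.sum_congr rfl fun σ _ => hterm σ, Finset.sum_const, Finset.card_univ,
    Fintype.card_perm, Fintype.card_fin, Nat.factorial_zero, one_mul]

/-- Contraction of the wedge product with a `0`-form on the right. -/
lemma wedge_vecCons_zero (p : P →ₗ[R] Q →ₗ[R] E) {k : ℕ} (α : Forms R L P (k + 1))
    (η : Forms R L Q 0) (a : L) (w : Fin k → L) :
    wedge p α η (Matrix.vecCons a w : Fin (k + 1) → L) = wedge p (α.curryLeft a) η w := by
  have hn : (((k + 1).factorial * Nat.factorial 0 : ℕ) : ℝ) ≠ 0 := by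
    exact_mod_cast mul_ne_zero (Nat.factorial_ne_zero _) (Nat.factorial_ne_zero 0)
  refine smul_right_injective E hn ?_
  simp only [Nat.cast_smul_eq_nsmul]
  have h2 := factorial_smul_wedge p (α.curryLeft a) η w
  refine (factorial_smul_wedge p α η _).trans ?_
  refine (permSum_vecCons p α η (l' := Fin.castAdd 0) (r' := Fin.elim0)
    (Fin.castAdd_injective _ _) (fun i j => j.elim0) rfl (fun i => rfl) (fun j => j.elim0)
    (fun f => by simp) a w).trans ?_
  rw [Finset.univ_eq_empty, Finset.sum_empty, add_zero, Nat.factorial_succ, mul_assoc, mul_smul,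
    h2, Subsingleton.elim (Fin.natAdd k) Fin.elim0]

/-- Contraction is a graded derivation of the wedge product, evaluated on vectors. -/
lemma wedge_vecCons_succ (p : P →ₗ[R] Q →ₗ[R] E) {k n : ℕ} (α : Forms R L P (k + 1))
    (η : Forms R L Q (n + 1)) (a : L) (w : Fin (k + 1 + n) → L) :
    wedge p α η (Matrix.vecCons a w : Fin (k + 1 + n + 1) → L) =
      wedge p (α.curryLeft a) η (w ∘ Fin.cast (by omega)) +
        (-1 : ℤ) ^ (k + 1) • wedge p α (η.curryLeft a) w := by
  have hn : (((k + 1).factorial * (n + 1).factorial : ℕ) : ℝ) ≠ 0 := by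
    exact_mod_cast mul_ne_zero (Nat.factorial_ne_zero _) (Nat.factorial_ne_zero _)
  have hN : k + (n + 1) = k + 1 + n := by omega
  refine smul_right_injective E hn ?_
  simp only [Nat.cast_smul_eq_nsmul]
  have h1 := factorial_smul_wedge p (α.curryLeft a) η (w ∘ Fin.cast hN)
  have h2 := factorial_smul_wedge p α (η.curryLeft a) w
  rw [permSum_cast] at h1
  have e1 : (Fin.snoc (Fin.cast hN ∘ Fin.castAdd (n + 1)) ((Fin.cast hN ∘ Fin.natAdd k) 0) :
      Fin (k + 1) → Fin (k + 1 + n)) = Fin.castAdd n := by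
    funext t
    refine Fin.lastCases ?_ (fun t => ?_) t
    · ext; simp
    · ext; simp
  have e2 : (Fin.cast hN ∘ Fin.natAdd k) ∘ Fin.succ = Fin.natAdd (k + 1) := by
    funext t
    ext
    simp
    omega
  have hlr : ∀ (i : Fin (k + 1)) (j : Fin (n + 1)),
      Fin.castAdd (n + 1) i ≠ Fin.natAdd (k + 1) j := by
    intro i j h
    have := congrArg Fin.val h
    simp at this
    omega
  have hr' : ∀ j : Fin (n + 1), (Fin.natAdd (k + 1) j : Fin (k + 1 + n + 1)) =
      ((Fin.cast hN ∘ Fin.natAdd k) j).succ := by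
    intro j
    ext
    simp
    omega
  refine (factorial_smul_wedge p α η _).trans ?_
  refine (permSum_vecCons p α η (l' := Fin.cast hN ∘ Fin.castAdd (n + 1))
    (r' := Fin.cast hN ∘ Fin.natAdd k)
    (Fin.castAdd_injective _ _) hlr rfl (fun i => rfl) hr'
    (fun f => Fin.sum_univ_add (a := k + 1) (b := n + 1) f) a w).trans ?_
  refine (congrArg _ (permSum_vecCons_right p α η (l' := Fin.cast hN ∘ Fin.castAdd (n + 1))
    (r' := Fin.cast hN ∘ Fin.natAdd k) (Fin.natAdd_injective _ _) hlr rfl (fun i => rfl) hr'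
    a w)).trans ?_
  rw [← h1, e1, e2, ← h2, smul_add, Nat.factorial_succ k, Nat.factorial_succ n]
  congr 1
  · rw [smul_smul]; congr 1; ring
  · rw [smul_comm (_ * _ : ℕ) ((-1 : ℤ) ^ (k + 1)), smul_smul]; congr 2; ring

end WedgeExpansion

/-! ### Contractions and the wedge product on forms of all degrees -/

section Contraction

variable {R L : Type*} [CommRing R] [AddCommGroup L] [Module R L] [Algebra ℝ R]
  {P Q E : Type*} [AddCommGroup P] [Module R P] [AddCommGroup Q] [Module R Q]
  [AddCommGroup E] [Module R E]
  [Module ℝ P] [IsScalarTower ℝ R P] [Module ℝ Q] [IsScalarTower ℝ R Q]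
  [Module ℝ E] [IsScalarTower ℝ R E]

/-- The contraction `ι_a` on `Ω_A(E)`; it vanishes on forms of degree `0`. -/
def contract (a : L) : TotalForms R L E →ₗ[ℝ] TotalForms R L E :=
  DirectSum.toModule ℝ ℕ _ fun n => match n with
    | 0 => 0
    | n + 1 => DirectSum.lof ℝ ℕ (Forms R L E) n ∘ₗ
        { toFun := fun η => AlternatingMap.curryLeft η a
          map_add' := fun _ _ => rfl
          map_smul' := fun _ _ => rfl }

/-- The sign operator of the form degree, `η ↦ (-1)^n η` on `n`-forms. -/
def signOp : TotalForms R L E →ₗ[ℝ] TotalForms R L E :=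
  DirectSum.toModule ℝ ℕ _ fun n => (-1 : ℝ) ^ n • DirectSum.lof ℝ ℕ (Forms R L E) n

/-- The wedge product along a pairing `p`, as a bilinear map `Ω_A(P) × Ω_A(Q) → Ω_A(E)`. -/
def wedgeTotal (p : P →ₗ[R] Q →ₗ[R] E) :
    TotalForms R L P →ₗ[ℝ] TotalForms R L Q →ₗ[ℝ] TotalForms R L E :=
  DirectSum.toModule ℝ ℕ _ fun k =>
    { toFun := fun α => DirectSum.toModule ℝ ℕ _ fun n =>
        DirectSum.lof ℝ ℕ (Forms R L E) (k + n) ∘ₗ wedgeLeft p α n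
      map_add' := fun α β => by
        refine DirectSum.linearMap_ext _ fun n => LinearMap.ext fun η => ?_
        simp only [LinearMap.comp_apply, DirectSum.toModule_lof, LinearMap.add_apply]
        rw [← map_add]
        congr 1
        change wedge p (α + β) η = wedge p α η + wedge p β η
        simp only [wedge, ← AlternatingMap.domCoprod'_apply, TensorProduct.add_tmul, map_add]
        ext v
        simp
      map_smul' := fun c α => by
        refine DirectSum.linearMap_ext _ fun n => LinearMap.ext fun η => ?_
        simp only [LinearMap.comp_apply, DirectSum.toModule_lof, LinearMap.smul_apply,
          RingHom.id_apply]
        rw [← map_smul]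
        congr 1
        change wedge p (c • α) η = c • wedge p α η
        rw [← algebraMap_smul R c α]
        simp only [wedge, ← AlternatingMap.domCoprod'_apply]
        rw [← TensorProduct.smul_tmul', map_smul]
        ext v
        simp }

lemma contract_lof_zero (a : L) (η : Forms R L E 0) :
    contract a (DirectSum.lof ℝ ℕ (Forms R L E) 0 η) = 0 := by
  rw [contract, DirectSum.toModule_lof]
  rfl

lemma contract_lof_succ (a : L) {n : ℕ} (η : Forms R L E (n + 1)) :
    contract a (DirectSum.lof ℝ ℕ (Forms R L E) (n + 1) η) =
      DirectSum.lof ℝ ℕ (Forms R L E) n (η.curryLeft a) := by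
  rw [contract, DirectSum.toModule_lof]
  rfl

lemma signOp_lof {n : ℕ} (η : Forms R L E n) :
    signOp (DirectSum.lof ℝ ℕ (Forms R L E) n η) =
      (-1 : ℝ) ^ n • DirectSum.lof ℝ ℕ (Forms R L E) n η := by
  rw [signOp, DirectSum.toModule_lof, LinearMap.smul_apply]

lemma wedgeTotal_lof (p : P →ₗ[R] Q →ₗ[R] E) {k n : ℕ} (α : Forms R L P k) (η : Forms R L Q n) :
    wedgeTotal p (DirectSum.lof ℝ ℕ (Forms R L P) k α) (DirectSum.lof ℝ ℕ (Forms R L Q) n η) =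
      DirectSum.lof ℝ ℕ (Forms R L E) (k + n) (wedge p α η) := by
  rw [wedgeTotal, DirectSum.toModule_lof]
  exact DirectSum.toModule_lof (M := Forms R L Q) ℝ n η

lemma extendEven_lof (g : P →ₗ[R] E) {n : ℕ} (η : Forms R L P n) :
    extendEven g (DirectSum.lof ℝ ℕ (Forms R L P) n η) =
      DirectSum.lof ℝ ℕ (Forms R L E) n (g.compAlternatingMap η) := by
  rw [extendEven, DirectSum.toModule_lof]
  rfl

lemma mulForm_eq {k : ℕ} (α : Forms R L R k) (x : TotalForms R L E) :
    mulForm α x = wedgeTotal (LinearMap.lsmul R E) (DirectSum.lof ℝ ℕ (Forms R L R) k α) x := by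
  rw [wedgeTotal, DirectSum.toModule_lof]
  rfl

lemma extendOdd_eq (g : P →ₗ[R] E) (x : TotalForms R L P) :
    extendOdd g x = extendEven g (signOp x) := by
  rw [← LinearMap.comp_apply]
  congr 1
  refine DirectSum.linearMap_ext _ fun n => LinearMap.ext fun η => ?_
  simp only [LinearMap.comp_apply, signOp_lof, map_smul, extendEven_lof]
  rw [extendOdd, DirectSum.toModule_lof]
  rfl

lemma extendTwoForm_eq (Φ : Forms R L (P →ₗ[R] E) 2) (x : TotalForms R L P) :
    extendTwoForm Φ x = wedgeTotal LinearMap.id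
      (DirectSum.lof ℝ ℕ (Forms R L (P →ₗ[R] E)) 2 Φ) (signOp x) := by
  rw [← LinearMap.comp_apply]
  congr 1
  refine DirectSum.linearMap_ext _ fun n => LinearMap.ext fun η => ?_
  simp only [LinearMap.comp_apply, signOp_lof, map_smul, wedgeTotal_lof]
  rw [extendTwoForm, DirectSum.toModule_lof]
  rfl

lemma linearMap_eq_of_lof {X : Type*} [AddCommGroup X] [Module ℝ X]
    {f g : TotalForms R L E →ₗ[ℝ] X}
    (h : ∀ n (η : Forms R L E n), f (DirectSum.lof ℝ ℕ _ n η) = g (DirectSum.lof ℝ ℕ _ n η)) :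
    f = g :=
  DirectSum.linearMap_ext _ fun n => LinearMap.ext fun η => h n η

lemma lof_eq_lof {m n : ℕ} (h : n = m) (ζ : Forms R L E m) (θ : Forms R L E n)
    (hv : ∀ v : Fin m → L, ζ v = θ (v ∘ Fin.cast h)) :
    DirectSum.lof ℝ ℕ (Forms R L E) m ζ = DirectSum.lof ℝ ℕ (Forms R L E) n θ := by
  subst h
  congr 1
  exact AlternatingMap.ext hv

lemma lof_apply_zero (η : Forms R L E 0) : (DirectSum.lof ℝ ℕ (Forms R L E) 0 η) 0 = η :=
  DirectSum.lof_apply ℝ _ _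

lemma lof_apply_zero_of_ne {n : ℕ} (hn : n ≠ 0) (η : Forms R L E n) :
    (DirectSum.lof ℝ ℕ (Forms R L E) n η) 0 = 0 :=
  DirectSum.of_eq_of_ne _ _ _ hn.symm

/-- The value of the component of form degree `0`. -/
def eval₀ : TotalForms R L E →ₗ[ℝ] E where
  toFun x := x 0 ![]
  map_add' _ _ := rfl
  map_smul' _ _ := rfl

lemma eval₀_lof_zero (η : Forms R L E 0) : eval₀ (DirectSum.lof ℝ ℕ (Forms R L E) 0 η) = η ![] := by
  change (DirectSum.lof ℝ ℕ (Forms R L E) 0 η) 0 ![] = η ![]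
  rw [lof_apply_zero]

lemma eval₀_lof_of_ne {n : ℕ} (hn : n ≠ 0) (η : Forms R L E n) :
    eval₀ (DirectSum.lof ℝ ℕ (Forms R L E) n η) = 0 := by
  change (DirectSum.lof ℝ ℕ (Forms R L E) n η) 0 ![] = 0
  rw [lof_apply_zero_of_ne hn]
  rfl

lemma contract_apply (a : L) (x : TotalForms R L E) (n : ℕ) :
    (contract a x) n = AlternatingMap.curryLeft (x (n + 1)) a := by
  induction x using DirectSum.induction_on with
  | zero => rw [map_zero]; rfl
  | add x y hx hy =>
    rw [map_add, DirectSum.add_apply, hx, hy, DirectSum.add_apply]; rfl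
  | of k η =>
    change (contract a (DirectSum.lof ℝ ℕ (Forms R L E) k η)) n =
      AlternatingMap.curryLeft ((DirectSum.lof ℝ ℕ (Forms R L E) k η) (n + 1)) a
    cases k with
    | zero =>
      rw [contract_lof_zero]
      have : (DirectSum.lof ℝ ℕ (Forms R L E) 0 η) (n + 1) = 0 :=
        DirectSum.of_eq_of_ne _ _ _ (Nat.succ_ne_zero n)
      rw [this]; rfl
    | succ k =>
      rw [contract_lof_succ]
      by_cases h : k = n
      · subst h
        rw [DirectSum.lof_apply, DirectSum.lof_apply]
      · have h1 : (DirectSum.lof ℝ ℕ (Forms R L E) (k + 1) η) (n + 1) = 0 :=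
          DirectSum.of_eq_of_ne _ _ _ (by omega)
        have h2 : (DirectSum.lof ℝ ℕ (Forms R L E) k (η.curryLeft a)) n = 0 :=
          DirectSum.of_eq_of_ne _ _ _ (by omega)
        rw [h1, h2]; rfl

/-- A form is zero if its contractions and its component of degree `0` are zero. -/
lemma eq_zero_of_contract {x : TotalForms R L E} (h0 : eval₀ x = 0) (h : ∀ a, contract a x = 0) :
    x = 0 := by
  refine DFinsupp.ext fun n => ?_
  cases n with
  | zero =>
    refine AlternatingMap.ext fun v => ?_
    rw [Subsingleton.elim v ![]]
    exact h0
  | succ n =>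
    refine AlternatingMap.ext fun v => ?_
    have := contract_apply (v 0) x n
    rw [h] at this
    have h' := DFunLike.congr_fun this (Fin.tail v)
    rw [AlternatingMap.curryLeft_apply_apply] at h'
    have hv : Matrix.vecCons (v 0) (Fin.tail v) = v := Fin.cons_self_tail v
    rw [hv] at h'
    exact h'.symm

/-- Induction over the form degree, for operators: an operator which commutes with all contractions
up to a scalar factor, and whose values have no component of form degree `0`, is zero. -/
lemma op_eq_zero {Z : TotalForms R L P →ₗ[ℝ] TotalForms R L E} (c : ℝ)
    (h : ∀ a x, contract a (Z x) = c • Z (contract a x)) (h0 : ∀ x, eval₀ (Z x) = 0)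
    (x : TotalForms R L P) : Z x = 0 := by
  suffices hz : Z = 0 by rw [hz]; rfl
  refine linearMap_eq_of_lof fun n => ?_
  induction n with
  | zero =>
    intro η
    refine eq_zero_of_contract (h0 _) fun a => ?_
    rw [h, contract_lof_zero, map_zero, smul_zero]
  | succ n ih =>
    intro η
    refine eq_zero_of_contract (h0 _) fun a => ?_
    rw [h, contract_lof_succ, ih, LinearMap.zero_apply, smul_zero]

/-- Induction over the form degree, for bilinear operations: two of them agree if their contractions
satisfy the same derivation rule, up to scalar factors, and they agree in form degree `0`. -/
lemma op₂_ext {Z Z' : TotalForms R L P →ₗ[ℝ] TotalForms R L Q →ₗ[ℝ] TotalForms R L E} (c c' : ℝ)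
    (h : ∀ a x y, contract a (Z x y) - contract a (Z' x y) =
      c • (Z (contract a x) y - Z' (contract a x) y) +
        c' • (Z (signOp x) (contract a y) - Z' (signOp x) (contract a y)))
    (h0 : ∀ x y, eval₀ (Z x y) = eval₀ (Z' x y)) (x : TotalForms R L P) (y : TotalForms R L Q) :
    Z x y = Z' x y := by
  suffices hz : ∀ N k n : ℕ, k + n = N → ∀ (α : Forms R L P k) (η : Forms R L Q n),
      Z (DirectSum.lof ℝ ℕ _ k α) (DirectSum.lof ℝ ℕ _ n η) =
        Z' (DirectSum.lof ℝ ℕ _ k α) (DirectSum.lof ℝ ℕ _ n η) by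
    have : Z = Z' := linearMap_eq_of_lof fun k α => linearMap_eq_of_lof fun n η =>
      hz (k + n) k n rfl α η
    rw [this]
  intro N
  induction N with
  | zero =>
    intro k n hkn α η
    obtain ⟨rfl, rfl⟩ : k = 0 ∧ n = 0 := by omega
    refine sub_eq_zero.1 (eq_zero_of_contract (by rw [map_sub, h0, sub_self]) fun a => ?_)
    rw [map_sub, h, contract_lof_zero, contract_lof_zero, map_zero, map_zero, map_zero, map_zero,
      LinearMap.zero_apply, sub_zero, smul_zero, smul_zero, add_zero]
  | succ N ih =>
    intro k n hkn α η
    refine sub_eq_zero.1 (eq_zero_of_contract (by rw [map_sub, h0, sub_self]) fun a => ?_)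
    have h1 : Z (contract a (DirectSum.lof ℝ ℕ _ k α)) (DirectSum.lof ℝ ℕ _ n η) =
        Z' (contract a (DirectSum.lof ℝ ℕ _ k α)) (DirectSum.lof ℝ ℕ _ n η) := by
      cases k with
      | zero => rw [contract_lof_zero, map_zero, map_zero, LinearMap.zero_apply]
      | succ k => rw [contract_lof_succ, ih _ _ (by omega)]
    have h2 : Z (signOp (DirectSum.lof ℝ ℕ _ k α)) (contract a (DirectSum.lof ℝ ℕ _ n η)) =
        Z' (signOp (DirectSum.lof ℝ ℕ _ k α)) (contract a (DirectSum.lof ℝ ℕ _ n η)) := by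
      cases n with
      | zero => rw [contract_lof_zero, map_zero, map_zero]
      | succ n => rw [contract_lof_succ, signOp_lof, map_smul, map_smul, LinearMap.smul_apply,
          LinearMap.smul_apply, ih _ _ (by omega)]
    rw [map_sub, h, h1, h2, sub_self, sub_self, smul_zero, smul_zero, add_zero]

/-- `neg_one_smul` with its instances fixed, for which the search inside `simp` and `rw` is slow. -/
lemma neg_one_smul_totalForms (x : TotalForms R L E) : (-1 : ℝ) • x = -x :=
  neg_one_smul ℝ x

lemma map_vecCons_swap {n : ℕ} (η : Forms R L E (n + 2)) (a b : L) (v : Fin n → L) :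
    η (Matrix.vecCons a (Matrix.vecCons b v)) = -η (Matrix.vecCons b (Matrix.vecCons a v)) := by
  have h := η.map_swap (Matrix.vecCons b (Matrix.vecCons a v)) (i := 0) (j := 1) (by simp)
  have e : (Matrix.vecCons b (Matrix.vecCons a v) : Fin (n + 1 + 1) → L) ∘ Equiv.swap 0 1 =
      Matrix.vecCons a (Matrix.vecCons b v) := by
    funext t
    refine Fin.cases ?_ (fun t => ?_) t
    · simp
    · refine Fin.cases ?_ (fun t => ?_) t
      · simp
      · have : Equiv.swap (0 : Fin (n + 1 + 1)) 1 t.succ.succ = t.succ.succ :=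
          Equiv.swap_apply_of_ne_of_ne (by simp [Fin.ext_iff]) (by simp [Fin.ext_iff])
        simp [this]
  rw [← e, h]

lemma contract_add (a b : L) (x : TotalForms R L E) :
    contract (a + b) x = contract a x + contract b x := by
  refine DFinsupp.ext fun n => ?_
  change contract (a + b) x n = contract a x n + contract b x n
  rw [contract_apply, contract_apply, contract_apply, map_add]

lemma contract_neg (a : L) (x : TotalForms R L E) : contract (-a) x = -contract a x := by
  refine DFinsupp.ext fun n => ?_
  change contract (-a) x n = -(contract a x n)
  rw [contract_apply, contract_apply, map_neg]

lemma signOp_signOp (x : TotalForms R L E) : signOp (signOp x) = x := by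
  rw [← LinearMap.comp_apply]
  conv_rhs => rw [← LinearMap.id_apply (R := ℝ) x]
  congr 1
  refine linearMap_eq_of_lof fun n η => ?_
  rw [LinearMap.comp_apply, signOp_lof, map_smul, signOp_lof, smul_smul, ← mul_pow]
  simp

lemma contract_signOp (a : L) (x : TotalForms R L E) :
    contract a (signOp x) = -signOp (contract a x) := by
  rw [← LinearMap.comp_apply, ← LinearMap.comp_apply, ← LinearMap.neg_apply]
  congr 1
  refine linearMap_eq_of_lof fun n η => ?_
  rw [LinearMap.comp_apply, LinearMap.neg_apply, LinearMap.comp_apply, signOp_lof, map_smul]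
  cases n with
  | zero => rw [contract_lof_zero, map_zero, smul_zero, neg_zero]
  | succ n =>
    rw [contract_lof_succ, signOp_lof, pow_succ, mul_neg_one]
    exact neg_smul ((-1 : ℝ) ^ n) (DirectSum.lof ℝ ℕ (Forms R L E) n (η.curryLeft a))

lemma contract_extendEven (a : L) (g : P →ₗ[R] E) (x : TotalForms R L P) :
    contract a (extendEven g x) = extendEven g (contract a x) := by
  rw [← LinearMap.comp_apply, ← LinearMap.comp_apply]
  congr 1
  refine linearMap_eq_of_lof fun n η => ?_
  rw [LinearMap.comp_apply, LinearMap.comp_apply, extendEven_lof]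
  cases n with
  | zero => rw [contract_lof_zero, contract_lof_zero, map_zero]
  | succ n => rw [contract_lof_succ, contract_lof_succ, extendEven_lof]; rfl

lemma signOp_extendEven (g : P →ₗ[R] E) (x : TotalForms R L P) :
    signOp (extendEven g x) = extendEven g (signOp x) := by
  rw [← LinearMap.comp_apply, ← LinearMap.comp_apply]
  congr 1
  refine linearMap_eq_of_lof fun n η => ?_
  rw [LinearMap.comp_apply, LinearMap.comp_apply, extendEven_lof, signOp_lof, signOp_lof, map_smul,
    extendEven_lof]

lemma eval₀_extendEven (g : P →ₗ[R] E) (x : TotalForms R L P) :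
    eval₀ (extendEven g x) = g (eval₀ x) := by
  induction x using DirectSum.induction_on with
  | zero => simp
  | add x y hx hy => rw [map_add, map_add, hx, hy, map_add, map_add]
  | of n η =>
    change eval₀ (extendEven g (DirectSum.lof ℝ ℕ (Forms R L P) n η)) =
      g (eval₀ (DirectSum.lof ℝ ℕ (Forms R L P) n η))
    rw [extendEven_lof]
    cases n with
    | zero => rw [eval₀_lof_zero, eval₀_lof_zero]; rfl
    | succ n =>
      rw [eval₀_lof_of_ne (Nat.succ_ne_zero n), eval₀_lof_of_ne (Nat.succ_ne_zero n), map_zero]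

/-- Contraction is a graded derivation of the wedge product. -/
lemma contract_wedgeTotal (p : P →ₗ[R] Q →ₗ[R] E) (a : L) (x : TotalForms R L P)
    (y : TotalForms R L Q) :
    contract a (wedgeTotal p x y) =
      wedgeTotal p (contract a x) y + wedgeTotal p (signOp x) (contract a y) := by
  have key : (wedgeTotal p).compr₂ (contract a) =
      (wedgeTotal p) ∘ₗ (contract a) + ((wedgeTotal p) ∘ₗ signOp).compl₂ (contract a) := by
    refine linearMap_eq_of_lof fun k α => linearMap_eq_of_lof fun n η => ?_
    simp only [LinearMap.compr₂_apply, LinearMap.add_apply, LinearMap.comp_apply,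
      LinearMap.compl₂_apply, signOp_lof, map_smul, LinearMap.smul_apply, wedgeTotal_lof]
    cases k with
    | zero =>
      rw [contract_lof_zero, map_zero, LinearMap.zero_apply]
      refine Eq.trans ?_ (zero_add _).symm
      rw [pow_zero, one_smul]
      cases n with
      | zero =>
        rw [contract_lof_zero a η, map_zero]
        exact contract_lof_zero a _
      | succ n =>
        rw [contract_lof_succ, wedgeTotal_lof]
        refine (contract_lof_succ (n := 0 + n) a _).trans ?_
        congr 1
        refine AlternatingMap.ext fun v => ?_
        rw [AlternatingMap.curryLeft_apply_apply]
        refine (wedge_of_isEmpty p α η _).trans ?_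
        rw [wedge_of_isEmpty, AlternatingMap.curryLeft_apply_apply]
        congr 2
        funext t
        refine Fin.cases ?_ (fun t => ?_) t
        · have : Fin.natAdd 0 (0 : Fin (n + 1)) = (0 : Fin (0 + n + 1)) := Fin.ext (by simp)
          rw [Function.comp_apply, this]; rfl
        · have : Fin.natAdd 0 t.succ = (Fin.natAdd 0 t).succ := Fin.ext (by simp)
          rw [Function.comp_apply, this]; rfl
    | succ k =>
      rw [contract_lof_succ, wedgeTotal_lof]
      cases n with
      | zero =>
        rw [contract_lof_zero, map_zero, smul_zero]
        refine Eq.trans ?_ (add_zero _).symm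
        refine (contract_lof_succ (n := k + 0) a _).trans ?_
        congr 1
        refine AlternatingMap.ext fun v => ?_
        rw [AlternatingMap.curryLeft_apply_apply]
        exact wedge_vecCons_zero p α η a v
      | succ n =>
        rw [contract_lof_succ, wedgeTotal_lof, ← map_smul]
        refine (contract_lof_succ (n := k + 1 + n) a _).trans ?_
        have hN : k + 1 + n = k + (n + 1) := by omega
        have h1 : DirectSum.lof ℝ ℕ (Forms R L E) (k + (n + 1)) (wedge p (α.curryLeft a) η) =
            DirectSum.lof ℝ ℕ (Forms R L E) (k + 1 + n)
              ((wedge p (α.curryLeft a) η).domDomCongr (finCongr hN.symm)) :=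
          lof_eq_lof hN _ _ fun v => by
            rw [AlternatingMap.domDomCongr_apply]
            rfl
        rw [h1, ← map_add]
        congr 1
        refine AlternatingMap.ext fun v => ?_
        rw [AlternatingMap.curryLeft_apply_apply]
        refine (wedge_vecCons_succ p α η a v).trans ?_
        rw [AlternatingMap.add_apply, AlternatingMap.smul_apply, ← Int.cast_smul_eq_zsmul ℝ]
        push_cast
        rfl
  exact LinearMap.congr_fun₂ key x y

lemma eval₀_wedgeTotal (p : P →ₗ[R] Q →ₗ[R] E) (x : TotalForms R L P) (y : TotalForms R L Q) :
    eval₀ (wedgeTotal p x y) = p (eval₀ x) (eval₀ y) := by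
  induction x using DirectSum.induction_on with
  | zero => simp
  | add x x' hx hx' => simp only [map_add, LinearMap.add_apply, hx, hx']
  | of k α =>
    induction y using DirectSum.induction_on with
    | zero => simp
    | add y y' hy hy' => simp only [map_add, hy, hy']
    | of n η =>
      change eval₀ (wedgeTotal p (DirectSum.lof ℝ ℕ (Forms R L P) k α)
        (DirectSum.lof ℝ ℕ (Forms R L Q) n η)) = p (eval₀ (DirectSum.lof ℝ ℕ (Forms R L P) k α))
          (eval₀ (DirectSum.lof ℝ ℕ (Forms R L Q) n η))
      rw [wedgeTotal_lof]
      rcases Nat.eq_zero_or_pos k with rfl | hk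
      · rcases Nat.eq_zero_or_pos n with rfl | hn
        · rw [eval₀_lof_zero α, eval₀_lof_zero η]
          refine (eval₀_lof_zero (wedge p α η : Forms R L E 0)).trans ?_
          refine (wedge_of_isEmpty p α η _).trans ?_
          rw [Subsingleton.elim (_ ∘ Fin.natAdd 0) ![]]
        · rw [eval₀_lof_of_ne hn.ne', eval₀_lof_of_ne (by omega), map_zero]
      · rw [eval₀_lof_of_ne hk.ne', eval₀_lof_of_ne (by omega), map_zero, LinearMap.zero_apply]

lemma signOp_wedgeTotal (p : P →ₗ[R] Q →ₗ[R] E) (x : TotalForms R L P) (y : TotalForms R L Q) :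
    signOp (wedgeTotal p x y) = wedgeTotal p (signOp x) (signOp y) := by
  have key : (wedgeTotal p).compr₂ signOp =
      ((wedgeTotal p) ∘ₗ signOp).compl₂ (signOp (R := R) (L := L)) := by
    refine linearMap_eq_of_lof fun k α => linearMap_eq_of_lof fun n η => ?_
    simp only [LinearMap.compr₂_apply, LinearMap.comp_apply,
      LinearMap.compl₂_apply, signOp_lof, map_smul, LinearMap.smul_apply, wedgeTotal_lof]
    rw [smul_smul, ← pow_add, Nat.add_comm n k]
  exact LinearMap.congr_fun₂ key x y

end Contraction

/-! ### The Cartan calculus of a connection -/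

section Cartan

variable {R L : Type*} [CommRing R] [Algebra ℝ R] [LieRing L] [LieAlgebra ℝ L] [Module R L]
  [LieRingModule L R] [LieRinehartRing R L] [LieRinehartAlgebra ℝ R L]
  {P Q E : Type*} [AddCommGroup P] [Module R P] [AddCommGroup Q] [Module R Q]
  [AddCommGroup E] [Module R E]
  [Module ℝ P] [IsScalarTower ℝ R P] [Module ℝ Q] [IsScalarTower ℝ R Q]
  [Module ℝ E] [IsScalarTower ℝ R E]

namespace Connection

lemma d_lof (D : Connection R L E) {n : ℕ} (η : Forms R L E n) :
    D.d (DirectSum.lof ℝ ℕ (Forms R L E) n η) =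
      DirectSum.lof ℝ ℕ (Forms R L E) (n + 1) (D.koszul n η) := by
  rw [d, DirectSum.toModule_lof]
  rfl

lemma d_apply_zero (D : Connection R L E) (x : TotalForms R L E) : (D.d x) 0 = 0 := by
  induction x using DirectSum.induction_on with
  | zero => rw [map_zero]; rfl
  | add x y hx hy => rw [map_add, DirectSum.add_apply, hx, hy, add_zero]
  | of k η =>
    change (D.d (DirectSum.lof ℝ ℕ (Forms R L E) k η)) 0 = 0
    rw [d_lof, lof_apply_zero_of_ne (Nat.succ_ne_zero k)]

lemma d_apply_succ (D : Connection R L E) (x : TotalForms R L E) (n : ℕ) :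
    (D.d x) (n + 1) = D.koszul n (x n) := by
  induction x using DirectSum.induction_on with
  | zero => rw [map_zero]; exact (map_zero _).symm
  | add x y hx hy => rw [map_add, DirectSum.add_apply, hx, hy, DirectSum.add_apply, map_add]
  | of k η =>
    change (D.d (DirectSum.lof ℝ ℕ (Forms R L E) k η)) (n + 1) =
      D.koszul n ((DirectSum.lof ℝ ℕ (Forms R L E) k η) n)
    rw [d_lof]
    by_cases h : k = n
    · subst h
      rw [DirectSum.lof_apply, DirectSum.lof_apply]
    · have h1 : (DirectSum.lof ℝ ℕ (Forms R L E) (k + 1) (D.koszul k η)) (n + 1) = 0 :=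
        DirectSum.of_eq_of_ne _ _ _ (by omega)
      have h2 : (DirectSum.lof ℝ ℕ (Forms R L E) k η) n = 0 :=
        DirectSum.of_eq_of_ne _ _ _ (by omega)
      rw [h1, h2, map_zero]

/-- The Lie derivative `L_a = ι_a d + d ι_a` along a section `a` of `A`, for an `A`-connection. -/
def lieDeriv (D : Connection R L E) (a : L) : TotalForms R L E →ₗ[ℝ] TotalForms R L E :=
  contract a ∘ₗ D.d + D.d ∘ₗ contract a

lemma contract_d (D : Connection R L E) (a : L) (x : TotalForms R L E) :
    contract a (D.d x) = D.lieDeriv a x - D.d (contract a x) := by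
  rw [lieDeriv, LinearMap.add_apply, LinearMap.comp_apply, LinearMap.comp_apply,
    add_sub_cancel_right]

lemma eval₀_d (D : Connection R L E) (x : TotalForms R L E) : eval₀ (D.d x) = 0 := by
  change (D.d x) 0 ![] = 0
  rw [d_apply_zero]
  rfl

lemma lieDeriv_apply_zero (D : Connection R L E) (a : L) (x : TotalForms R L E) (v : Fin 0 → L) :
    (D.lieDeriv a x) 0 v = D a (x 0 v) := by
  rw [lieDeriv, LinearMap.add_apply, LinearMap.comp_apply, LinearMap.comp_apply,
    DirectSum.add_apply, d_apply_zero, add_zero, contract_apply, d_apply_succ,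
    AlternatingMap.curryLeft_apply_apply]
  change D.koszulFun (x 0) _ = _
  rw [koszulFun, Subsingleton.elim (Fin.removeNth 0 _) v]
  rfl

lemma sum_Ici_succ {M : Type*} [AddCommMonoid M] {n : ℕ} (i : Fin n) (f : Fin (n + 1) → M) :
    ∑ j ≥ i.succ, f j = ∑ j ≥ i, f j.succ := by
  have : (Finset.Ici i.succ) = (Finset.Ici i).map (Fin.succEmb n) := by
    ext j
    refine Fin.cases ?_ (fun j => ?_) j
    · simp
    · simp
  rw [this, Finset.sum_map]
  rfl

/-- The usual formula for the Lie derivative: the double sums of the Koszul formulas for `ι_a d` and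
`d ι_a` cancel. -/
lemma lieDeriv_apply_succ (D : Connection R L E) (a : L) (x : TotalForms R L E) {n : ℕ}
    (w : Fin (n + 1) → L) :
    (D.lieDeriv a x) (n + 1) w = D a (x (n + 1) w) - ∑ j : Fin (n + 1), (-1 : ℤ) ^ (j : ℕ) •
      x (n + 1) (Matrix.vecCons ⁅a, w j⁆ (j.removeNth w)) := by
  rw [lieDeriv, LinearMap.add_apply, LinearMap.comp_apply, LinearMap.comp_apply,
    DirectSum.add_apply, d_apply_succ, contract_apply, d_apply_succ,
    contract_apply, AlternatingMap.add_apply, AlternatingMap.curryLeft_apply_apply]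
  generalize x (n + 1) = η
  change D.koszulFun η (Matrix.vecCons a w) + D.koszulFun (AlternatingMap.curryLeft η a) w = _
  rw [koszulFun_vecCons]
  cases n with
  | zero =>
    simp [koszulFun]
    abel
  | succ n =>
    have hs : ∀ i : Fin (n + 1), ∑ j ≥ i.succ, (-1 : ℤ) ^ (i + 1 + (j + 1) : ℕ) •
        η (Matrix.vecCons ⁅w i.castSucc, w j⁆
          (j.removeNth (i.castSucc.succ.removeNth (Matrix.vecCons a w)))) =
        -∑ j ≥ i, (-1 : ℤ) ^ (i + (j + 1) : ℕ) • η (Matrix.vecCons a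
          (Matrix.vecCons ⁅w i.castSucc, w j.succ⁆ (j.removeNth (i.castSucc.removeNth w)))) := by
      intro i
      rw [sum_Ici_succ, ← Finset.sum_neg_distrib]
      refine Finset.sum_congr rfl fun j _ => ?_
      rw [removeNth_succ_vecCons, removeNth_succ_vecCons, map_vecCons_swap, smul_neg, Fin.val_succ]
      congr 2
      ring
    simp only [koszulFun, AlternatingMap.curryLeft_apply_apply]
    rw [Finset.sum_congr rfl fun i _ => hs i]
    simp only [pow_succ, mul_neg_one, neg_smul, Finset.sum_neg_distrib]
    abel

lemma eval₀_lieDeriv (D : Connection R L E) (a : L) (x : TotalForms R L E) :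
    eval₀ (D.lieDeriv a x) = D a (eval₀ x) :=
  D.lieDeriv_apply_zero a x ![]

/-- The Cartan relation `[L_a, ι_b] = ι_[a, b]`. -/
lemma contract_lieDeriv (D : Connection R L E) (a b : L) (x : TotalForms R L E) :
    contract b (D.lieDeriv a x) = D.lieDeriv a (contract b x) - contract ⁅a, b⁆ x := by
  refine DFinsupp.ext fun n => AlternatingMap.ext fun w => ?_
  change (contract b (D.lieDeriv a x)) n w =
    (D.lieDeriv a (contract b x)) n w - (contract ⁅a, b⁆ x) n w
  rw [contract_apply, contract_apply, AlternatingMap.curryLeft_apply_apply,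
    AlternatingMap.curryLeft_apply_apply, lieDeriv_apply_succ, Fin.sum_univ_succ]
  have h0 : (0 : Fin (n + 1)).removeNth (Matrix.vecCons b w) = w := rfl
  rw [h0, Matrix.cons_val_zero, Fin.val_zero, pow_zero, one_smul]
  cases n with
  | zero =>
    rw [lieDeriv_apply_zero, contract_apply, AlternatingMap.curryLeft_apply_apply,
      Finset.univ_eq_empty, Finset.sum_empty, add_zero]
  | succ n =>
    rw [lieDeriv_apply_succ, contract_apply, AlternatingMap.curryLeft_apply_apply]
    have hs : ∀ j : Fin (n + 1), (-1 : ℤ) ^ (j.succ : ℕ) • x (n + 1 + 1)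
        (Matrix.vecCons ⁅a, (Matrix.vecCons b w : Fin (n + 2) → L) j.succ⁆
          (j.succ.removeNth (Matrix.vecCons b w))) =
        (-1 : ℤ) ^ (j : ℕ) • (AlternatingMap.curryLeft (x (n + 1 + 1)) b)
          (Matrix.vecCons ⁅a, w j⁆ (j.removeNth w)) := by
      intro j
      rw [removeNth_succ_vecCons, map_vecCons_swap, Matrix.cons_val_succ, Fin.val_succ, pow_succ,
        mul_neg_one, smul_neg, neg_smul, neg_neg, AlternatingMap.curryLeft_apply_apply]
    rw [Finset.sum_congr rfl fun j _ => hs j]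
    abel

lemma signOp_d (D : Connection R L E) (x : TotalForms R L E) :
    signOp (D.d x) = -D.d (signOp x) := by
  rw [← LinearMap.comp_apply, ← LinearMap.comp_apply, ← LinearMap.neg_apply]
  congr 1
  refine linearMap_eq_of_lof fun n η => ?_
  rw [LinearMap.comp_apply, LinearMap.neg_apply, LinearMap.comp_apply, signOp_lof, map_smul,
    d_lof, signOp_lof, pow_succ, mul_neg_one]
  exact neg_smul ((-1 : ℝ) ^ n) (DirectSum.lof ℝ ℕ (Forms R L E) (n + 1) (D.koszul n η))

lemma signOp_lieDeriv (D : Connection R L E) (a : L) (x : TotalForms R L E) :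
    signOp (D.lieDeriv a x) = D.lieDeriv a (signOp x) := by
  have h : ∀ y : TotalForms R L E, signOp (contract a y) = -contract a (signOp y) := fun y => by
    rw [contract_signOp, neg_neg]
  simp only [lieDeriv, LinearMap.add_apply, LinearMap.comp_apply, map_add, signOp_d, h, map_neg,
    neg_neg]

end Connection

end Cartan

/-! ### Operators of bundle maps and of two-forms -/

section Operators

variable {R L : Type*} [CommRing R] [Algebra ℝ R] [LieRing L] [LieAlgebra ℝ L] [Module R L]
  [LieRingModule L R] [LieRinehartRing R L] [LieRinehartAlgebra ℝ R L]
  {P Q E E' : Type*} [AddCommGroup P] [Module R P] [AddCommGroup Q] [Module R Q]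
  [AddCommGroup E] [Module R E] [AddCommGroup E'] [Module R E']
  [Module ℝ P] [IsScalarTower ℝ R P] [Module ℝ Q] [IsScalarTower ℝ R Q]
  [Module ℝ E] [IsScalarTower ℝ R E] [Module ℝ E'] [IsScalarTower ℝ R E']

lemma extendEven_comp (g : Q →ₗ[R] E) (f : P →ₗ[R] Q) (x : TotalForms R L P) :
    extendEven g (extendEven f x) = extendEven (g ∘ₗ f) x := by
  rw [← LinearMap.comp_apply (extendEven g)]
  congr 1
  refine linearMap_eq_of_lof fun n η => ?_
  rw [LinearMap.comp_apply, extendEven_lof, extendEven_lof, extendEven_lof]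
  rfl

lemma extendEven_id (x : TotalForms R L E) : extendEven LinearMap.id x = x := by
  conv_rhs => rw [← LinearMap.id_apply (R := ℝ) x]
  congr 1
  refine linearMap_eq_of_lof fun n η => ?_
  rw [extendEven_lof]
  rfl

lemma extendEven_zero (x : TotalForms R L P) : extendEven (0 : P →ₗ[R] E) x = 0 := by
  conv_rhs => rw [← LinearMap.zero_apply (σ₁₂ := RingHom.id ℝ) x]
  congr 1
  refine linearMap_eq_of_lof fun n η => ?_
  rw [extendEven_lof, LinearMap.zero_apply]
  exact map_zero _

lemma extendEven_add (f g : P →ₗ[R] E) (x : TotalForms R L P) :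
    extendEven (f + g) x = extendEven f x + extendEven g x := by
  rw [← LinearMap.add_apply]
  congr 1
  refine linearMap_eq_of_lof fun n η => ?_
  rw [LinearMap.add_apply, extendEven_lof, extendEven_lof, extendEven_lof, ← map_add]
  rfl

lemma extendEven_neg (f : P →ₗ[R] E) (x : TotalForms R L P) :
    extendEven (-f) x = -extendEven f x := by
  rw [eq_neg_iff_add_eq_zero, ← extendEven_add, neg_add_cancel, extendEven_zero]

lemma extendEven_sub (f g : P →ₗ[R] E) (x : TotalForms R L P) :
    extendEven (f - g) x = extendEven f x - extendEven g x := by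
  rw [sub_eq_add_neg, extendEven_add, extendEven_neg, sub_eq_add_neg]

/-- A two-step version of `op_eq_zero`, for operators which behave like the wedge product with a
two-form. -/
lemma op_eq_zero_of_contract_contract {Z : TotalForms R L P →ₗ[ℝ] TotalForms R L E}
    {Z₁ : L → TotalForms R L P →ₗ[ℝ] TotalForms R L E} (c c₁ : ℝ)
    (h : ∀ a x, contract a (Z x) = c • Z (contract a x) + Z₁ a x)
    (h₁ : ∀ a b x, contract b (Z₁ a x) = c₁ • Z₁ a (contract b x))
    (h0 : ∀ x, eval₀ (Z x) = 0) (h0₁ : ∀ a x, eval₀ (Z₁ a x) = 0) (x : TotalForms R L P) :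
    Z x = 0 := by
  have hZ₁ : ∀ a x, Z₁ a x = 0 := fun a => op_eq_zero c₁ (h₁ a) (h0₁ a)
  exact op_eq_zero c (fun a x => by rw [h, hZ₁, add_zero]) h0 x

namespace Connection

/-- The derivative `∇_a g` of a bundle map `g`, `p ↦ ∇_a (g p) - g (∇_a p)`. -/
def hom (DP : Connection R L P) (DE : Connection R L E) (a : L) (g : P →ₗ[R] E) : P →ₗ[R] E where
  toFun p := DE a (g p) - g (DP a p)
  map_add' p q := by simp only [map_add]; abel
  map_smul' f p := by
    simp only [map_smul, Connection.leibniz, map_add, RingHom.id_apply]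
    module

/-- The curvature `F(a, b) = [∇_a, ∇_b] - ∇_[a, b]` of an `A`-connection. -/
def curv (D : Connection R L E) (a b : L) : E →ₗ[R] E where
  toFun e := D a (D b e) - D b (D a e) - D ⁅a, b⁆ e
  map_add' p q := by simp only [map_add]; abel
  map_smul' f e := by
    simp only [Connection.leibniz, map_add, RingHom.id_apply, lie_lie]
    module

lemma lieDeriv_extendEven (DP : Connection R L P) (DE : Connection R L E) (a : L) (g : P →ₗ[R] E)
    (x : TotalForms R L P) :
    DE.lieDeriv a (extendEven g x) =
      extendEven g (DP.lieDeriv a x) + extendEven (hom DP DE a g) x := by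
  have := op_eq_zero (Z := DE.lieDeriv a ∘ₗ extendEven g - extendEven g ∘ₗ DP.lieDeriv a -
    extendEven (hom DP DE a g)) 1 (fun b x => by
      simp only [LinearMap.sub_apply, LinearMap.comp_apply, map_sub, contract_lieDeriv,
        contract_extendEven, one_smul]
      abel) (fun x => by
      simp only [LinearMap.sub_apply, LinearMap.comp_apply, map_sub, eval₀_lieDeriv,
        eval₀_extendEven]
      exact sub_self _) x
  simp only [LinearMap.sub_apply, LinearMap.comp_apply] at this
  rw [sub_sub, sub_eq_zero] at this
  exact this

lemma lieDeriv_extendEven_of_parallel {DP : Connection R L P} {DE : Connection R L E}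
    {g : P →ₗ[R] E} (hg : ∀ a p, DE a (g p) = g (DP a p)) (a : L) (x : TotalForms R L P) :
    DE.lieDeriv a (extendEven g x) = extendEven g (DP.lieDeriv a x) := by
  have h : hom DP DE a g = 0 := LinearMap.ext fun p => sub_eq_zero.2 (hg a p)
  rw [lieDeriv_extendEven DP, h, extendEven_zero, add_zero]

/-- The extension of a parallel bundle map commutes with the covariant derivatives. -/
lemma d_extendEven_of_parallel {DP : Connection R L P} {DE : Connection R L E}
    {g : P →ₗ[R] E} (hg : ∀ a p, DE a (g p) = g (DP a p)) (x : TotalForms R L P) :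
    DE.d (extendEven g x) = extendEven g (DP.d x) := by
  have := op_eq_zero (Z := DE.d ∘ₗ extendEven g - extendEven g ∘ₗ DP.d) (-1) (fun b x => by
      simp only [LinearMap.sub_apply, LinearMap.comp_apply, map_sub, contract_d,
        contract_extendEven, lieDeriv_extendEven_of_parallel hg, neg_one_smul_totalForms]
      abel) (fun x => by
      simp only [LinearMap.sub_apply, LinearMap.comp_apply, map_sub, eval₀_d,
        eval₀_extendEven, map_zero, sub_self]) x
  exact sub_eq_zero.1 this

/-- The commutator of Lie derivatives, `[L_a, L_b] = L_[a, b] + F(a, b)`. -/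
lemma lieDeriv_lieDeriv (D : Connection R L E) (a b : L) (x : TotalForms R L E) :
    D.lieDeriv a (D.lieDeriv b x) = D.lieDeriv b (D.lieDeriv a x) + D.lieDeriv ⁅a, b⁆ x +
      extendEven (D.curv a b) x := by
  have := op_eq_zero (Z := D.lieDeriv a ∘ₗ D.lieDeriv b - (D.lieDeriv b ∘ₗ D.lieDeriv a +
    D.lieDeriv ⁅a, b⁆ + extendEven (D.curv a b))) 1 (fun c x => by
      simp only [LinearMap.sub_apply, LinearMap.add_apply, LinearMap.comp_apply, map_sub, map_add,
        contract_lieDeriv, contract_extendEven, one_smul]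
      rw [lie_lie, sub_eq_add_neg ⁅a, ⁅b, c⁆⁆, contract_add, contract_neg]
      abel) (fun x => by
      simp only [LinearMap.sub_apply, LinearMap.add_apply, LinearMap.comp_apply, map_sub, map_add,
        eval₀_lieDeriv, eval₀_extendEven, curv, LinearMap.coe_mk, AddHom.coe_mk]
      abel) x
  exact sub_eq_zero.1 this

/-- If an operator `Z` has the contractions of the wedge product with minus the curvature of `∇`,
then `d_∇ ∘ d_∇ = -Z`. -/
lemma d_d_add_eq_zero (D : Connection R L E) {Z : TotalForms R L E →ₗ[ℝ] TotalForms R L E}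
    {Z₁ : L → TotalForms R L E →ₗ[ℝ] TotalForms R L E} {G : L → L → E →ₗ[R] E}
    (h : ∀ a x, contract a (Z x) = Z (contract a x) + Z₁ a x)
    (h₁ : ∀ a b x, contract b (Z₁ a x) = extendEven (G a b) x - Z₁ a (contract b x))
    (h0 : ∀ x, eval₀ (Z x) = 0) (h0₁ : ∀ a x, eval₀ (Z₁ a x) = 0)
    (hG : ∀ a b e, D a (D b e) - D b (D a e) - D ⁅a, b⁆ e + G a b e = 0)
    (x : TotalForms R L E) : D.d (D.d x) + Z x = 0 := by
  have hF : ∀ a b, D.curv a b = -G a b := fun a b => LinearMap.ext fun e =>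
    eq_neg_of_add_eq_zero_left (hG a b e)
  exact op_eq_zero_of_contract_contract (Z := D.d ∘ₗ D.d + Z)
    (Z₁ := fun a => D.lieDeriv a ∘ₗ D.d - D.d ∘ₗ D.lieDeriv a + Z₁ a) 1 (-1)
    (fun a x => by
      simp only [LinearMap.sub_apply, LinearMap.add_apply, LinearMap.comp_apply, map_sub, map_add,
        contract_d, h, one_smul]
      abel)
    (fun a b x => by
      simp only [LinearMap.sub_apply, LinearMap.add_apply, LinearMap.comp_apply, map_sub, map_add,
        contract_d, contract_lieDeriv, h₁, neg_one_smul_totalForms]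
      rw [lieDeriv_lieDeriv D a b, hF, extendEven_neg]
      abel)
    (fun x => by simp only [LinearMap.add_apply, LinearMap.comp_apply, map_add, eval₀_d, h0,
      add_zero])
    (fun a x => by simp only [LinearMap.sub_apply, LinearMap.add_apply, LinearMap.comp_apply,
      map_add, map_sub, eval₀_d, eval₀_lieDeriv, h0₁, map_zero, add_zero, sub_zero]) x

end Connection

section ScalarForms

lemma extendEven_wedgeTotal (g : P →ₗ[R] E) (x : TotalForms R L R) (y : TotalForms R L P) :
    extendEven g (wedgeTotal (LinearMap.lsmul R P) x y) =
      wedgeTotal (LinearMap.lsmul R E) x (extendEven g y) :=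
  op₂_ext (Z := (wedgeTotal (LinearMap.lsmul R P)).compr₂ (extendEven g))
    (Z' := (wedgeTotal (LinearMap.lsmul R E)).compl₂ (extendEven (L := L) g)) 1 1
    (fun a x y => by
      simp only [LinearMap.compr₂_apply, LinearMap.compl₂_apply,
        contract_wedgeTotal, contract_extendEven, one_smul, map_add]
      abel)
    (fun x y => by
      simp only [LinearMap.compr₂_apply, LinearMap.compl₂_apply,
        eval₀_wedgeTotal, eval₀_extendEven, LinearMap.lsmul_apply, map_smul]) x y

lemma lieDeriv_wedgeTotal (D : Connection R L E) (a : L) (x : TotalForms R L R)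
    (y : TotalForms R L E) :
    D.lieDeriv a (wedgeTotal (LinearMap.lsmul R E) x y) =
      wedgeTotal (LinearMap.lsmul R E) ((Connection.trivial R L).lieDeriv a x) y +
        wedgeTotal (LinearMap.lsmul R E) x (D.lieDeriv a y) :=
  op₂_ext (Z := (wedgeTotal (LinearMap.lsmul R E)).compr₂ (D.lieDeriv a))
    (Z' := wedgeTotal (LinearMap.lsmul R E) ∘ₗ (Connection.trivial R L).lieDeriv a +
      (wedgeTotal (LinearMap.lsmul R E)).compl₂ (D.lieDeriv a)) 1 1
    (fun b x y => by
      simp only [LinearMap.add_apply, LinearMap.comp_apply, LinearMap.sub_apply,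
        LinearMap.compr₂_apply, LinearMap.compl₂_apply, map_sub,
        contract_wedgeTotal, Connection.contract_lieDeriv, one_smul, map_add,
        Connection.signOp_lieDeriv]
      abel)
    (fun x y => by
      simp only [LinearMap.add_apply, LinearMap.comp_apply,
        LinearMap.compr₂_apply, LinearMap.compl₂_apply, map_add, Connection.eval₀_lieDeriv,
        eval₀_wedgeTotal, LinearMap.lsmul_apply, Connection.leibniz]
      exact add_comm _ _) x y

lemma d_wedgeTotal (D : Connection R L E) (x : TotalForms R L R) (y : TotalForms R L E) :
    D.d (wedgeTotal (LinearMap.lsmul R E) x y) =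
      wedgeTotal (LinearMap.lsmul R E) ((Connection.trivial R L).d x) y +
        wedgeTotal (LinearMap.lsmul R E) (signOp x) (D.d y) :=
  op₂_ext (Z := (wedgeTotal (LinearMap.lsmul R E)).compr₂ D.d)
    (Z' := wedgeTotal (LinearMap.lsmul R E) ∘ₗ (Connection.trivial R L).d +
      ((wedgeTotal (LinearMap.lsmul R E)) ∘ₗ signOp).compl₂ D.d) (-1) (-1)
    (fun b x y => by
      simp only [LinearMap.add_apply, LinearMap.comp_apply, LinearMap.sub_apply,
        LinearMap.compr₂_apply, LinearMap.compl₂_apply, map_sub, map_neg, LinearMap.neg_apply,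
        contract_wedgeTotal, Connection.contract_d, neg_one_smul_totalForms, map_add,
        lieDeriv_wedgeTotal, Connection.signOp_d, signOp_signOp, contract_signOp]
      abel)
    (fun x y => by
      simp only [LinearMap.add_apply, LinearMap.comp_apply,
        LinearMap.compr₂_apply, LinearMap.compl₂_apply, map_add, Connection.eval₀_d,
        eval₀_wedgeTotal, map_zero, LinearMap.zero_apply, add_zero]) x y

end ScalarForms

section TwoForms

/-- The wedge product `Φ ∧ x` with a `Hom(P, E)`-valued two-form `Φ`. -/
def wedgeTwo (Φ : Forms R L (P →ₗ[R] E) 2) : TotalForms R L P →ₗ[ℝ] TotalForms R L E :=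
  wedgeTotal LinearMap.id (DirectSum.lof ℝ ℕ (Forms R L (P →ₗ[R] E)) 2 Φ)

/-- The wedge product `(ι_a Φ) ∧ x` with the contraction of a `Hom(P, E)`-valued two-form `Φ`. -/
def wedgeOne (Φ : Forms R L (P →ₗ[R] E) 2) (a : L) : TotalForms R L P →ₗ[ℝ] TotalForms R L E :=
  wedgeTotal LinearMap.id (DirectSum.lof ℝ ℕ (Forms R L (P →ₗ[R] E)) 1 (Φ.curryLeft a))

lemma wedgeTotal_lof_zero (f : Forms R L (P →ₗ[R] E) 0) (x : TotalForms R L P) :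
    wedgeTotal LinearMap.id (DirectSum.lof ℝ ℕ (Forms R L (P →ₗ[R] E)) 0 f) x =
      extendEven (f ![]) x := by
  have := op_eq_zero (Z := wedgeTotal LinearMap.id
    (DirectSum.lof ℝ ℕ (Forms R L (P →ₗ[R] E)) 0 f) - extendEven (f ![])) 1 (fun a x => by
      simp only [LinearMap.sub_apply, map_sub, contract_wedgeTotal, contract_extendEven,
        contract_lof_zero, signOp_lof, pow_zero, one_smul, map_zero, LinearMap.zero_apply,
        zero_add]) (fun x => by
      simp only [LinearMap.sub_apply, map_sub, eval₀_wedgeTotal, eval₀_extendEven, eval₀_lof_zero,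
        LinearMap.id_apply, sub_self]) x
  exact sub_eq_zero.1 this

lemma contract_wedgeTwo (Φ : Forms R L (P →ₗ[R] E) 2) (a : L) (x : TotalForms R L P) :
    contract a (wedgeTwo Φ x) = wedgeTwo Φ (contract a x) + wedgeOne Φ a x := by
  rw [wedgeTwo, contract_wedgeTotal, signOp_lof, contract_lof_succ, neg_one_sq, one_smul, add_comm]
  rfl

lemma contract_wedgeOne (Φ : Forms R L (P →ₗ[R] E) 2) (a b : L) (x : TotalForms R L P) :
    contract b (wedgeOne Φ a x) = extendEven (Φ ![a, b]) x - wedgeOne Φ a (contract b x) := by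
  rw [wedgeOne, contract_wedgeTotal, signOp_lof, contract_lof_succ, pow_one, map_smul,
    LinearMap.smul_apply, neg_one_smul_totalForms, wedgeTotal_lof_zero, ← sub_eq_add_neg]
  rfl

lemma eval₀_wedgeTwo (Φ : Forms R L (P →ₗ[R] E) 2) (x : TotalForms R L P) :
    eval₀ (wedgeTwo Φ x) = 0 := by
  rw [wedgeTwo, eval₀_wedgeTotal, eval₀_lof_of_ne two_ne_zero, map_zero, LinearMap.zero_apply]

lemma eval₀_wedgeOne (Φ : Forms R L (P →ₗ[R] E) 2) (a : L) (x : TotalForms R L P) :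
    eval₀ (wedgeOne Φ a x) = 0 := by
  rw [wedgeOne, eval₀_wedgeTotal, eval₀_lof_of_ne one_ne_zero, map_zero, LinearMap.zero_apply]

/-- If bundle maps `f`, `g` intertwine the two-forms `Φ`, `Φ'`, then their extensions intertwine the
wedge products with these. -/
lemma extendEven_wedgeTwo {Φ : Forms R L (P →ₗ[R] E) 2} {Φ' : Forms R L (Q →ₗ[R] E') 2}
    {g : E →ₗ[R] E'} {f : P →ₗ[R] Q} (h : ∀ v p, g (Φ v p) = Φ' v (f p)) (x : TotalForms R L P) :
    extendEven g (wedgeTwo Φ x) = wedgeTwo Φ' (extendEven f x) := by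
  have hc : ∀ v, g ∘ₗ Φ v = Φ' v ∘ₗ f := fun v => LinearMap.ext (h v)
  have := op_eq_zero_of_contract_contract (Z := extendEven g ∘ₗ wedgeTwo Φ -
    wedgeTwo Φ' ∘ₗ extendEven f) (Z₁ := fun a => extendEven g ∘ₗ wedgeOne Φ a -
    wedgeOne Φ' a ∘ₗ extendEven f) 1 (-1)
    (fun a x => by
      simp only [LinearMap.sub_apply, LinearMap.comp_apply, map_sub, contract_extendEven,
        contract_wedgeTwo, map_add, one_smul]
      abel)
    (fun a b x => by
      simp only [LinearMap.sub_apply, LinearMap.comp_apply, map_sub, contract_extendEven,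
        contract_wedgeOne, neg_one_smul_totalForms, extendEven_comp, hc]
      abel)
    (fun x => by
      simp only [LinearMap.sub_apply, LinearMap.comp_apply, map_sub, eval₀_extendEven,
        eval₀_wedgeTwo, map_zero, sub_zero])
    (fun a x => by
      simp only [LinearMap.sub_apply, LinearMap.comp_apply, map_sub, eval₀_extendEven,
        eval₀_wedgeOne, map_zero, sub_zero]) x
  exact sub_eq_zero.1 this

lemma wedgeTotal_wedgeOne (Φ : Forms R L (P →ₗ[R] E) 2) (a : L) (x : TotalForms R L R)
    (y : TotalForms R L P) :
    wedgeTotal (LinearMap.lsmul R E) x (wedgeOne Φ a y) =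
      wedgeOne Φ a (wedgeTotal (LinearMap.lsmul R P) (signOp x) y) :=
  op₂_ext (Z := (wedgeTotal (LinearMap.lsmul R E)).compl₂ (wedgeOne Φ a))
    (Z' := (wedgeTotal (LinearMap.lsmul R P) ∘ₗ signOp).compr₂ (wedgeOne Φ a)) 1 (-1)
    (fun b x y => by
      simp only [LinearMap.comp_apply, LinearMap.compr₂_apply, LinearMap.compl₂_apply, map_sub,
        map_neg, map_add, LinearMap.neg_apply, contract_wedgeTotal, contract_wedgeOne, one_smul,
        neg_one_smul_totalForms, signOp_signOp, contract_signOp, extendEven_wedgeTotal]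
      abel)
    (fun x y => by
      simp only [LinearMap.comp_apply, LinearMap.compr₂_apply, LinearMap.compl₂_apply,
        eval₀_wedgeTotal, eval₀_wedgeOne, map_zero]) x y

/-- Scalar forms commute with two-forms. -/
lemma wedgeTotal_wedgeTwo (Φ : Forms R L (P →ₗ[R] E) 2) (x : TotalForms R L R)
    (y : TotalForms R L P) :
    wedgeTotal (LinearMap.lsmul R E) x (wedgeTwo Φ y) =
      wedgeTwo Φ (wedgeTotal (LinearMap.lsmul R P) x y) :=
  op₂_ext (Z := (wedgeTotal (LinearMap.lsmul R E)).compl₂ (wedgeTwo Φ))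
    (Z' := (wedgeTotal (LinearMap.lsmul R P)).compr₂ (wedgeTwo Φ)) 1 1
    (fun b x y => by
      simp only [LinearMap.compr₂_apply, LinearMap.compl₂_apply, map_add,
        contract_wedgeTotal, contract_wedgeTwo, one_smul, wedgeTotal_wedgeOne, signOp_signOp]
      abel)
    (fun x y => by
      simp only [LinearMap.compr₂_apply, LinearMap.compl₂_apply,
        eval₀_wedgeTotal, eval₀_wedgeTwo, map_zero]) x y

/-- A two-form that satisfies the Bianchi identity, i.e. whose covariant derivative vanishes,
commutes with the covariant derivatives. -/
lemma d_wedgeTwo {DP : Connection R L P} {DE : Connection R L E} {Φ : Forms R L (P →ₗ[R] E) 2}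
    (h : ∀ a b c p,
      DE a (Φ ![b, c] p) - Φ ![b, c] (DP a p) - (DE b (Φ ![a, c] p) - Φ ![a, c] (DP b p)) +
        (DE c (Φ ![a, b] p) - Φ ![a, b] (DP c p)) - Φ ![⁅a, b⁆, c] p - Φ ![b, ⁅a, c⁆] p +
        Φ ![a, ⁅b, c⁆] p = 0) (x : TotalForms R L P) :
    DE.d (wedgeTwo Φ x) = wedgeTwo Φ (DP.d x) := by
  have hB : ∀ a b c, DP.hom DE a (Φ ![b, c]) - DP.hom DE b (Φ ![a, c]) + DP.hom DE c (Φ ![a, b]) -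
      Φ ![⁅a, b⁆, c] - Φ ![b, ⁅a, c⁆] + Φ ![a, ⁅b, c⁆] = 0 := fun a b c =>
    LinearMap.ext fun p => h a b c p
  -- The double contraction of `d ∘ (Φ ∧ ·) - (Φ ∧ ·) ∘ d`. When it is contracted once more, the
  -- terms free of further contractions are those of the Bianchi identity.
  have hX : ∀ a b x, DE.lieDeriv a (wedgeOne Φ b x) - wedgeOne Φ b (DP.lieDeriv a x) -
      wedgeOne Φ ⁅a, b⁆ x - (DE.lieDeriv b (wedgeOne Φ a x) - wedgeOne Φ a (DP.lieDeriv b x)) +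
      (DE.d (extendEven (Φ ![a, b]) x) - extendEven (Φ ![a, b]) (DP.d x)) = 0 := fun a b =>
    op_eq_zero (Z := DE.lieDeriv a ∘ₗ wedgeOne Φ b - wedgeOne Φ b ∘ₗ DP.lieDeriv a -
      wedgeOne Φ ⁅a, b⁆ - (DE.lieDeriv b ∘ₗ wedgeOne Φ a - wedgeOne Φ a ∘ₗ DP.lieDeriv b) +
      (DE.d ∘ₗ extendEven (Φ ![a, b]) - extendEven (Φ ![a, b]) ∘ₗ DP.d)) (-1)
      (fun c x => by
        have hc : extendEven (DP.hom DE a (Φ ![b, c])) x - extendEven (DP.hom DE b (Φ ![a, c])) x +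
            extendEven (DP.hom DE c (Φ ![a, b])) x - extendEven (Φ ![⁅a, b⁆, c]) x -
            extendEven (Φ ![b, ⁅a, c⁆]) x + extendEven (Φ ![a, ⁅b, c⁆]) x = 0 := by
          rw [← extendEven_sub, ← extendEven_add, ← extendEven_sub, ← extendEven_sub,
            ← extendEven_add, hB, extendEven_zero]
        simp only [LinearMap.sub_apply, LinearMap.add_apply, LinearMap.comp_apply, map_sub, map_add,
          Connection.contract_d, Connection.contract_lieDeriv, contract_wedgeOne,
          contract_extendEven, Connection.lieDeriv_extendEven DP, neg_one_smul_totalForms]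
        rw [← sub_eq_zero, ← hc]
        abel)
      (fun x => by
        simp only [LinearMap.sub_apply, LinearMap.add_apply, LinearMap.comp_apply, map_sub, map_add,
          Connection.eval₀_d, Connection.eval₀_lieDeriv, eval₀_wedgeOne, eval₀_extendEven, map_zero,
          sub_zero, add_zero])
  have := op_eq_zero_of_contract_contract (Z := DE.d ∘ₗ wedgeTwo Φ - wedgeTwo Φ ∘ₗ DP.d)
    (Z₁ := fun a => DE.lieDeriv a ∘ₗ wedgeTwo Φ - wedgeTwo Φ ∘ₗ DP.lieDeriv a -
      (DE.d ∘ₗ wedgeOne Φ a + wedgeOne Φ a ∘ₗ DP.d)) (-1) 1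
    (fun a x => by
      simp only [LinearMap.sub_apply, LinearMap.add_apply, LinearMap.comp_apply, map_sub, map_add,
        Connection.contract_d, contract_wedgeTwo, neg_one_smul_totalForms]
      abel)
    (fun a b x => by
      simp only [LinearMap.sub_apply, LinearMap.add_apply, LinearMap.comp_apply, map_sub, map_add,
        Connection.contract_d, Connection.contract_lieDeriv, contract_wedgeTwo, contract_wedgeOne,
        one_smul]
      rw [← sub_eq_zero, ← hX a b x]
      abel)
    (fun x => by
      simp only [LinearMap.sub_apply, LinearMap.comp_apply, map_sub, Connection.eval₀_d,
        eval₀_wedgeTwo, sub_zero])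
    (fun a x => by
      simp only [LinearMap.sub_apply, LinearMap.add_apply, LinearMap.comp_apply, map_sub, map_add,
        Connection.eval₀_d, Connection.eval₀_lieDeriv, eval₀_wedgeTwo, eval₀_wedgeOne, map_zero,
        sub_zero, add_zero]) x
  exact sub_eq_zero.1 this

end TwoForms

end Operators

/-! ### Identities of the basic connections and the basic curvature -/

section Adjoint

variable {R L T : Type*} [CommRing R] [Algebra ℝ R]
  [LieRing L] [LieAlgebra ℝ L] [Module R L]
  [LieRingModule L R] [LieRinehartRing R L] [LieRinehartAlgebra ℝ R L]
  [LieRing T] [LieAlgebra ℝ T] [Module R T]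
  [LieRingModule T R] [LieRinehartRing R T] [LieRinehartAlgebra ℝ R T]

namespace AnchorData

variable (𝔞 : AnchorData R L T) (D : Connection R T L)

lemma basicL_apply (a b : L) : 𝔞.basicL D a b = D (𝔞.anchor b) a + ⁅a, b⁆ := rfl

lemma anchor_basicL (a b : L) : 𝔞.anchor (𝔞.basicL D a b) = 𝔞.basicT D a (𝔞.anchor b) := by
  rw [basicL_apply, basicT_apply, map_add, 𝔞.anchor_lie]

/-- On the image of the anchor, the basic curvature is minus the curvature of the basic connection
on `A`. -/
lemma basicL_curv_add (a b c : L) :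
    𝔞.basicL D a (𝔞.basicL D b c) - 𝔞.basicL D b (𝔞.basicL D a c) - 𝔞.basicL D ⁅a, b⁆ c +
      𝔞.basicCurvFun D (𝔞.anchor c) a b = 0 := by
  simp only [basicL_apply, basicCurvFun, basicT_apply, map_add, LinearMap.add_apply,
    𝔞.anchor_lie, lie_lie]
  rw [← lie_skew b (D (𝔞.anchor c) a)]
  abel

/-- The anchor maps the basic curvature to minus the curvature of the basic connection on `TM`. -/
lemma basicT_curv_add (a b : L) (u : T) :
    𝔞.basicT D a (𝔞.basicT D b u) - 𝔞.basicT D b (𝔞.basicT D a u) - 𝔞.basicT D ⁅a, b⁆ u +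
      𝔞.anchor (𝔞.basicCurvFun D u a b) = 0 := by
  simp only [basicCurvFun, basicT_apply, map_add, map_sub, LinearMap.add_apply,
    𝔞.anchor_lie, lie_lie]
  rw [← lie_skew (𝔞.anchor b) (𝔞.anchor (D u a))]
  abel

/-- The Bianchi identity of the basic curvature: its covariant derivative along the basic
connections vanishes. -/
lemma basicCurvature_bianchi (a b c : L) (u : T) :
    𝔞.basicL D a (𝔞.basicCurvFun D u b c) - 𝔞.basicCurvFun D (𝔞.basicT D a u) b c -
      (𝔞.basicL D b (𝔞.basicCurvFun D u a c) - 𝔞.basicCurvFun D (𝔞.basicT D b u) a c) +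
      (𝔞.basicL D c (𝔞.basicCurvFun D u a b) - 𝔞.basicCurvFun D (𝔞.basicT D c u) a b) -
      𝔞.basicCurvFun D u ⁅a, b⁆ c - 𝔞.basicCurvFun D u b ⁅a, c⁆ +
      𝔞.basicCurvFun D u a ⁅b, c⁆ = 0 := by
  -- The terms `∇_{ρ R(u)(x, y)} z` are rewritten through the curvature of `∇^bas` on `TM`.
  have hR : ∀ x y, 𝔞.anchor (𝔞.basicCurvFun D u x y) = 𝔞.basicT D ⁅x, y⁆ u +
      𝔞.basicT D y (𝔞.basicT D x u) - 𝔞.basicT D x (𝔞.basicT D y u) := by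
    intro x y
    have h := 𝔞.basicT_curv_add D x y u
    rw [← sub_eq_zero, ← h]
    abel
  have hs : ∀ (v : T) (x y : L), ⁅D v x, y⁆ = -⁅y, D v x⁆ := fun v x y => (lie_skew _ _).symm
  simp only [basicL_apply, hR, map_add, map_sub, LinearMap.add_apply, LinearMap.sub_apply]
  simp only [basicCurvFun]
  -- The remaining occurrences of `∇^bas` on `TM` cancel in pairs; unfolding them would undo this.
  generalize 𝔞.basicT D = t
  simp only [lie_lie, hs, lie_add, lie_sub, lie_neg, map_sub, neg_sub]
  abel

lemma basicCurvature_two (a b : L) (u : T) :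
    𝔞.basicCurvature D ![a, b] u = 𝔞.basicCurvFun D u a b := rfl

end AnchorData

namespace AnchorData.Quadruple

variable {𝔞 : AnchorData R L T} (q : 𝔞.Quadruple)

/-- The projection to `K` is parallel for the basic connection on `A`. -/
lemma prK_basicL (a b : L) :
    q.prK (𝔞.basicL q.nablaA a b) = 𝔞.moduleK a (q.prK b) := by
  have hF : q.prF (𝔞.anchor b) = 𝔞.toImage b := q.prF_image (𝔞.toImage b)
  have hK : (q.nablaK (𝔞.anchor b) (q.prK a) : L) = ⁅q.τ (𝔞.toImage b), (q.prK a : L)⁆ :=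
    q.nablaK_image (𝔞.toImage b) (q.prK a)
  have hI : 𝔞.toImage (𝔞.basicL q.nablaA a b) =
      q.nablaF (𝔞.anchor b) (𝔞.toImage a) - q.lieF (𝔞.toImage b) (𝔞.toImage a) := by
    refine Subtype.ext ?_
    rw [toImage_coe, basicL_apply, map_add, anchor_nablaA, 𝔞.anchor_lie, ← lie_skew,
      ← sub_eq_add_neg]
    rfl
  refine Subtype.ext ?_
  change _ = ⁅a, (q.prK b : L)⁆
  rw [prK_coe, hI, basicL_apply, nablaA_apply, hF, hK, prK_coe, prK_coe, curvτ,
    LinearMap.mk₂_apply, map_sub, lie_sub, lie_sub, ← lie_skew a (q.τ (𝔞.toImage b))]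
  abel

lemma prB_basicT (a : L) (u : T) :
    𝔞.prB (𝔞.basicT q.nablaA a u) = q.moduleB a (𝔞.prB u) := by
  rw [basicT_apply, map_add, 𝔞.prB_eq_zero (𝔞.anchor_mem _), zero_add, moduleB_prB]

lemma basicL_coe_kernel (a : L) (k : 𝔞.kernel) :
    𝔞.basicL q.nablaA a (k : L) = (𝔞.moduleK a k : L) := by
  have hk : 𝔞.anchor (k : L) = 0 := k.2
  rw [basicL_apply, hk, map_zero, LinearMap.zero_apply, zero_add]
  rfl

lemma prK_kernel (k : 𝔞.kernel) : q.prK (k : L) = k := by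
  refine Subtype.ext ?_
  have h : 𝔞.toImage (k : L) = 0 := Subtype.ext k.2
  rw [prK_coe, h, map_zero, sub_zero]

lemma prK_τ (u : 𝔞.image) : q.prK (q.τ u) = 0 := by
  refine Subtype.ext ?_
  have h : 𝔞.toImage (q.τ u) = u := Subtype.ext (q.anchor_τ u)
  rw [prK_coe, h, sub_self]
  rfl

lemma prF_basicT (a : L) (u : T) :
    (q.prF (𝔞.basicT q.nablaA a u) : T) = 𝔞.basicT q.nablaA a (q.prF u : T) := by
  rw [prF_coe, prB_basicT, ← basicT_j, ← map_sub, ← prF_coe]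

/-- The splitting `τ ∘ pr_F` is parallel for the basic connections. -/
lemma basicL_τ_prF (a : L) (u : T) :
    𝔞.basicL q.nablaA a ((q.τ ∘ₗ q.prF) u) = (q.τ ∘ₗ q.prF) (𝔞.basicT q.nablaA a u) := by
  rw [LinearMap.comp_apply, LinearMap.comp_apply]
  have h1 : q.prK (𝔞.basicL q.nablaA a (q.τ (q.prF u))) = 0 := by
    rw [prK_basicL, prK_τ, map_zero]
  have h2 : 𝔞.toImage (𝔞.basicL q.nablaA a (q.τ (q.prF u))) =
      q.prF (𝔞.basicT q.nablaA a u) := by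
    refine Subtype.ext ?_
    rw [toImage_coe, anchor_basicL, q.anchor_τ, prF_basicT]
  have h3 := congrArg Subtype.val h1
  rw [prK_coe, h2] at h3
  exact sub_eq_zero.1 h3

/-- The `K`-component of the basic curvature vanishes on `F`, since `K` is a flat `A`-module. -/
lemma prK_basicCurvature_image (v : Fin 2 → L) (u : 𝔞.image) :
    q.prK (𝔞.basicCurvature q.nablaA v (u : T)) = 0 := by
  have h := congrArg q.prK (𝔞.basicL_curv_add q.nablaA (v 0) (v 1) (q.τ u))
  rw [q.anchor_τ, map_add, map_sub, map_sub, prK_basicL, prK_basicL, prK_basicL, prK_basicL,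
    prK_basicL, prK_τ, map_zero, map_zero, map_zero, map_zero, map_zero, sub_zero, sub_zero,
    zero_add] at h
  exact h

lemma coe_Ω (v : Fin 2 → L) (b : 𝔞.Normal) :
    (q.Ω v b : L) = -𝔞.basicCurvature q.nablaA v (q.j b) := rfl

lemma prK_basicCurvature (v : Fin 2 → L) (u : T) :
    q.prK (𝔞.basicCurvature q.nablaA v u) = -q.Ω v (𝔞.prB u) := by
  have hu : u = (q.prF u : T) + q.j (𝔞.prB u) := by rw [prF_coe, sub_add_cancel]
  have hΩ : 𝔞.basicCurvature q.nablaA v (q.j (𝔞.prB u)) = ((-q.Ω v (𝔞.prB u) : 𝔞.kernel) : L) := by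
    rw [Submodule.coe_neg, coe_Ω, neg_neg]
  conv_lhs => rw [hu]
  rw [map_add, map_add, prK_basicCurvature_image, zero_add, hΩ, prK_kernel]

end AnchorData.Quadruple

end Adjoint

/-! ### The adjoint representation and its contraction -/

section Degree

variable {R L : Type*} [CommRing R] [Algebra ℝ R] [LieRing L] [LieAlgebra ℝ L] [Module R L]
  [LieRingModule L R] [LieRinehartRing R L] [LieRinehartAlgebra ℝ R L]
  {P E : Type*} [AddCommGroup P] [Module R P] [AddCommGroup E] [Module R E]
  [Module ℝ P] [IsScalarTower ℝ R P] [Module ℝ E] [IsScalarTower ℝ R E]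

lemma lof_apply_of_ne {n k : ℕ} (h : k ≠ n) (η : Forms R L E n) :
    (DirectSum.lof ℝ ℕ (Forms R L E) n η) k = 0 :=
  DirectSum.of_eq_of_ne _ _ _ h

/-- An operator that shifts the form degree by `r` on forms of pure degree maps elements which are
concentrated in degree `m` to elements which are concentrated in degree `m + r`. -/
lemma apply_eq_zero_of_shift {f : TotalForms R L P →ₗ[ℝ] TotalForms R L E} {r : ℕ}
    (hf : ∀ n (η : Forms R L P n) (k : ℕ), k ≠ n + r →
      f (DirectSum.lof ℝ ℕ (Forms R L P) n η) k = 0)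
    {x : TotalForms R L P} {m : ℤ} (hx : ∀ k : ℕ, (k : ℤ) ≠ m → x k = 0)
    (k : ℕ) (hk : (k : ℤ) ≠ m + r) : f x k = 0 := by
  classical
  rw [← DirectSum.sum_support_of x, map_sum, DirectSum.sum_apply]
  refine Finset.sum_eq_zero fun i _ => ?_
  change f (DirectSum.lof ℝ ℕ (Forms R L P) i (x i)) k = 0
  by_cases hi : (i : ℤ) = m
  · exact hf i _ k (by omega)
  · rw [hx i hi, map_zero, map_zero]
    rfl

lemma d_shift (D : Connection R L E) (n : ℕ) (η : Forms R L E n) (k : ℕ) (hk : k ≠ n + 1) :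
    D.d (DirectSum.lof ℝ ℕ (Forms R L E) n η) k = 0 := by
  rw [Connection.d_lof, lof_apply_of_ne hk]

lemma extendEven_shift (g : P →ₗ[R] E) (n : ℕ) (η : Forms R L P n) (k : ℕ) (hk : k ≠ n + 0) :
    extendEven g (DirectSum.lof ℝ ℕ (Forms R L P) n η) k = 0 := by
  rw [extendEven_lof, lof_apply_of_ne (by omega)]

lemma extendOdd_shift (g : P →ₗ[R] E) (n : ℕ) (η : Forms R L P n) (k : ℕ) (hk : k ≠ n + 0) :
    extendOdd g (DirectSum.lof ℝ ℕ (Forms R L P) n η) k = 0 := by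
  rw [extendOdd_eq, signOp_lof, map_smul, extendEven_lof, DirectSum.smul_apply,
    lof_apply_of_ne (by omega), smul_zero]

lemma extendTwoForm_shift (Φ : Forms R L (P →ₗ[R] E) 2) (n : ℕ) (η : Forms R L P n) (k : ℕ)
    (hk : k ≠ n + 2) : extendTwoForm Φ (DirectSum.lof ℝ ℕ (Forms R L P) n η) k = 0 := by
  rw [extendTwoForm_eq, signOp_lof, map_smul, wedgeTotal_lof, DirectSum.smul_apply,
    lof_apply_of_ne (by omega), smul_zero]

lemma extendTwoForm_eq_wedgeTwo (Φ : Forms R L (P →ₗ[R] E) 2) (x : TotalForms R L P) :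
    extendTwoForm Φ x = wedgeTwo Φ (signOp x) :=
  extendTwoForm_eq Φ x

lemma signOp_wedgeTwo (Φ : Forms R L (P →ₗ[R] E) 2) (x : TotalForms R L P) :
    signOp (wedgeTwo Φ x) = wedgeTwo Φ (signOp x) := by
  rw [wedgeTwo, signOp_wedgeTotal, signOp_lof, neg_one_sq, one_smul]

lemma extendEven_mulForm (g : P →ₗ[R] E) {k : ℕ} (α : Forms R L R k) (x : TotalForms R L P) :
    extendEven g (mulForm α x) = mulForm α (extendEven g x) := by
  rw [mulForm_eq, mulForm_eq, extendEven_wedgeTotal]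

lemma signOp_mulForm {k : ℕ} (α : Forms R L R k) (x : TotalForms R L P) :
    signOp (mulForm α x) = (-1 : ℝ) ^ k • mulForm α (signOp x) := by
  rw [mulForm_eq, mulForm_eq, signOp_wedgeTotal, signOp_lof, map_smul, LinearMap.smul_apply]

lemma extendOdd_mulForm (g : P →ₗ[R] E) {k : ℕ} (α : Forms R L R k) (x : TotalForms R L P) :
    extendOdd g (mulForm α x) = (-1 : ℝ) ^ k • mulForm α (extendOdd g x) := by
  rw [extendOdd_eq, extendOdd_eq, signOp_mulForm, map_smul, extendEven_mulForm]

lemma extendTwoForm_mulForm (Φ : Forms R L (P →ₗ[R] E) 2) {k : ℕ} (α : Forms R L R k)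
    (x : TotalForms R L P) :
    extendTwoForm Φ (mulForm α x) = (-1 : ℝ) ^ k • mulForm α (extendTwoForm Φ x) := by
  rw [extendTwoForm_eq_wedgeTwo, extendTwoForm_eq_wedgeTwo, signOp_mulForm, map_smul, mulForm_eq,
    mulForm_eq, wedgeTotal_wedgeTwo]

lemma d_mulForm (D : Connection R L E) {k : ℕ} (α : Forms R L R k) (x : TotalForms R L E) :
    D.d (mulForm α x) =
      mulForm ((Connection.trivial R L).koszul k α) x + (-1 : ℝ) ^ k • mulForm α (D.d x) := by
  rw [mulForm_eq, mulForm_eq, mulForm_eq, d_wedgeTotal, signOp_lof, Connection.d_lof, map_smul,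
    LinearMap.smul_apply]

end Degree

section Main

variable {R L T : Type*} [CommRing R] [Algebra ℝ R]
  [LieRing L] [LieAlgebra ℝ L] [Module R L]
  [LieRingModule L R] [LieRinehartRing R L] [LieRinehartAlgebra ℝ R L]
  [LieRing T] [LieAlgebra ℝ T] [Module R T]
  [LieRingModule T R] [LieRinehartRing R T] [LieRinehartAlgebra ℝ R T]

namespace AnchorData

variable (𝔞 : AnchorData R L T) (D : Connection R T L)

lemma adjointD_apply (x : TotalForms R L L) (y : TotalForms R L T) :
    𝔞.adjointD D (x, y) = ((𝔞.basicL D).d x + extendTwoForm (𝔞.basicCurvature D) y,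
      extendOdd 𝔞.anchor x + (𝔞.basicT D).d y) := rfl

/-- The curvature of the basic connection on `A` is `-R^bas ∘ ρ`. -/
lemma d_basicL_d_basicL (x : TotalForms R L L) :
    (𝔞.basicL D).d ((𝔞.basicL D).d x) +
      wedgeTwo (𝔞.basicCurvature D) (extendEven 𝔞.anchor x) = 0 := by
  have h := (𝔞.basicL D).d_d_add_eq_zero
    (Z := wedgeTwo (𝔞.basicCurvature D) ∘ₗ extendEven 𝔞.anchor)
    (Z₁ := fun a => wedgeOne (𝔞.basicCurvature D) a ∘ₗ extendEven 𝔞.anchor)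
    (G := fun a b => 𝔞.basicCurvature D ![a, b] ∘ₗ 𝔞.anchor)
    (fun a x => by
      simp only [LinearMap.comp_apply, contract_wedgeTwo, contract_extendEven])
    (fun a b x => by
      simp only [LinearMap.comp_apply, contract_wedgeOne, contract_extendEven, extendEven_comp])
    (fun x => by rw [LinearMap.comp_apply, eval₀_wedgeTwo])
    (fun a x => by rw [LinearMap.comp_apply, eval₀_wedgeOne])
    (fun a b e => by
      rw [LinearMap.comp_apply, basicCurvature_two]
      exact 𝔞.basicL_curv_add D a b e) x
  rwa [LinearMap.comp_apply] at h

/-- The curvature of the basic connection on `TM` is `-ρ ∘ R^bas`. -/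
lemma d_basicT_d_basicT (y : TotalForms R L T) :
    (𝔞.basicT D).d ((𝔞.basicT D).d y) +
      extendEven 𝔞.anchor (wedgeTwo (𝔞.basicCurvature D) y) = 0 := by
  have h := (𝔞.basicT D).d_d_add_eq_zero
    (Z := extendEven 𝔞.anchor ∘ₗ wedgeTwo (𝔞.basicCurvature D))
    (Z₁ := fun a => extendEven 𝔞.anchor ∘ₗ wedgeOne (𝔞.basicCurvature D) a)
    (G := fun a b => 𝔞.anchor ∘ₗ 𝔞.basicCurvature D ![a, b])
    (fun a x => by
      simp only [LinearMap.comp_apply, contract_wedgeTwo, contract_extendEven, map_add])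
    (fun a b x => by
      simp only [LinearMap.comp_apply, contract_wedgeOne, contract_extendEven, extendEven_comp,
        map_sub])
    (fun x => by rw [LinearMap.comp_apply, eval₀_extendEven, eval₀_wedgeTwo, map_zero])
    (fun a x => by rw [LinearMap.comp_apply, eval₀_extendEven, eval₀_wedgeOne, map_zero])
    (fun a b u => by
      rw [LinearMap.comp_apply, basicCurvature_two]
      exact 𝔞.basicT_curv_add D a b u) y
  rwa [LinearMap.comp_apply] at h

lemma d_basicL_wedgeTwo (y : TotalForms R L T) :
    (𝔞.basicL D).d (wedgeTwo (𝔞.basicCurvature D) y) =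
      wedgeTwo (𝔞.basicCurvature D) ((𝔞.basicT D).d y) :=
  d_wedgeTwo (fun a b c u => by
    simp only [basicCurvature_two]
    exact 𝔞.basicCurvature_bianchi D a b c u) y

/-- The adjoint representation up to homotopy. The diagonal entries of `D ∘ D` vanish by the
relation of `R^bas` to the curvatures of the basic connections, the entry from `TM` to `A` by the
Bianchi identity, and the entry from `A` to `TM` since the anchor is parallel. -/
theorem isRepUpToHomotopy_adjointD : IsRepUpToHomotopy (𝔞.adjointD D) where
  degree := by
    rintro n ⟨x, y⟩ ⟨hx, hy⟩
    rw [adjointD_apply]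
    refine ⟨fun k hk => ?_, fun k hk => ?_⟩
    · rw [DirectSum.add_apply, apply_eq_zero_of_shift (d_shift (𝔞.basicL D)) hx k (by omega),
        apply_eq_zero_of_shift (extendTwoForm_shift (𝔞.basicCurvature D)) hy k (by omega), add_zero]
    · rw [DirectSum.add_apply, apply_eq_zero_of_shift (extendOdd_shift 𝔞.anchor) hx k (by omega),
        apply_eq_zero_of_shift (d_shift (𝔞.basicT D)) hy k (by omega), add_zero]
  square_zero := by
    refine LinearMap.ext fun ⟨x, y⟩ => ?_
    rw [LinearMap.comp_apply, adjointD_apply, adjointD_apply]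
    refine Prod.ext ?_ ?_
    · change _ = (0 : TotalForms R L L)
      have h := 𝔞.d_basicL_d_basicL D x
      simp only [extendTwoForm_eq_wedgeTwo, extendOdd_eq, map_add, d_basicL_wedgeTwo,
        signOp_extendEven, signOp_signOp, Connection.signOp_d, map_neg]
      rw [← h]
      abel
    · change _ = (0 : TotalForms R L T)
      have h := 𝔞.d_basicT_d_basicT D y
      simp only [extendTwoForm_eq_wedgeTwo, extendOdd_eq, map_add, signOp_wedgeTwo,
        signOp_signOp, Connection.signOp_d, map_neg,
        Connection.d_extendEven_of_parallel (fun a b => (𝔞.anchor_basicL D a b).symm)]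
      rw [← h]
      abel
  leibniz := by
    rintro k α ⟨x, y⟩
    refine Prod.ext ?_ ?_
    · change (𝔞.basicL D).d (mulForm α x) + extendTwoForm (𝔞.basicCurvature D) (mulForm α y) =
        mulForm ((Connection.trivial R L).koszul k α) x + (-1 : ℝ) ^ k •
          mulForm α ((𝔞.basicL D).d x + extendTwoForm (𝔞.basicCurvature D) y)
      rw [d_mulForm, extendTwoForm_mulForm, map_add, smul_add, add_assoc]
    · change extendOdd 𝔞.anchor (mulForm α x) + (𝔞.basicT D).d (mulForm α y) =
        mulForm ((Connection.trivial R L).koszul k α) y + (-1 : ℝ) ^ k •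
          mulForm α (extendOdd 𝔞.anchor x + (𝔞.basicT D).d y)
      rw [d_mulForm, extendOdd_mulForm, map_add, smul_add, add_left_comm]

end AnchorData

namespace AnchorData.Quadruple

variable {𝔞 : AnchorData R L T} (q : 𝔞.Quadruple)

lemma targetD_apply (x : TotalForms R L 𝔞.kernel) (y : TotalForms R L 𝔞.Normal) :
    q.targetD (x, y) = (𝔞.moduleK.d x - extendTwoForm q.Ω y, q.moduleB.d y) := by
  refine Prod.ext rfl ?_
  exact sub_zero (q.moduleB.d y)

lemma φ_apply (x : TotalForms R L L) (y : TotalForms R L T) :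
    q.φ (x, y) = (extendEven q.prK x, extendEven 𝔞.prB y) := rfl

lemma ψ_apply (x : TotalForms R L 𝔞.kernel) (y : TotalForms R L 𝔞.Normal) :
    q.ψ (x, y) = (extendEven 𝔞.kernel.subtype x, extendEven q.j y) := rfl

lemma h_apply (x : TotalForms R L L) (y : TotalForms R L T) :
    q.h (x, y) = (-extendOdd (q.τ ∘ₗ q.prF) y, 0) := rfl

/-- If `g` maps the basic curvature to `-Ω ∘ f`, then so do the extensions to forms. -/
lemma extendEven_neg_Ω (f : T →ₗ[R] 𝔞.Normal) (g : L →ₗ[R] 𝔞.kernel)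
    (hfg : ∀ v u, g (𝔞.basicCurvature q.nablaA v u) = -q.Ω v (f u)) (y : TotalForms R L T) :
    extendEven g (wedgeTwo (𝔞.basicCurvature q.nablaA) y) = -wedgeTwo q.Ω (extendEven f y) := by
  have h := extendEven_wedgeTwo (Φ := 𝔞.basicCurvature q.nablaA) (Φ' := q.Ω) (g := -g) (f := f)
    (fun v p => by rw [LinearMap.neg_apply, hfg, neg_neg]) y
  rw [← h, extendEven_neg, neg_neg]

theorem φ_comp_adjointD : q.φ ∘ₗ 𝔞.adjointD q.nablaA = q.targetD ∘ₗ q.φ := by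
  refine LinearMap.ext fun ⟨x, y⟩ => ?_
  rw [LinearMap.comp_apply, LinearMap.comp_apply, adjointD_apply, φ_apply, φ_apply, targetD_apply]
  refine Prod.ext ?_ ?_
  · change extendEven q.prK _ = _ - _
    rw [map_add, Connection.d_extendEven_of_parallel fun a b => (q.prK_basicL a b).symm,
      extendTwoForm_eq_wedgeTwo, extendTwoForm_eq_wedgeTwo,
      q.extendEven_neg_Ω 𝔞.prB q.prK q.prK_basicCurvature, signOp_extendEven, sub_eq_add_neg]
  · change extendEven 𝔞.prB _ = q.moduleB.d _
    have h0 : 𝔞.prB ∘ₗ 𝔞.anchor = 0 := LinearMap.ext fun a => 𝔞.prB_eq_zero (𝔞.anchor_mem a)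
    rw [map_add, Connection.d_extendEven_of_parallel fun a u => (q.prB_basicT a u).symm,
      extendOdd_eq, extendEven_comp, h0, extendEven_zero, zero_add]

theorem adjointD_comp_ψ : 𝔞.adjointD q.nablaA ∘ₗ q.ψ = q.ψ ∘ₗ q.targetD := by
  refine LinearMap.ext fun ⟨x, y⟩ => ?_
  rw [LinearMap.comp_apply, LinearMap.comp_apply, ψ_apply, adjointD_apply, targetD_apply, ψ_apply]
  refine Prod.ext ?_ ?_
  · change _ + _ = extendEven 𝔞.kernel.subtype _
    have h := extendEven_wedgeTwo (Φ := q.Ω) (Φ' := 𝔞.basicCurvature q.nablaA)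
      (g := -𝔞.kernel.subtype) (f := q.j) (fun v b => by
        rw [LinearMap.neg_apply, Submodule.subtype_apply, coe_Ω, neg_neg]) (signOp y)
    rw [map_sub, Connection.d_extendEven_of_parallel (DP := 𝔞.moduleK)
        (g := 𝔞.kernel.subtype) (fun a k => q.basicL_coe_kernel a k),
      extendTwoForm_eq_wedgeTwo, extendTwoForm_eq_wedgeTwo, signOp_extendEven, ← h, extendEven_neg,
      ← sub_eq_add_neg]
  · change _ + _ = extendEven q.j _
    have h0 : 𝔞.anchor ∘ₗ 𝔞.kernel.subtype = 0 := LinearMap.ext fun k => k.2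
    rw [Connection.d_extendEven_of_parallel q.basicT_j, extendOdd_eq, signOp_extendEven,
      extendEven_comp, h0, extendEven_zero, zero_add]

theorem φ_comp_ψ : q.φ ∘ₗ q.ψ = LinearMap.id := by
  have h1 : q.prK ∘ₗ 𝔞.kernel.subtype = LinearMap.id := LinearMap.ext q.prK_kernel
  have h2 : 𝔞.prB ∘ₗ q.j = LinearMap.id := LinearMap.ext q.prB_j
  refine LinearMap.ext fun ⟨x, y⟩ => ?_
  rw [LinearMap.comp_apply, ψ_apply, φ_apply, extendEven_comp, extendEven_comp, h1, h2,
    extendEven_id, extendEven_id, LinearMap.id_apply]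

/-- The operator `d_CE - Ω` is a retract of the adjoint representation, and inherits its
properties from there. -/
theorem isRepUpToHomotopy_targetD : IsRepUpToHomotopy q.targetD where
  degree := by
    rintro n ⟨x, y⟩ ⟨hx, hy⟩
    rw [targetD_apply]
    refine ⟨fun k hk => ?_, fun k hk => ?_⟩
    · rw [DirectSum.sub_apply, apply_eq_zero_of_shift (d_shift 𝔞.moduleK) hx k (by omega),
        apply_eq_zero_of_shift (extendTwoForm_shift q.Ω) hy k (by omega), sub_zero]
    · exact apply_eq_zero_of_shift (d_shift q.moduleB) hy k (by omega)
  square_zero := by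
    have h : q.targetD ∘ₗ q.targetD ∘ₗ q.φ = 0 := by
      rw [← φ_comp_adjointD, ← LinearMap.comp_assoc, ← φ_comp_adjointD, LinearMap.comp_assoc,
        (𝔞.isRepUpToHomotopy_adjointD q.nablaA).square_zero, LinearMap.comp_zero]
    refine LinearMap.ext fun z => ?_
    have hz : q.φ (q.ψ z) = z := LinearMap.congr_fun q.φ_comp_ψ z
    rw [← hz]
    exact LinearMap.congr_fun h (q.ψ z)
  leibniz := by
    rintro k α ⟨x, y⟩
    change q.targetD (mulForm α x, mulForm α y) =
      mulPair ((Connection.trivial R L).koszul k α) (x, y) +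
        (-1 : ℝ) ^ k • mulPair α (q.targetD (x, y))
    rw [targetD_apply, targetD_apply]
    refine Prod.ext ?_ ?_
    · change 𝔞.moduleK.d (mulForm α x) - extendTwoForm q.Ω (mulForm α y) =
        mulForm ((Connection.trivial R L).koszul k α) x + (-1 : ℝ) ^ k •
          mulForm α (𝔞.moduleK.d x - extendTwoForm q.Ω y)
      rw [d_mulForm, extendTwoForm_mulForm, map_sub, smul_sub, add_sub_assoc]
    · exact d_mulForm q.moduleB α y

/-- The homotopy `h` splits off `F`: both `D h + h D` and `ψ φ - id` are minus the projections
`τ ρ` on `A` and `pr_F` on `TM`, because `τ ∘ pr_F` is parallel and the terms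
with covariant derivatives cancel. -/
theorem ψ_comp_φ : q.ψ ∘ₗ q.φ =
    LinearMap.id + (𝔞.adjointD q.nablaA ∘ₗ q.h + q.h ∘ₗ 𝔞.adjointD q.nablaA) := by
  have h1 : 𝔞.kernel.subtype ∘ₗ q.prK = LinearMap.id - q.τ ∘ₗ q.prF ∘ₗ 𝔞.anchor :=
    LinearMap.ext fun a => congrArg (a - q.τ ·) (q.prF_image (𝔞.toImage a)).symm
  have h2 : q.j ∘ₗ 𝔞.prB = LinearMap.id - 𝔞.anchor ∘ₗ q.τ ∘ₗ q.prF := LinearMap.ext fun u => by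
    change q.j (𝔞.prB u) = u - 𝔞.anchor (q.τ (q.prF u))
    rw [q.anchor_τ, prF_coe, sub_sub_cancel]
  refine LinearMap.ext fun ⟨x, y⟩ => ?_
  rw [LinearMap.comp_apply, LinearMap.add_apply, LinearMap.add_apply, LinearMap.comp_apply,
    LinearMap.comp_apply, LinearMap.id_apply, φ_apply, ψ_apply, h_apply, adjointD_apply,
    adjointD_apply, h_apply, extendEven_comp, extendEven_comp, h1, h2]
  refine Prod.ext ?_ ?_
  · change _ = x + (_ + _)
    simp only [extendOdd_eq, map_add, map_neg, map_zero, add_zero,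
      Connection.signOp_d, Connection.d_extendEven_of_parallel q.basicL_τ_prF, signOp_extendEven,
      signOp_signOp, extendEven_comp, extendEven_sub, extendEven_id, LinearMap.comp_assoc]
    abel
  · change _ = y + (_ + 0)
    simp only [extendOdd_eq, map_neg, map_zero, add_zero, signOp_extendEven,
      signOp_signOp, extendEven_comp, extendEven_sub, extendEven_id]
    abel

/-- The contraction of the adjoint representation onto `Ω_A(K[1] ⊕ B)`. -/
theorem isContraction : IsContraction (𝔞.adjointD q.nablaA) q.targetD q.φ q.ψ q.h where
  φ_degree := by
    rintro n ⟨x, y⟩ ⟨hx, hy⟩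
    exact ⟨fun k hk => apply_eq_zero_of_shift (extendEven_shift q.prK) hx k (by omega),
      fun k hk => apply_eq_zero_of_shift (extendEven_shift 𝔞.prB) hy k (by omega)⟩
  ψ_degree := by
    rintro n ⟨x, y⟩ ⟨hx, hy⟩
    exact ⟨fun k hk => apply_eq_zero_of_shift (extendEven_shift _) hx k (by omega),
      fun k hk => apply_eq_zero_of_shift (extendEven_shift q.j) hy k (by omega)⟩
  h_degree := by
    rintro n ⟨x, y⟩ ⟨hx, hy⟩
    refine ⟨fun k hk => ?_, fun k hk => rfl⟩
    have h := apply_eq_zero_of_shift (extendOdd_shift (q.τ ∘ₗ q.prF)) hy k (by omega)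
    change -(extendOdd (q.τ ∘ₗ q.prF) y k) = 0
    rw [h, neg_zero]
  φ_linear := by
    rintro k α ⟨x, y⟩
    rw [Nat.zero_mul, pow_zero, one_smul]
    exact Prod.ext (extendEven_mulForm _ α x) (extendEven_mulForm _ α y)
  ψ_linear := by
    rintro k α ⟨x, y⟩
    rw [Nat.zero_mul, pow_zero, one_smul]
    exact Prod.ext (extendEven_mulForm _ α x) (extendEven_mulForm _ α y)
  h_linear := by
    rintro k α ⟨x, y⟩
    rw [Nat.one_mul]
    change q.h (mulForm α x, mulForm α y) = _
    rw [h_apply, h_apply, extendOdd_mulForm]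
    refine Prod.ext ?_ ?_
    · change -((-1 : ℝ) ^ k • mulForm α (extendOdd (q.τ ∘ₗ q.prF) y)) =
        (-1 : ℝ) ^ k • mulForm α (-extendOdd (q.τ ∘ₗ q.prF) y)
      rw [map_neg]
      exact (smul_neg ((-1 : ℝ) ^ k) (mulForm α (extendOdd (q.τ ∘ₗ q.prF) y))).symm
    · change (0 : TotalForms R L T) = (-1 : ℝ) ^ k • mulForm α 0
      rw [map_zero, smul_zero]
  φ_comm := q.φ_comp_adjointD
  ψ_comm := q.adjointD_comp_ψ
  φ_ψ := q.φ_comp_ψ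
  ψ_φ := q.ψ_comp_φ
  h_h := by
    refine LinearMap.ext fun ⟨x, y⟩ => ?_
    rw [LinearMap.comp_apply, h_apply, h_apply, map_zero, neg_zero]
    rfl
  φ_h := by
    have h0 : q.prK ∘ₗ q.τ ∘ₗ q.prF = 0 := LinearMap.ext fun u => q.prK_τ (q.prF u)
    refine LinearMap.ext fun ⟨x, y⟩ => ?_
    rw [LinearMap.comp_apply, h_apply, φ_apply, extendOdd_eq, map_neg, extendEven_comp, h0,
      extendEven_zero, map_zero, neg_zero]
    rfl
  h_ψ := by
    have h0 : (q.τ ∘ₗ q.prF) ∘ₗ q.j = 0 := LinearMap.ext fun b => by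
      rw [LinearMap.comp_apply, LinearMap.comp_apply, prF_j, map_zero, LinearMap.zero_apply]
    refine LinearMap.ext fun ⟨x, y⟩ => ?_
    rw [LinearMap.comp_apply, ψ_apply, h_apply, extendOdd_eq, signOp_extendEven, extendEven_comp,
      h0, extendEven_zero, neg_zero]
    rfl

end AnchorData.Quadruple

end Main

end LRForms

end

theorem mainTheorem8 {m : ℕ} {M : Type*} [TopologicalSpace M]
    [ChartedSpace (EuclideanSpace ℝ (Fin m)) M] [IsManifold (𝓡 m) ∞ M] [T2Space M]
    [SigmaCompactSpace M]
    {V : Type*} [NormedAddCommGroup V] [NormedSpace ℝ V] [FiniteDimensional ℝ V]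
    {A : M → Type*} [TopologicalSpace (Bundle.TotalSpace V A)] [∀ x, TopologicalSpace (A x)]
    [∀ x, AddCommGroup (A x)] [∀ x, Module ℝ (A x)] [FiberBundle V A] [VectorBundle ℝ V A]
    [ContMDiffVectorBundle ∞ V A (𝓡 m)]
    [SmoothSections.LieAlgebroid (m := m) V A]
    (hreg : SmoothSections.LieAlgebroid.IsRegular (m := m) V A)
    (q : (SmoothSections.LieAlgebroid.anchorData m V A).Quadruple) :
    LRForms.IsRepUpToHomotopy
        ((SmoothSections.LieAlgebroid.anchorData m V A).adjointD q.nablaA) ∧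
      LRForms.IsRepUpToHomotopy q.targetD ∧
      LRForms.IsContraction ((SmoothSections.LieAlgebroid.anchorData m V A).adjointD q.nablaA)
        q.targetD q.φ q.ψ q.h :=
  ⟨LRForms.AnchorData.isRepUpToHomotopy_adjointD _ _, q.isRepUpToHomotopy_targetD,
    q.isContraction⟩
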